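/- Notation. Let $n\ge 2$. A weight is a non-negative, locally integrable function $w$ on $\mathbb{R}^n$ that is not almost everywhere zero, and $w(E)=\int_E w\,dx$. Balls are denoted by $B$, with radius $r(B)$; cubes $Q$ have sides parallel to the axes. For $r>1$ and $r'=r/(r-1)$ put $$[w]_{A_r}=\sup_B\Big(\frac1{|B|}\int_B w\,dx\Big)\Big(\frac1{|B|}\int_B w^{1-r'}dx\Big)^{r-1},$$ and $[w]_{A_1}=\|Mw/w\|_{L^\infty}$, where $Mw(x)=\sup_{B\ni x}\frac1{|B|}\int_B w\,dy$. We write $w\in A_r$ if $[w]_{A_r}<\infty$. The Fujii–Wilson constant of a weight $\sigma$ is $$[\sigma]_{A_\infty}=\sup_Q\frac1{\sigma(Q)}\int_Q M_{\mathcal Q}(\sigma\chi_Q)\,dx,\qquad M_{\mathcal Q}g(x)=\sup_{Q\ni x}\frac1{|Q|}\int_Q |g|\,dy,$$ the suprema being over all cubes. For $1\le p<n$ put $p^*=\frac{np}{n-p}$. For $1\le r\le p$ and $w\in A_r$ let $q_1=p^*$, and for $r>1$ let $q_r$ be defined by $$\frac1p-\frac1{q_r}=\frac1n\,\frac{\tau_n[\sigma]_{A_\infty}}{1+r(\tau_n[\sigma]_{A_\infty}-1)},\qquad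 \sigma=w^{1-r'},\quad \tau_n=2^{n+1}.$$ For a ball $B$ and $0<q,s<\infty$ put $$\|h\|_{L^{q,s}(B,\frac{w\,dx}{w(B)})}=\Big(q\int_0^\infty t^s\Big(\frac{w(\{x\in B:|h(x)|>t\})}{w(B)}\Big)^{s/q}\frac{dt}{t}\Big)^{1/s}.$$ Finally, $f_B=\frac1{|B|}\int_B f\,dx$. Theorem. Let $n\ge 2$. (i) There is a constant $c_n>0$ depending only on $n$ such that for all $1\le p<n$, all $1\le r\le p$, all $w\in A_r$, all balls $B$ and all $f\in L^1(B)$ with a locally integrable weak gradient $\nabla f$ on $B$, $$\Big(\frac1{w(B)}\int_B|f-f_B|^{q_r}w\,dx\Big)^{1/q_r}\le c_n\,p^*\,[w]_{A_r}^{1/p}\,r(B)\Big(\frac1{w(B)}\int_B|\nabla f|^p w\,dx\Big)^{1/p},$$ and, moreover, $$\|f-f_B\|_{L^{q_r,p}(B,\frac{w\,dx}{w(B)})}\le c_n\,p^*\,[w]_{A_r}^{1/p}\,r(B)\Big(\frac1{w(B)}\int_B|\nabla f|^p w\,dx\Big)^{1/p}$$ (the right-hand sides may be $+\infty$). In particular,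 for $r=1$ both hold with $q_1=p^*$ and constant $c_n\,p^*\,[w]_{A_1}^{1/p}$. (ii) The exponent $1/p$ of $[w]_{A_r}$ in the first inequality is sharp: let $1\le p<n$, $1\le r\le p$ and $\beta,C\in\mathbb{R}$. If $$\Big(\frac1{w(B)}\int_B|f-f_B|^{q_r}w\,dx\Big)^{1/q_r}\le C\,[w]_{A_r}^{\beta}\,r(B)\Big(\frac1{w(B)}\int_B|\nabla f|^p w\,dx\Big)^{1/p}$$ for all $w\in A_r$, all balls $B$ and all $f$ as in (i), then $\beta\ge 1/p$. -/

import Mathlib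

open MeasureTheory Metric
open scoped ENNReal ContDiff

namespace PoincareSobolev

noncomputable section

/-- The uncentred Hardy-Littlewood maximal function over balls, for a nonnegative function. -/
def ballMaximal {n : ℕ} (w : EuclideanSpace ℝ (Fin n) → ℝ≥0∞)
    (x : EuclideanSpace ℝ (Fin n)) : ℝ≥0∞ :=
  ⨆ (c : EuclideanSpace ℝ (Fin n)) (R : ℝ) (_ : x ∈ ball c R), ⨍⁻ y in ball c R, w y ∂volume

/-- The Muckenhoupt constant `[w]_{A_r}`, `1 ≤ r < ∞`: the essential supremum of `Mw / w` if
`r = 1`, and the supremum over all balls of `(⨍ w) (⨍ w ^ (1 - r')) ^ (r - 1)` if `r > 1`. -/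
def apConst {n : ℕ} (r : ℝ) (w : EuclideanSpace ℝ (Fin n) → ℝ≥0∞) : ℝ≥0∞ :=
  if r = 1 then essSup (fun x => ballMaximal w x / w x) volume
  else ⨆ (c : EuclideanSpace ℝ (Fin n)) (R : ℝ) (_ : 0 < R),
    (⨍⁻ y in ball c R, w y ∂volume) *
      (⨍⁻ y in ball c R, w y ^ (1 - Real.conjExponent r) ∂volume) ^ (r - 1)

/-- `w` is a weight (nonnegative, locally integrable, not almost everywhere zero) of
class `A_r`. -/
structure IsApWeight {n : ℕ} (r : ℝ) (w : EuclideanSpace ℝ (Fin n) → ℝ≥0∞) : Prop where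
  aemeasurable : AEMeasurable w volume
  lintegral_ball_lt_top : ∀ (c : EuclideanSpace ℝ (Fin n)) (R : ℝ), ∫⁻ x in ball c R, w x < ⊤
  not_ae_zero : ¬ w =ᵐ[volume] 0
  apConst_lt_top : apConst r w < ⊤

/-- The open cube with centre `c`, side length `l` and sides parallel to the axes. -/
def cube {n : ℕ} (c : EuclideanSpace ℝ (Fin n)) (l : ℝ) : Set (EuclideanSpace ℝ (Fin n)) :=
  {x | ∀ i, |x i - c i| < l / 2}

/-- The uncentred Hardy-Littlewood maximal function over cubes, for a nonnegative function. -/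
def cubeMaximal {n : ℕ} (w : EuclideanSpace ℝ (Fin n) → ℝ≥0∞)
    (x : EuclideanSpace ℝ (Fin n)) : ℝ≥0∞ :=
  ⨆ (c : EuclideanSpace ℝ (Fin n)) (l : ℝ) (_ : 0 < l) (_ : x ∈ cube c l), ⨍⁻ y in cube c l, w y ∂volume

/-- The Fujii-Wilson constant `[w]_{A_∞}`: the supremum over all cubes `Q` of
`w(Q)⁻¹ ∫_Q M(w χ_Q)`. -/
def aInftyConst {n : ℕ} (w : EuclideanSpace ℝ (Fin n) → ℝ≥0∞) : ℝ≥0∞ :=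
  ⨆ (c : EuclideanSpace ℝ (Fin n)) (l : ℝ) (_ : 0 < l),
    (∫⁻ x in cube c l, cubeMaximal ((cube c l).indicator w) x) / ∫⁻ x in cube c l, w x

/-- The dual weight `σ = w ^ (1 - r')`, used for `r > 1`. -/
def dualWeight {n : ℕ} (r : ℝ) (w : EuclideanSpace ℝ (Fin n) → ℝ≥0∞) :
    EuclideanSpace ℝ (Fin n) → ℝ≥0∞ :=
  fun x => w x ^ (1 - Real.conjExponent r)

/-- The classical Sobolev exponent `p^* = n p / (n - p)`. -/
def sobolevExponent (n : ℕ) (p : ℝ) : ℝ := n * p / (n - p)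

/-- The weighted Sobolev exponent `q_r`: `q_1 = p^*`, and for `r > 1` it is given by
`1 / p - 1 / q_r = (1 / n) * (τ A / (1 + r (τ A - 1)))`, where `τ = 2 ^ (n + 1)` and
`A = [σ]_{A_∞}`. -/
def weightedSobolevExponent {n : ℕ} (p r : ℝ) (w : EuclideanSpace ℝ (Fin n) → ℝ≥0∞) : ℝ :=
  if r = 1 then sobolevExponent n p
  else (1 / p - 1 / n * (2 ^ (n + 1) * (aInftyConst (dualWeight r w)).toReal /
    (1 + r * (2 ^ (n + 1) * (aInftyConst (dualWeight r w)).toReal - 1))))⁻¹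

/-- `G` is the weak gradient of `f` on the open set `U`. -/
structure HasWeakGradientOn {n : ℕ} (U : Set (EuclideanSpace ℝ (Fin n)))
    (f : EuclideanSpace ℝ (Fin n) → ℝ)
    (G : EuclideanSpace ℝ (Fin n) → EuclideanSpace ℝ (Fin n)) : Prop where
  locallyIntegrableOn_fun : LocallyIntegrableOn f U volume
  locallyIntegrableOn_grad : LocallyIntegrableOn G U volume
  integral_eq : ∀ φ : EuclideanSpace ℝ (Fin n) → ℝ, ContDiff ℝ ∞ φ → HasCompactSupport φ →
    tsupport φ ⊆ U → ∀ v : EuclideanSpace ℝ (Fin n),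
      ∫ x in U, f x * fderiv ℝ φ x v = - ∫ x in U, inner ℝ (G x) v * φ x

/-- The weighted `L^q` average `(w(B)⁻¹ ∫_B |h|^q w) ^ (1 / q)`. -/
def weightedLpAvg {n : ℕ} {F : Type*} [NormedAddCommGroup F] (q : ℝ)
    (w : EuclideanSpace ℝ (Fin n) → ℝ≥0∞) (B : Set (EuclideanSpace ℝ (Fin n)))
    (h : EuclideanSpace ℝ (Fin n) → F) : ℝ≥0∞ :=
  ((∫⁻ x in B, ‖h x‖ₑ ^ q * w x) / ∫⁻ x in B, w x) ^ (1 / q)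

/-- The weighted Lorentz average
`(q ∫_0^∞ t^s (w({x ∈ B : |h x| > t}) / w(B)) ^ (s / q) dt / t) ^ (1 / s)`, i.e. the norm of
`L^{q,s}(B, w dx / w(B))`, for `s < ∞`. -/
def weightedLorentzAvg {n : ℕ} (q s : ℝ)
    (w : EuclideanSpace ℝ (Fin n) → ℝ≥0∞) (B : Set (EuclideanSpace ℝ (Fin n)))
    (h : EuclideanSpace ℝ (Fin n) → ℝ) : ℝ≥0∞ :=
  (ENNReal.ofReal q * ∫⁻ t in Set.Ioi (0 : ℝ), ENNReal.ofReal t ^ s *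
    ((∫⁻ x in {x ∈ B | t < |h x|}, w x) / ∫⁻ x in B, w x) ^ (s / q) / ENNReal.ofReal t) ^ (1 / s)

end

end PoincareSobolev

/-! Part (i) uses the weight only through the two-ball condition `HasPairBound`: the s-th power of
the average of g over a ball, times the w-mass of a larger concentric ball, is at most K(ρ₀/ρ)^(ns)
∫ g^s w. An A_r weight has it with s = r by Hölder's inequality. The exponent q_r requires a smaller
s, and this comes from the reverse Hölder inequality for σ = w^(1-r') with exponent 1 + ε, where ε =
1/(τ_n[σ]_{A_∞} − 1): it puts w in A_s for s − 1 = (r − 1)/(1 + ε), with constant at most a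
dimensional multiple of [w]_{A_r}, and 1/q_r = 1/p − 1/(ns).

The function |f − f_B| is dominated by the Riesz potential of |∇f|, which is cut into dyadic annuli
in the manner of Hedberg. The fine annuli are controlled by a centred maximal function with respect
to the measure w; the coarse ones by Hölder's inequality, where disjointness of the annuli keeps the
cost at q^(1-1/p). Besicovitch's theorem bounds the maximal function without any doubling constant
of w, so the weight constant enters to the power 1/p only. This is `exists_weak_type`.

Maz'ya's truncation method turns the weak bound into a strong one. The weak bound is applied to
smooth truncations of f at levels l and 2l; the gradients of the truncations live on disjoint
shells, so summing over dyadic levels gives the Lorentz norm L^{q,p}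
(`exists_weightedLorentzAvg_le`). The factor q in that norm meets the factor q^(p-1) of the weak
bound, and after a p-th root the dependence on q ≤ p^* is linear. Finally L^{q,p} embeds in L^q with
constant one.

For (ii), the weights |x|^(δ-n) have A_r constant at most of order 1/δ, while w(B) is of order 1/δ.
A bump that is constant near the origin keeps the left side bounded below, and its gradient average
is of order δ^(1/p). Letting δ → 0 forces β ≥ 1/p. -/

namespace PoincareSobolev

/-! ### Riesz kernel and the representation formula for smooth functions -/

section Kernel

open Module

variable {E : Type*} [NormedAddCommGroup E] [NormedSpace ℝ E] [MeasurableSpace E] [BorelSpace E]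
  [FiniteDimensional ℝ E] (μ : Measure E) [μ.IsAddHaarMeasure]

/-- Polar coordinates. The case δ = 1 gives the mass of the Riesz kernel; small δ gives the factor
1/δ behind the sharpness example. -/
theorem lintegral_ball_zero_enorm_rpow [Nontrivial E] {δ R : ℝ} (hδ : 0 < δ) (hR : 0 < R) :
    ∫⁻ y in ball (0 : E) R, ‖y‖ₑ ^ (δ - finrank ℝ E) ∂μ =
      ENNReal.ofReal (finrank ℝ E * R ^ δ / δ) * μ (ball 0 1) := by
  set d := finrank ℝ E with hd
  have hd1 : 1 ≤ d := finrank_pos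
  have hpow : ∀ y : ℝ, 0 < y → y ^ (d - 1) • y ^ (δ - d) = y ^ (δ - 1) := by
    intro y hy
    rw [smul_eq_mul, ← Real.rpow_natCast, ← Real.rpow_add hy, Nat.cast_sub hd1]
    congr 1; push_cast; ring
  have hint : IntegrableOn (fun y : ℝ => y ^ (δ - 1)) (Set.Ioo 0 R) := by
    have := intervalIntegral.intervalIntegrable_rpow' (a := 0) (b := R) (r := δ - 1) (by linarith)
    rw [intervalIntegrable_iff_integrableOn_Ioo_of_le hR.le] at this
    exact this
  have hintE : IntegrableOn (fun y : E => ‖y‖ ^ (δ - d)) (ball 0 R) μ := by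
    rw [integrableOn_fun_norm_addHaar μ (f := fun y : ℝ => y ^ (δ - d))]
    refine hint.congr_fun (fun y hy => (hpow y hy.1).symm) measurableSet_Ioo
  have h1 : ∫⁻ y in ball (0 : E) R, ‖y‖ₑ ^ (δ - d) ∂μ =
      ∫⁻ y in ball (0 : E) R, ENNReal.ofReal (‖y‖ ^ (δ - d)) ∂μ := by
    refine lintegral_congr_ae (ae_restrict_of_ae ?_)
    have : ∀ᵐ y ∂μ, y ≠ (0 : E) := by simp [ae_iff]
    filter_upwards [this] with y hy
    rw [← ofReal_norm, ENNReal.ofReal_rpow_of_pos (norm_pos_iff.2 hy)]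
  rw [h1, ← ofReal_integral_eq_lintegral_ofReal hintE
    (Filter.Eventually.of_forall fun y => by positivity)]
  have h2 : ∫ y in ball (0 : E) R, ‖y‖ ^ (δ - d) ∂μ =
      ∫ y : E, (Set.Iio R).indicator (fun t => t ^ (δ - d)) ‖y‖ ∂μ := by
    rw [← integral_indicator measurableSet_ball]
    congr 1; ext y; simp [Set.indicator]
  have h3 : ∫ y in Set.Ioi (0 : ℝ), y ^ (d - 1) • (Set.Iio R).indicator (fun t => t ^ (δ - d)) y =
      R ^ δ / δ := by
    have : ∫ y in Set.Ioi (0 : ℝ), y ^ (d - 1) • (Set.Iio R).indicator (fun t => t ^ (δ - d)) y =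
        ∫ y in Set.Ioi (0 : ℝ), (Set.Iio R).indicator (fun t => t ^ (δ - 1)) y := by
      refine setIntegral_congr_fun measurableSet_Ioi fun y hy => ?_
      by_cases h : y < R
      · simp only [Set.indicator, Set.mem_Iio, h, if_true]; exact hpow y hy
      · simp [h]
    rw [this, setIntegral_indicator measurableSet_Iio, Set.Ioi_inter_Iio,
      ← integral_Ioc_eq_integral_Ioo, ← intervalIntegral.integral_of_le hR.le,
      integral_rpow (Or.inl (by linarith))]
    simp [Real.zero_rpow hδ.ne']
  rw [h2, integral_fun_norm_addHaar μ, h3, nsmul_eq_mul, smul_eq_mul, Measure.real,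
    mul_left_comm, ENNReal.ofReal_mul ENNReal.toReal_nonneg,
    ENNReal.ofReal_toReal measure_ball_lt_top.ne, mul_comm, mul_div_assoc]

/-- The ball of twice the radius about the singularity contains the given one, so the bound is
uniform in z. -/
theorem lintegral_ball_enorm_sub_rpow_le [Nontrivial E] {R : ℝ} (hR : 0 < R) {x₀ z : E}
    (hz : z ∈ ball x₀ R) :
    ∫⁻ x in ball x₀ R, ‖x - z‖ₑ ^ (1 - (finrank ℝ E : ℝ)) ∂μ ≤
      ENNReal.ofReal (finrank ℝ E * (2 * R)) * μ (ball 0 1) := by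
  calc ∫⁻ x in ball x₀ R, ‖x - z‖ₑ ^ (1 - (finrank ℝ E : ℝ)) ∂μ
      ≤ ∫⁻ x in ball z (2 * R), ‖x - z‖ₑ ^ (1 - (finrank ℝ E : ℝ)) ∂μ := by
        refine lintegral_mono_set (ball_subset_ball' ?_)
        rw [mem_ball'] at hz; linarith
    _ = ∫⁻ y in ball (0 : E) (2 * R), ‖y‖ₑ ^ (1 - (finrank ℝ E : ℝ)) ∂μ := by
        rw [← lintegral_indicator measurableSet_ball, ← lintegral_indicator measurableSet_ball,
          ← lintegral_sub_right_eq_self ((ball (0 : E) (2 * R)).indicator _) z]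
        congr 1; ext y
        simp [Set.indicator, dist_eq_norm]
    _ = _ := by
        rw [lintegral_ball_zero_enorm_rpow μ one_pos (by positivity)]
        simp

theorem lintegral_comp_smul_addHaar {g : E → ℝ≥0∞} {t : ℝ} (ht : 0 < t) :
    ∫⁻ v, g (t • v) ∂μ = ENNReal.ofReal (t ^ (-(finrank ℝ E : ℝ))) * ∫⁻ v, g v ∂μ := by
  have h := Measure.map_addHaar_smul μ ht.ne'
  have h2 : ∫⁻ v, g (t • v) ∂μ = ∫⁻ v, g v ∂(Measure.map (t • ·) μ) :=
    ((Homeomorph.smulOfNeZero t ht.ne').toMeasurableEquiv.measurableEmbedding.lintegral_map g).symm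
  rw [h2, h, lintegral_smul_measure, smul_eq_mul, abs_of_pos (by positivity),
    Real.rpow_neg ht.le, Real.rpow_natCast]

omit [MeasurableSpace E] [BorelSpace E] [FiniteDimensional ℝ E] in
theorem enorm_sub_le_lintegral_fderiv {u : E → ℝ} (hu : ContDiff ℝ 1 u) (x v : E) :
    ‖u (x + v) - u x‖ₑ ≤ ∫⁻ t in Set.Ioo (0 : ℝ) 1, ‖fderiv ℝ u (x + t • v)‖ₑ * ‖v‖ₑ := by
  have hd : ∀ t : ℝ, HasDerivAt (fun t : ℝ => u (x + t • v)) (fderiv ℝ u (x + t • v) v) t := by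
    intro t
    have h1 : HasDerivAt (fun t : ℝ => x + t • v) v t := by
      simpa using ((hasDerivAt_id t).smul_const v).const_add x
    exact ((hu.differentiable one_ne_zero) (x + t • v)).hasFDerivAt.comp_hasDerivAt t h1
  have hc : Continuous fun t : ℝ => fderiv ℝ u (x + t • v) v :=
    ((hu.continuous_fderiv one_ne_zero).comp (by fun_prop)).clm_apply continuous_const
  have h := intervalIntegral.integral_eq_sub_of_hasDerivAt (a := 0) (b := 1)
    (fun t _ => hd t) (hc.intervalIntegrable _ _)
  simp only [one_smul, zero_smul, add_zero] at h
  rw [← h, intervalIntegral.integral_of_le zero_le_one, integral_Ioc_eq_integral_Ioo]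
  refine (enorm_integral_le_lintegral_enorm _).trans (lintegral_mono fun t => ?_)
  exact ContinuousLinearMap.le_opENorm _ _

theorem lintegral_Ioo_rpow_le {a : ℝ} (ha : 0 < a) {d : ℝ} (hd : 0 < d) :
    ∫⁻ t in Set.Ioi a, ENNReal.ofReal (t ^ (-d - 1)) ≤ ENNReal.ofReal (a ^ (-d) / d) := by
  rw [← ofReal_integral_eq_lintegral_ofReal
    ((integrableOn_Ioi_rpow_iff ha).2 (by linarith))
    ((ae_restrict_iff' measurableSet_Ioi).2 (Filter.Eventually.of_forall fun t ht =>
      Real.rpow_nonneg (ha.trans ht).le _)),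
    integral_Ioi_rpow_of_lt (by linarith) ha]
  refine le_of_eq ?_
  congr 1
  rw [show -d - 1 + 1 = -d by ring, neg_div_neg_eq]

/-- Pointwise control of a `C^1` function by the Riesz potential of its gradient. -/
theorem enorm_sub_average_le_of_contDiff [Nontrivial E] {u : E → ℝ} (hu : ContDiff ℝ 1 u)
    {x₀ x : E} {R : ℝ} (hx : x ∈ ball x₀ R) :
    ‖u x - ⨍ y in ball x₀ R, u y ∂μ‖ₑ ≤
      ENNReal.ofReal (2 ^ finrank ℝ E / finrank ℝ E) / μ (ball 0 1) *
        ∫⁻ z in ball x₀ R, ‖fderiv ℝ u z‖ₑ * ‖x - z‖ₑ ^ (1 - (finrank ℝ E : ℝ)) ∂μ := by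
  set d := finrank ℝ E with hd
  have hd0 : (0 : ℝ) < d := by exact_mod_cast (finrank_pos : 0 < finrank ℝ E)
  have hR : 0 < R := by
    have := (dist_nonneg (x := x) (y := x₀)); rw [mem_ball] at hx; linarith
  set B := ball x₀ R with hB
  have hμB0 : μ B ≠ 0 := (measure_ball_pos μ x₀ hR).ne'
  have hμB : μ B ≠ ⊤ := measure_ball_lt_top.ne
  have hfd : Continuous (fderiv ℝ u) := hu.continuous_fderiv one_ne_zero
  have hui : IntegrableOn u B μ :=
    (hu.continuous.continuousOn.integrableOn_compact
      (isCompact_closedBall x₀ R)).mono_set ball_subset_closedBall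
  have hprob : IsProbabilityMeasure ((μ B)⁻¹ • μ.restrict B) :=
    ⟨by simp [ENNReal.inv_mul_cancel hμB0 hμB]⟩
  have h1 : ‖u x - ⨍ y in B, u y ∂μ‖ₑ ≤ (μ B)⁻¹ * ∫⁻ y in B, ‖u y - u x‖ₑ ∂μ := by
    have : u x - ⨍ y in B, u y ∂μ = - ⨍ y in B, (u y - u x) ∂μ := by
      rw [setAverage_eq', setAverage_eq', integral_sub, integral_const]
      · simp
      · exact (hui.integrable).smul_measure (ENNReal.inv_ne_top.2 hμB0)
      · exact integrable_const _
    rw [this, enorm_neg, setAverage_eq']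
    refine (enorm_integral_le_lintegral_enorm _).trans ?_
    rw [lintegral_smul_measure, smul_eq_mul]
  set g : E → ℝ≥0∞ := B.indicator fun z => ‖fderiv ℝ u z‖ₑ with hg
  have hgm : Measurable g := (hfd.enorm.measurable).indicator measurableSet_ball
  -- polar form of the double integral
  have h2 : ∫⁻ y in B, ‖u y - u x‖ₑ ∂μ ≤
      ∫⁻ v, (∫⁻ t in Set.Ioo (0 : ℝ) 1, (ball (0 : E) (2 * R)).indicator
        (fun v => g (x + t • v) * ‖v‖ₑ) v) ∂μ := by
    calc ∫⁻ y in B, ‖u y - u x‖ₑ ∂μ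
        = ∫⁻ v, B.indicator (fun y => ‖u y - u x‖ₑ) (x + v) ∂μ := by
          rw [lintegral_add_left_eq_self (μ := μ)
            (B.indicator (fun y => ‖u y - u x‖ₑ)) x, lintegral_indicator measurableSet_ball]
      _ ≤ _ := by
          refine lintegral_mono fun v => ?_
          by_cases hv : x + v ∈ B
          · rw [Set.indicator_of_mem hv]
            refine (enorm_sub_le_lintegral_fderiv hu x v).trans ?_
            refine setLIntegral_mono' measurableSet_Ioo fun t ht => ?_
            have hv2 : v ∈ ball (0 : E) (2 * R) := by
              rw [mem_ball_zero_iff]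
              have h3 := dist_triangle (x + v) x₀ x
              rw [dist_eq_norm, add_sub_cancel_left] at h3
              rw [hB, mem_ball] at hv
              rw [hB, mem_ball'] at hx
              linarith
            have hm : x + t • v ∈ B := by
              have := (convex_ball x₀ R).add_smul_sub_mem hx hv ⟨ht.1.le, ht.2.le⟩
              simpa [hB] using this
            rw [Set.indicator_of_mem hv2, hg, Set.indicator_of_mem hm]
          · rw [Set.indicator_of_notMem hv]; exact zero_le
  -- For fixed t replace v by t⁻¹v: the Jacobian gives t^(-d), the factor ‖v‖ gives one more t⁻¹,
  -- and the ball of radius 2R becomes one of radius 2Rt.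
  have h3 : ∫⁻ v, (∫⁻ t in Set.Ioo (0 : ℝ) 1, (ball (0 : E) (2 * R)).indicator
        (fun v => g (x + t • v) * ‖v‖ₑ) v) ∂μ =
      ∫⁻ v, (∫⁻ t in Set.Ioo (0 : ℝ) 1, ENNReal.ofReal (t ^ (-(d : ℝ) - 1)) *
        ((ball (0 : E) (2 * R * t)).indicator (fun v => g (x + v) * ‖v‖ₑ) v)) ∂μ := by
    have hms : MeasurableSet {p : E × ℝ | p.1 ∈ ball (0 : E) (2 * R * p.2)} := by
      simp only [mem_ball_zero_iff]
      exact measurableSet_lt (by fun_prop) (by fun_prop)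
    have m1 : AEMeasurable (Function.uncurry fun (v : E) (t : ℝ) =>
        (ball (0 : E) (2 * R)).indicator (fun v => g (x + t • v) * ‖v‖ₑ) v)
        (μ.prod (volume.restrict (Set.Ioo 0 1))) := by
      refine Measurable.aemeasurable ?_
      have : Measurable fun p : E × ℝ => g (x + p.2 • p.1) * ‖p.1‖ₑ :=
        (hgm.comp (by fun_prop)).mul (by fun_prop)
      exact this.indicator (s := {p : E × ℝ | p.1 ∈ ball (0 : E) (2 * R)})
        (measurable_fst measurableSet_ball)
    have m2 : AEMeasurable (Function.uncurry fun (v : E) (t : ℝ) =>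
        ENNReal.ofReal (t ^ (-(d : ℝ) - 1)) *
          ((ball (0 : E) (2 * R * t)).indicator (fun v => g (x + v) * ‖v‖ₑ) v))
        (μ.prod (volume.restrict (Set.Ioo 0 1))) := by
      refine Measurable.aemeasurable ?_
      refine Measurable.mul (f := fun p : E × ℝ => ENNReal.ofReal (p.2 ^ (-(d : ℝ) - 1)))
        (by fun_prop) ?_
      have : Measurable fun p : E × ℝ => g (x + p.1) * ‖p.1‖ₑ :=
        (hgm.comp (by fun_prop)).mul (by fun_prop)
      exact this.indicator hms
    rw [lintegral_lintegral_swap m1, lintegral_lintegral_swap m2]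
    refine setLIntegral_congr_fun measurableSet_Ioo fun t ht => ?_
    have h4 := lintegral_comp_smul_addHaar μ (t := t⁻¹) (inv_pos.2 ht.1)
      (g := (ball (0 : E) (2 * R)).indicator (fun v => g (x + t • v) * ‖v‖ₑ))
    have ht1 : 0 < t := ht.1
    have ht0 : t ≠ 0 := ht1.ne'
    rw [lintegral_const_mul' _ _ ENNReal.ofReal_ne_top]
    have h5 : ∀ v, (ball (0 : E) (2 * R)).indicator (fun v => g (x + t • v) * ‖v‖ₑ) (t⁻¹ • v) =
        ENNReal.ofReal t⁻¹ *
          (ball (0 : E) (2 * R * t)).indicator (fun v => g (x + v) * ‖v‖ₑ) v := by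
      intro v
      have hiff : t⁻¹ • v ∈ ball (0 : E) (2 * R) ↔ v ∈ ball (0 : E) (2 * R * t) := by
        rw [mem_ball_zero_iff, mem_ball_zero_iff, norm_smul, Real.norm_of_nonneg
          (inv_nonneg.2 ht.1.le), inv_mul_eq_div, div_lt_iff₀ ht.1]
      by_cases hv : v ∈ ball (0 : E) (2 * R * t)
      · rw [Set.indicator_of_mem hv, Set.indicator_of_mem (hiff.2 hv), smul_smul,
          mul_inv_cancel₀ ht0, one_smul, enorm_smul, Real.enorm_eq_ofReal (inv_nonneg.2 ht.1.le)]
        ring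
      · rw [Set.indicator_of_notMem hv, Set.indicator_of_notMem (fun h => hv (hiff.1 h)),
          mul_zero]
    simp_rw [h5] at h4
    rw [lintegral_const_mul' _ _ ENNReal.ofReal_ne_top] at h4
    rw [Real.rpow_sub ht.1, Real.rpow_one, div_eq_mul_inv, ENNReal.ofReal_mul (by positivity),
      mul_assoc, h4, ← mul_assoc, ← ENNReal.ofReal_mul (by positivity),
      Real.inv_rpow ht.1.le, Real.rpow_neg ht.1.le, inv_inv, inv_mul_cancel₀ (by positivity),
      ENNReal.ofReal_one, one_mul]
  -- The cutoff now forces t > ‖v‖/(2R); integrating t^(-d-1) over such t produces the kernel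
  -- ‖v‖^(1-d).
  have h4 : ∀ v : E, v ≠ 0 → ∫⁻ t in Set.Ioo (0 : ℝ) 1, ENNReal.ofReal (t ^ (-(d : ℝ) - 1)) *
        ((ball (0 : E) (2 * R * t)).indicator (fun v => g (x + v) * ‖v‖ₑ) v) ≤
      ENNReal.ofReal ((2 * R) ^ d / d) * (g (x + v) * ‖v‖ₑ ^ (1 - (d : ℝ))) := by
    intro v hv
    have hv0 : 0 < ‖v‖ := norm_pos_iff.2 hv
    have hgf : g (x + v) ≠ ⊤ := by
      rw [hg]; by_cases h : x + v ∈ B <;> simp [h]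
    calc _ ≤ ∫⁻ t in Set.Ioi (‖v‖ / (2 * R)), ENNReal.ofReal (t ^ (-(d : ℝ) - 1)) *
          (g (x + v) * ‖v‖ₑ) := by
          rw [← lintegral_indicator measurableSet_Ioo, ← lintegral_indicator measurableSet_Ioi]
          refine lintegral_mono fun t => ?_
          by_cases h1 : t ∈ Set.Ioo (0 : ℝ) 1
          · rw [Set.indicator_of_mem h1]
            by_cases h2 : v ∈ ball (0 : E) (2 * R * t)
            · rw [Set.indicator_of_mem h2, Set.indicator_of_mem]
              rw [mem_ball_zero_iff] at h2
              rw [Set.mem_Ioi, div_lt_iff₀ (by positivity)]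
              linarith
            · rw [Set.indicator_of_notMem h2, mul_zero]; exact zero_le
          · rw [Set.indicator_of_notMem h1]; exact zero_le
      _ = (∫⁻ t in Set.Ioi (‖v‖ / (2 * R)), ENNReal.ofReal (t ^ (-(d : ℝ) - 1))) *
          (g (x + v) * ‖v‖ₑ) :=
          lintegral_mul_const' _ _ (ENNReal.mul_ne_top hgf enorm_ne_top)
      _ ≤ ENNReal.ofReal ((‖v‖ / (2 * R)) ^ (-(d : ℝ)) / d) * (g (x + v) * ‖v‖ₑ) := by
          gcongr
          exact lintegral_Ioo_rpow_le (by positivity) hd0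
      _ = ENNReal.ofReal ((2 * R) ^ d / d) * (g (x + v) * ‖v‖ₑ ^ (1 - (d : ℝ))) := by
          have : (‖v‖ / (2 * R)) ^ (-(d : ℝ)) / d = (2 * R) ^ d / d * ‖v‖ ^ (-(d : ℝ)) := by
            rw [Real.div_rpow hv0.le (by positivity), Real.rpow_neg (by positivity : 0 ≤ 2 * R),
              Real.rpow_natCast]
            field_simp
          rw [this, ENNReal.ofReal_mul (by positivity), ← ENNReal.ofReal_rpow_of_pos hv0,
            ofReal_norm, sub_eq_add_neg, ENNReal.rpow_add _ _ (by simpa using hv)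
            enorm_ne_top, ENNReal.rpow_one]
          ring
  have h5 : ∫⁻ y in B, ‖u y - u x‖ₑ ∂μ ≤ ENNReal.ofReal ((2 * R) ^ d / d) *
      ∫⁻ z in B, ‖fderiv ℝ u z‖ₑ * ‖x - z‖ₑ ^ (1 - (d : ℝ)) ∂μ := by
    rw [h3] at h2
    refine h2.trans ?_
    rw [← lintegral_const_mul' _ _ ENNReal.ofReal_ne_top, ← lintegral_indicator measurableSet_ball,
      ← lintegral_add_left_eq_self (μ := μ) ((ball x₀ R).indicator _) x]
    refine lintegral_mono_ae ?_
    have : ∀ᵐ y ∂μ, y ≠ (0 : E) := by simp [ae_iff]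
    filter_upwards [this] with v hv
    refine (h4 v hv).trans (le_of_eq ?_)
    by_cases h : x + v ∈ B
    · rw [hg, Set.indicator_of_mem h, Set.indicator_of_mem h]
      simp
    · rw [hg, Set.indicator_of_notMem h, Set.indicator_of_notMem h]
      simp
  refine h1.trans ((mul_le_mul_right h5 _).trans (le_of_eq ?_))
  rw [← mul_assoc]
  congr 1
  rw [hB, Measure.addHaar_ball_of_pos μ x₀ hR, mul_pow, ← hd,
    ENNReal.mul_inv (Or.inl (by positivity)) (Or.inl ENNReal.ofReal_ne_top),
    div_eq_mul_inv _ (μ (ball 0 1)), show (2 : ℝ) ^ d * R ^ d / d = R ^ d * (2 ^ d / d) by ring,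
    ENNReal.ofReal_mul (by positivity)]
  have : ENNReal.ofReal (R ^ d) ≠ 0 := by positivity
  calc _ = ((ENNReal.ofReal (R ^ d))⁻¹ * ENNReal.ofReal (R ^ d)) *
        (ENNReal.ofReal (2 ^ d / d) * (μ (ball 0 1))⁻¹) := by ring
    _ = _ := by rw [ENNReal.inv_mul_cancel this ENNReal.ofReal_ne_top, one_mul]

end Kernel

/-! ### Mollification of Sobolev functions -/

section Mollification

open Filter Topology

/-- Fatou's lemma for the nonnegative functions |X_j| + |Y| − |X_j − Y|, which tend to 2|Y| and
whose integrals together with ∫|X_j − Y| stay below 2∫|Y|. It upgrades a.e. convergence of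
mollifications to L¹ convergence. -/
theorem tendsto_lintegral_enorm_sub_of_ae_tendsto {α F : Type*} [MeasurableSpace α]
    [NormedAddCommGroup F] {μ : Measure α} {X : ℕ → α → F} {Y : α → F}
    (hX : ∀ j, AEStronglyMeasurable (X j) μ) (hY : Integrable Y μ)
    (hle : ∀ j, ∫⁻ x, ‖X j x‖ₑ ∂μ ≤ ∫⁻ x, ‖Y x‖ₑ ∂μ)
    (hlim : ∀ᵐ x ∂μ, Tendsto (fun j => X j x) atTop (𝓝 (Y x))) :
    Tendsto (fun j => ∫⁻ x, ‖X j x - Y x‖ₑ ∂μ) atTop (𝓝 0) := by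
  set S := ∫⁻ x, ‖Y x‖ₑ ∂μ with hS
  have hSf : S ≠ ⊤ := hY.2.ne
  have hsum : ∀ j, ∫⁻ x, (‖X j x‖ₑ + ‖Y x‖ₑ - ‖X j x - Y x‖ₑ) ∂μ + ∫⁻ x, ‖X j x - Y x‖ₑ ∂μ
      ≤ 2 * S := by
    intro j
    have hm : AEMeasurable (fun x => ‖X j x - Y x‖ₑ) μ := ((hX j).sub hY.1).enorm
    rw [← lintegral_add_right' _ hm, two_mul]
    calc _ = ∫⁻ x, (‖X j x‖ₑ + ‖Y x‖ₑ) ∂μ := by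
          refine lintegral_congr fun x => tsub_add_cancel_of_le ?_
          exact enorm_sub_le
      _ = ∫⁻ x, ‖X j x‖ₑ ∂μ + S := lintegral_add_right' _ hY.1.enorm
      _ ≤ S + S := by gcongr; exact hle j
  have hfatou : 2 * S ≤
      liminf (fun j => ∫⁻ x, (‖X j x‖ₑ + ‖Y x‖ₑ - ‖X j x - Y x‖ₑ) ∂μ) atTop := by
    refine le_trans ?_ (lintegral_liminf_le' fun j =>
      ((hX j).enorm.add hY.1.enorm).sub ((hX j).sub hY.1).enorm)
    rw [hS, ← lintegral_const_mul' _ _ (by simp)]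
    refine lintegral_mono_ae ?_
    filter_upwards [hlim] with x hx
    have h1 : Tendsto (fun j => ‖X j x‖ₑ + ‖Y x‖ₑ - ‖X j x - Y x‖ₑ) atTop
        (𝓝 (‖Y x‖ₑ + ‖Y x‖ₑ - 0)) := by
      refine ENNReal.Tendsto.sub (hx.enorm.add tendsto_const_nhds) ?_ (Or.inr (by simp))
      have := (hx.sub_const (Y x)).enorm
      simpa using this
    rw [h1.liminf_eq, tsub_zero, two_mul]
  rw [ENNReal.tendsto_nhds_zero]
  intro ε hε
  by_cases hS0 : S = 0
  · refine Eventually.of_forall fun j => ?_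
    have := (le_add_self).trans (hsum j)
    rw [hS0, mul_zero] at this
    exact this.trans zero_le
  · have hlt : 2 * S - ε < 2 * S :=
      ENNReal.sub_lt_self (ENNReal.mul_ne_top (by simp) hSf) (by simp [hS0]) hε.ne'
    filter_upwards [eventually_lt_of_lt_liminf (hlt.trans_le hfatou)] with j hj
    have h2 := hsum j
    have h3 : 2 * S ≤ ε + ∫⁻ x, (‖X j x‖ₑ + ‖Y x‖ₑ - ‖X j x - Y x‖ₑ) ∂μ := by
      have := tsub_le_iff_right.1 hj.le
      rwa [add_comm] at this
    have hfin : ∫⁻ x, (‖X j x‖ₑ + ‖Y x‖ₑ - ‖X j x - Y x‖ₑ) ∂μ ≠ ⊤ :=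
      ne_top_of_le_ne_top (ENNReal.mul_ne_top (by simp) hSf) (le_self_add.trans h2)
    have h4 := h2.trans h3
    rw [add_comm] at h4
    exact (ENNReal.add_le_add_iff_right hfin).1 h4

open ContinuousLinearMap in
-- Tonelli, and the mollifier has mass one. This is the norm bound that the passage from a.e. to L¹
-- convergence requires.
theorem lintegral_enorm_convolution_le {E F : Type*} [NormedAddCommGroup E] [NormedSpace ℝ E]
    [MeasurableSpace E] [BorelSpace E] [FiniteDimensional ℝ E] (μ : Measure E) [μ.IsAddHaarMeasure]
    [NormedAddCommGroup F] [NormedSpace ℝ F] (φ : ContDiffBump (0 : E)) {g : E → F}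
    (hg : Integrable g μ) :
    ∫⁻ x, ‖(convolution (φ.normed μ) g (lsmul ℝ ℝ) μ) x‖ₑ ∂μ ≤ ∫⁻ x, ‖g x‖ₑ ∂μ := by
  have hint := (φ.integrable_normed (μ := μ)).convolution_integrand (lsmul ℝ ℝ) hg
  calc _ ≤ ∫⁻ x, ∫⁻ t, ‖φ.normed μ t • g (x - t)‖ₑ ∂μ ∂μ := by
        refine lintegral_mono fun x => ?_
        rw [convolution_def]
        exact enorm_integral_le_lintegral_enorm _
    _ = ∫⁻ t, ∫⁻ x, ‖φ.normed μ t • g (x - t)‖ₑ ∂μ ∂μ :=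
        lintegral_lintegral_swap hint.1.enorm
    _ = ∫⁻ t, ‖φ.normed μ t‖ₑ * ∫⁻ x, ‖g x‖ₑ ∂μ ∂μ := by
        refine lintegral_congr fun t => ?_
        simp_rw [enorm_smul]
        rw [lintegral_const_mul' _ _ enorm_ne_top, lintegral_sub_right_eq_self (fun x => ‖g x‖ₑ)]
    _ = (∫⁻ t, ‖φ.normed μ t‖ₑ ∂μ) * ∫⁻ x, ‖g x‖ₑ ∂μ :=
        lintegral_mul_const' _ _ hg.2.ne
    _ = ∫⁻ x, ‖g x‖ₑ ∂μ := by
        have h1 : ∫⁻ t, ‖φ.normed μ t‖ₑ ∂μ = 1 := by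
          have h2 := φ.integral_normed (μ := μ)
          simp_rw [Real.enorm_eq_ofReal (φ.nonneg_normed _)]
          rw [← ofReal_integral_eq_lintegral_ofReal φ.integrable_normed
            (Eventually.of_forall fun x => φ.nonneg_normed x), h2, ENNReal.ofReal_one]
        rw [h1, one_mul]

variable {n : ℕ}

open ContinuousLinearMap in
/-- The gradient of a mollification of a Sobolev function is the mollification of its weak
gradient, away from the boundary. -/
theorem fderiv_convolution_eq_inner {U : Set (EuclideanSpace ℝ (Fin n))} (hU : MeasurableSet U)
    {f : EuclideanSpace ℝ (Fin n) → ℝ} {G : EuclideanSpace ℝ (Fin n) → EuclideanSpace ℝ (Fin n)}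
    (hf : IntegrableOn f U) (hG : IntegrableOn G U) (h : HasWeakGradientOn U f G)
    (φ : ContDiffBump (0 : EuclideanSpace ℝ (Fin n))) {x : EuclideanSpace ℝ (Fin n)}
    (hx : closedBall x φ.rOut ⊆ U) (v : EuclideanSpace ℝ (Fin n)) :
    fderiv ℝ (convolution (φ.normed volume) (U.indicator f) (lsmul ℝ ℝ) volume) x v =
      inner ℝ (convolution (φ.normed volume) (U.indicator G) (lsmul ℝ ℝ) volume x) v := by
  have hf' : Integrable (U.indicator f) := (integrable_indicator_iff hU).2 hf
  have hG' : Integrable (U.indicator G) := (integrable_indicator_iff hU).2 hG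
  have hφ1 : ContDiff ℝ 1 (φ.normed volume) := φ.contDiff_normed
  -- The test function is the reflected mollifier centred at x; the sign from differentiating y ↦ x
  -- − y cancels the one in the weak gradient identity.
  set ψ : EuclideanSpace ℝ (Fin n) → ℝ := fun y => φ.normed volume (x - y) with hψ
  have hψc : ContDiff ℝ ∞ ψ := φ.contDiff_normed.comp (contDiff_const.sub contDiff_id)
  have hsub : tsupport ψ ⊆ closedBall x φ.rOut := by
    refine closure_minimal (fun y hy => ?_) isClosed_closedBall
    have : x - y ∈ Function.support (φ.normed volume) := hy
    rw [φ.support_normed_eq, mem_ball_zero_iff] at this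
    rw [mem_closedBall', dist_eq_norm]
    exact this.le
  have hψs : HasCompactSupport ψ :=
    (isCompact_closedBall x φ.rOut).of_isClosed_subset (isClosed_tsupport _) hsub
  have hψd : ∀ y, fderiv ℝ ψ y v = - fderiv ℝ (φ.normed volume) (x - y) v := by
    intro y
    have h1 : HasFDerivAt ψ ((fderiv ℝ (φ.normed volume) (x - y)).comp
        (-(ContinuousLinearMap.id ℝ (EuclideanSpace ℝ (Fin n))))) y :=
      ((hφ1.differentiable one_ne_zero) (x - y)).hasFDerivAt.comp y
        ((hasFDerivAt_id y).const_sub x)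
    rw [h1.fderiv]; simp
  have hmain := h.integral_eq ψ hψc hψs (hsub.trans hx) v
  have hL : fderiv ℝ (convolution (φ.normed volume) (U.indicator f) (lsmul ℝ ℝ) volume) x v =
      ∫ y in U, f y * fderiv ℝ (φ.normed volume) (x - y) v := by
    rw [(φ.hasCompactSupport_normed.hasFDerivAt_convolution_left (lsmul ℝ ℝ) hφ1
      hf'.locallyIntegrable x).fderiv, convolution_eq_swap, ContinuousLinearMap.integral_apply]
    · rw [← integral_indicator hU]
      refine integral_congr_ae (Eventually.of_forall fun y => ?_)
      by_cases hy : y ∈ U <;> simp [hy, mul_comm]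
    · have := (φ.hasCompactSupport_normed.fderiv ℝ).convolutionExists_left
        ((lsmul ℝ ℝ).precompL (EuclideanSpace ℝ (Fin n))) (hφ1.continuous_fderiv one_ne_zero)
        hf'.locallyIntegrable x
      exact this.integrable_swap
  have hR : inner ℝ (convolution (φ.normed volume) (U.indicator G) (lsmul ℝ ℝ) volume x) v =
      ∫ y in U, inner ℝ (G y) v * φ.normed volume (x - y) := by
    rw [real_inner_comm, convolution_eq_swap, ← integral_inner, ← integral_indicator hU]
    · refine integral_congr_ae (Eventually.of_forall fun y => ?_)
      by_cases hy : y ∈ U <;> simp [hy, mul_comm, real_inner_comm, inner_smul_right]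
    · have := φ.hasCompactSupport_normed.convolutionExists_left
        (lsmul ℝ ℝ) hφ1.continuous hG'.locallyIntegrable x
      exact this.integrable_swap
  rw [hL, hR]
  simp_rw [hψd, mul_neg, integral_neg] at hmain
  exact neg_injective hmain

end Mollification

/-! ### The representation formula for functions with a weak gradient -/

section Representation

open Filter Topology ContinuousLinearMap

/-- The dimensional constant of the representation formula. -/
noncomputable def reprConst (n : ℕ) : ℝ≥0∞ :=
  ENNReal.ofReal (2 ^ n / n) / volume (ball (0 : EuclideanSpace ℝ (Fin n)) 1)

theorem reprConst_ne_top (n : ℕ) : reprConst n ≠ ⊤ :=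
  ENNReal.div_ne_top ENNReal.ofReal_ne_top (measure_ball_pos _ _ one_pos).ne'

variable {n : ℕ}

/-- On a strictly smaller ball the mollifications have the mollified gradient, so the smooth formula
applies to T ∘ f_j. In the limit the averages converge because T is Lipschitz, and the potentials
converge along indices depending on the point, because the Riesz potential maps L¹ of the ball to
itself. -/
theorem ae_enorm_sub_average_le_of_lt (hn : 0 < n) {x₀ : EuclideanSpace ℝ (Fin n)} {R R' : ℝ}
    (hR' : 0 < R') (hRR : R' < R) {f : EuclideanSpace ℝ (Fin n) → ℝ}
    {G : EuclideanSpace ℝ (Fin n) → EuclideanSpace ℝ (Fin n)} (hf : IntegrableOn f (ball x₀ R))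
    (hG : IntegrableOn G (ball x₀ R)) (h : HasWeakGradientOn (ball x₀ R) f G) {T : ℝ → ℝ}
    (hT : ContDiff ℝ 1 T) {M : NNReal} (hM : ∀ t, ‖deriv T t‖₊ ≤ M) :
    ∀ᵐ x ∂(volume.restrict (ball x₀ R')), ‖T (f x) - ⨍ y in ball x₀ R', T (f y)‖ₑ ≤
      reprConst n * ∫⁻ z in ball x₀ R', ‖deriv T (f z)‖ₑ * ‖G z‖ₑ * ‖x - z‖ₑ ^ (1 - (n : ℝ)) := by
  have : Nonempty (Fin n) := ⟨⟨0, hn⟩⟩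
  have hfr : Module.finrank ℝ (EuclideanSpace ℝ (Fin n)) = n := by simp
  set B := ball x₀ R with hB
  set B' := ball x₀ R' with hB'
  have hBB : B' ⊆ B := ball_subset_ball hRR.le
  have hBm : MeasurableSet B := measurableSet_ball
  have hBm' : MeasurableSet B' := measurableSet_ball
  have hTL : LipschitzWith M T := lipschitzWith_of_nnnorm_deriv_le (hT.differentiable one_ne_zero) hM
  have hT'c : Continuous (deriv T) := hT.continuous_deriv le_rfl
  have hf' : Integrable (B.indicator f) := (integrable_indicator_iff hBm).2 hf
  have hG' : Integrable (B.indicator G) := (integrable_indicator_iff hBm).2 hG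
  -- Radii (R − R')/(j + 2) never exceed R − R', so mollifying at a point of the smaller ball only
  -- sees values inside the larger one.
  have hr : ∀ j : ℕ, 0 < (R - R') / (j + 2) := fun j => by
    have := sub_pos.2 hRR; positivity
  let φ : ℕ → ContDiffBump (0 : EuclideanSpace ℝ (Fin n)) := fun j =>
    ⟨(R - R') / (j + 2) / 2, (R - R') / (j + 2), half_pos (hr j), half_lt_self (hr j)⟩
  have hφr : Tendsto (fun j => (φ j).rOut) atTop (𝓝 0) :=
    tendsto_const_nhds.div_atTop (tendsto_atTop_add_const_right _ _ tendsto_natCast_atTop_atTop)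
  have hφK : ∀ᶠ j in atTop, (φ j).rOut ≤ 2 * (φ j).rIn :=
    Eventually.of_forall fun j => by simp only [φ]; linarith
  set fj := fun j => convolution ((φ j).normed volume) (B.indicator f) (lsmul ℝ ℝ) volume with hfj
  set Gj := fun j => convolution ((φ j).normed volume) (B.indicator G) (lsmul ℝ ℝ) volume with hGj
  have hfj1 : ∀ j, ContDiff ℝ 1 (fj j) := fun j =>
    (φ j).hasCompactSupport_normed.contDiff_convolution_left _ (φ j).contDiff_normed
      hf'.locallyIntegrable
  have hfjae : ∀ᵐ x, Tendsto (fun j => fj j x) atTop (𝓝 (B.indicator f x)) :=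
    ContDiffBump.ae_convolution_tendsto_right_of_locallyIntegrable hφr hφK hf'.locallyIntegrable
  have hGjae : ∀ᵐ x, Tendsto (fun j => Gj j x) atTop (𝓝 (B.indicator G x)) :=
    ContDiffBump.ae_convolution_tendsto_right_of_locallyIntegrable hφr hφK hG'.locallyIntegrable
  have hfjI : ∀ j, Integrable (fj j) := fun j =>
    ((φ j).integrable_normed).integrable_convolution (lsmul ℝ ℝ) hf'
  have hGjI : ∀ j, Integrable (Gj j) := fun j =>
    ((φ j).integrable_normed).integrable_convolution (lsmul ℝ ℝ) hG'
  have hfjL : Tendsto (fun j => ∫⁻ x, ‖fj j x - B.indicator f x‖ₑ) atTop (𝓝 0) :=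
    tendsto_lintegral_enorm_sub_of_ae_tendsto (fun j => (hfjI j).1) hf'
      (fun j => lintegral_enorm_convolution_le volume (φ j) hf') hfjae
  have hGjL : Tendsto (fun j => ∫⁻ x, ‖Gj j x - B.indicator G x‖ₑ) atTop (𝓝 0) :=
    tendsto_lintegral_enorm_sub_of_ae_tendsto (fun j => (hGjI j).1) hG'
      (fun j => lintegral_enorm_convolution_le volume (φ j) hG') hGjae
  have hind : ∀ x ∈ B', B.indicator f x = f x := fun x hx => Set.indicator_of_mem (hBB hx) f
  have hindG : ∀ x ∈ B', B.indicator G x = G x := fun x hx => Set.indicator_of_mem (hBB hx) G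
  have hTint : ∀ g : EuclideanSpace ℝ (Fin n) → ℝ, Integrable g →
      IntegrableOn (fun x => T (g x)) B' := by
    intro g hg
    have h1 : IntegrableOn (fun x => T (g x) - T 0) B' := by
      refine Integrable.mono' (hg.norm.const_mul (M : ℝ)).integrableOn
        ((hTL.continuous.comp_aestronglyMeasurable hg.1.restrict).sub aestronglyMeasurable_const)
        (Eventually.of_forall fun x => ?_)
      simpa [Real.dist_eq] using hTL.dist_le_mul (g x) 0
    have h2 : IntegrableOn (fun _ : EuclideanSpace ℝ (Fin n) => T 0) B' :=
      integrableOn_const measure_ball_lt_top.ne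
    exact (h1.add h2).congr_fun (fun x _ => by simp) measurableSet_ball
  -- the averages converge
  have havg : Tendsto (fun j => ⨍ y in B', T (fj j y)) atTop (𝓝 (⨍ y in B', T (f y))) := by
    have h1 : ⨍ y in B', T (f y) = ⨍ y in B', T (B.indicator f y) :=
      setAverage_congr_fun hBm' (Eventually.of_forall fun x hx => by rw [hind x hx])
    rw [h1]
    simp_rw [setAverage_eq]
    refine Tendsto.const_smul ?_ _
    refine tendsto_integral_of_L1 _ (hTint _ hf').1
      (Eventually.of_forall fun j => hTint _ (hfjI j)) ?_
    have h2 : Tendsto (fun j => (M : ℝ≥0∞) * ∫⁻ x, ‖fj j x - B.indicator f x‖ₑ) atTop (𝓝 0) := by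
      simpa using ENNReal.Tendsto.const_mul hfjL (Or.inr (ENNReal.coe_ne_top (r := M)))
    refine tendsto_of_tendsto_of_tendsto_of_le_of_le tendsto_const_nhds h2 (fun _ => zero_le)
      fun j => ?_
    rw [← lintegral_const_mul' _ _ ENNReal.coe_ne_top]
    refine (setLIntegral_le_lintegral _ _).trans (lintegral_mono fun x => ?_)
    rw [← edist_eq_enorm_sub, ← edist_eq_enorm_sub]
    exact hTL.edist_le_mul _ _
  set hj := fun j z => deriv T (fj j z) • Gj j z with hhj
  set hh := fun z => deriv T (B.indicator f z) • B.indicator G z with hhh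
  have hMe : ∀ t, ‖deriv T t‖ₑ ≤ M := fun t => by exact_mod_cast hM t
  have hhm : ∀ j, AEStronglyMeasurable (fun z => hj j z - hh z) volume := fun j =>
    ((hT'c.comp_aestronglyMeasurable (hfjI j).1).smul (hGjI j).1).sub
      ((hT'c.comp_aestronglyMeasurable hf'.1).smul hG'.1)
  -- Split into T'(f_j)(G_j − G) and (T'(f_j) − T'(f))G: the first is at most M|G_j − G|, the second
  -- is dominated by 2M|G| and tends to zero a.e.
  have hhL : Tendsto (fun j => ∫⁻ z, ‖hj j z - hh z‖ₑ) atTop (𝓝 0) := by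
    have h1 : Tendsto (fun j => ∫⁻ z, ‖deriv T (fj j z) - deriv T (B.indicator f z)‖ₑ *
        ‖B.indicator G z‖ₑ) atTop (𝓝 0) := by
      have : Tendsto (fun j => ∫⁻ z, ‖deriv T (fj j z) - deriv T (B.indicator f z)‖ₑ *
        ‖B.indicator G z‖ₑ) atTop (𝓝 (∫⁻ _ : EuclideanSpace ℝ (Fin n), 0)) := by
        refine tendsto_lintegral_of_dominated_convergence'
          (fun z => (M + M) * ‖B.indicator G z‖ₑ) (fun j => ?_) (fun j => ?_) ?_ ?_
        · exact ((hT'c.comp_aestronglyMeasurable (hfjI j).1).sub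
            (hT'c.comp_aestronglyMeasurable hf'.1)).enorm.mul hG'.1.enorm
        · refine Eventually.of_forall fun z => ?_
          dsimp only
          gcongr
          exact enorm_sub_le.trans (add_le_add (hMe _) (hMe _))
        · rw [lintegral_const_mul' _ _ (by simp)]
          exact ENNReal.mul_ne_top (by simp) hG'.2.ne
        · filter_upwards [hfjae] with z hz
          have h2 := (((hT'c.tendsto _).comp hz).sub_const (deriv T (B.indicator f z))).enorm
          have h3 := ENNReal.Tendsto.mul_const (b := ‖B.indicator G z‖ₑ) h2 (Or.inr enorm_ne_top)
          simpa using h3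
      simpa using this
    have h2 : Tendsto (fun j => (M : ℝ≥0∞) * ∫⁻ x, ‖Gj j x - B.indicator G x‖ₑ) atTop (𝓝 0) := by
      simpa using ENNReal.Tendsto.const_mul hGjL (Or.inr (ENNReal.coe_ne_top (r := M)))
    have h3 := h2.add h1
    rw [add_zero] at h3
    refine tendsto_of_tendsto_of_tendsto_of_le_of_le tendsto_const_nhds h3 (fun _ => zero_le)
      fun j => ?_
    dsimp only
    rw [← lintegral_const_mul' _ _ ENNReal.coe_ne_top, ← lintegral_add_left']
    · refine lintegral_mono fun z => ?_
      have h4 : hj j z - hh z = deriv T (fj j z) • (Gj j z - B.indicator G z) +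
          (deriv T (fj j z) - deriv T (B.indicator f z)) • B.indicator G z := by
        simp only [hhj, hhh, smul_sub, sub_smul]; abel
      dsimp only
      rw [h4]
      refine (enorm_add_le _ _).trans ?_
      rw [enorm_smul, enorm_smul]
      gcongr
      exact hMe _
    · exact ((hGjI j).1.sub hG'.1).enorm.const_mul _
  set F := fun (j : ℕ) x => ∫⁻ z in B', ‖hj j z - hh z‖ₑ * ‖x - z‖ₑ ^ (1 - (n : ℝ)) with hF
  have hprodm : ∀ j, AEMeasurable (Function.uncurry fun x z => ‖hj j z - hh z‖ₑ *
      ‖x - z‖ₑ ^ (1 - (n : ℝ))) ((volume.restrict B').prod (volume.restrict B')) := fun j =>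
    ((hhm j).restrict.enorm.comp_snd).mul
      (Measurable.aemeasurable (f := fun p : EuclideanSpace ℝ (Fin n) × EuclideanSpace ℝ (Fin n) =>
        ‖p.1 - p.2‖ₑ ^ (1 - (n : ℝ))) (by fun_prop))
  set CR := ENNReal.ofReal (n * (2 * R')) * volume (ball (0 : EuclideanSpace ℝ (Fin n)) 1) with hCR
  have hCRf : CR ≠ ⊤ := ENNReal.mul_ne_top ENNReal.ofReal_ne_top measure_ball_lt_top.ne
  have hFint : ∀ j, ∫⁻ x in B', F j x ≤ CR * ∫⁻ z, ‖hj j z - hh z‖ₑ := by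
    intro j
    rw [hF]
    dsimp only
    rw [lintegral_lintegral_swap (hprodm j), ← lintegral_const_mul' _ _ hCRf]
    refine le_trans (setLIntegral_mono' hBm' fun z hz => ?_) (setLIntegral_le_lintegral _ _)
    rw [lintegral_const_mul' _ _ enorm_ne_top, mul_comm]
    gcongr
    have := lintegral_ball_enorm_sub_rpow_le volume hR' hz
    rwa [hfr] at this
  have hFm : ∀ j, AEMeasurable (F j) (volume.restrict B') := fun j => (hprodm j).lintegral_prod_right
  -- The error potentials tend to zero in L¹, and Fatou gives liminf zero a.e. No common subsequence
  -- is needed: each point may use its own infinite set of indices.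
  have hFlim : ∀ᵐ x ∂(volume.restrict B'), liminf (fun j => F j x) atTop = 0 := by
    have h1 : ∫⁻ x in B', liminf (fun j => F j x) atTop = 0 := by
      refine le_antisymm ((lintegral_liminf_le' hFm).trans ?_) zero_le
      have h2 : Tendsto (fun j => ∫⁻ x in B', F j x) atTop (𝓝 0) := by
        have h3 : Tendsto (fun j => CR * ∫⁻ z, ‖hj j z - hh z‖ₑ) atTop (𝓝 0) := by
          simpa using ENNReal.Tendsto.const_mul hhL (Or.inr hCRf)
        exact tendsto_of_tendsto_of_tendsto_of_le_of_le tendsto_const_nhds h3 (fun _ => zero_le)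
          hFint
      exact h2.liminf_eq.le
    refine (lintegral_eq_zero_iff' ?_).1 h1
    simp_rw [liminf_eq_iSup_iInf_of_nat']
    exact AEMeasurable.iSup fun i => AEMeasurable.iInf fun j => hFm _
  have hgrad : ∀ j, ∀ z ∈ B', ‖fderiv ℝ (fun x => T (fj j x)) z‖ₑ ≤ ‖hj j z‖ₑ := by
    intro j z hz
    have hd1 : HasFDerivAt (fun x => T (fj j x)) (deriv T (fj j z) • fderiv ℝ (fj j) z) z :=
      ((hT.differentiable one_ne_zero) (fj j z)).hasDerivAt.comp_hasFDerivAt z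
        ((hfj1 j).differentiable one_ne_zero z).hasFDerivAt
    rw [hd1.fderiv, enorm_smul, hhj, enorm_smul]
    gcongr
    rw [enorm_le_iff_norm_le]
    refine ContinuousLinearMap.opNorm_le_bound _ (norm_nonneg _) fun v => ?_
    rw [hfj, fderiv_convolution_eq_inner hBm hf hG h (φ j) ?_ v]
    · exact norm_inner_le_norm _ _
    · refine closedBall_subset_ball' ?_
      rw [hB', mem_ball] at hz
      have : (φ j).rOut ≤ R - R' := by
        simp only [φ]
        exact div_le_self (sub_pos.2 hRR).le (by linarith [(Nat.cast_nonneg j : (0 : ℝ) ≤ j)])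
      linarith
  filter_upwards [ae_restrict_of_ae hfjae, hFlim, ae_restrict_mem hBm'] with x hx1 hx2 hx3
  set I := ∫⁻ z in B', ‖deriv T (f z)‖ₑ * ‖G z‖ₑ * ‖x - z‖ₑ ^ (1 - (n : ℝ)) with hI
  have hbound : ∀ j, ‖T (fj j x) - ⨍ y in B', T (fj j y)‖ₑ ≤ reprConst n * (I + F j x) := by
    intro j
    have h1 := enorm_sub_average_le_of_contDiff volume (hT.comp (hfj1 j)) hx3
    rw [hfr] at h1
    refine h1.trans (mul_le_mul_right ?_ _)
    rw [hI, hF]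
    dsimp only
    rw [← lintegral_add_right']
    · refine setLIntegral_mono' hBm' fun z hz => ?_
      rw [← add_mul]
      gcongr
      refine (hgrad j z hz).trans ?_
      have h2 : hj j z = hh z + (hj j z - hh z) := by abel
      calc ‖hj j z‖ₑ = ‖hh z + (hj j z - hh z)‖ₑ := by rw [← h2]
        _ ≤ _ := enorm_add_le _ _
        _ = _ := by rw [hhh]; simp only [hind z hz, hindG z hz, enorm_smul]
    · exact ((hhm j).restrict.enorm).mul (Measurable.aemeasurable (by fun_prop))
  have hlim : Tendsto (fun j => ‖T (fj j x) - ⨍ y in B', T (fj j y)‖ₑ) atTop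
      (𝓝 ‖T (f x) - ⨍ y in B', T (f y)‖ₑ) := by
    rw [hind x hx3] at hx1
    exact (((hTL.continuous.tendsto _).comp hx1).sub havg).enorm
  have hε : ∀ k : ℕ, ‖T (f x) - ⨍ y in B', T (f y)‖ₑ ≤ reprConst n * (I + ((k : ℝ≥0∞) + 1)⁻¹) := by
    intro k
    have h1 : ∃ᶠ j in atTop, F j x < ((k : ℝ≥0∞) + 1)⁻¹ := by
      refine frequently_lt_of_liminf_lt (by isBoundedDefault) ?_
      rw [hx2]
      exact ENNReal.inv_pos.2 (by finiteness)
    refine le_of_tendsto_of_frequently hlim (h1.mono fun j hj => (hbound j).trans ?_)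
    gcongr
  have h3 : Tendsto (fun k : ℕ => reprConst n * (I + ((k : ℝ≥0∞) + 1)⁻¹)) atTop
      (𝓝 (reprConst n * (I + 0))) := by
    refine ENNReal.Tendsto.const_mul (tendsto_const_nhds.add ?_) (Or.inr (reprConst_ne_top n))
    have := (tendsto_add_atTop_iff_nat 1).2 ENNReal.tendsto_inv_nat_nhds_zero
    simpa using this
  rw [add_zero] at h3
  exact ge_of_tendsto' h3 hε

/-- Pointwise control of `T ∘ f`, for `f` a Sobolev function, by the Riesz potential of its
gradient. -/
theorem ae_enorm_sub_average_le (hn : 0 < n) {x₀ : EuclideanSpace ℝ (Fin n)} {R : ℝ}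
    (hR : 0 < R) {f : EuclideanSpace ℝ (Fin n) → ℝ}
    {G : EuclideanSpace ℝ (Fin n) → EuclideanSpace ℝ (Fin n)} (hf : IntegrableOn f (ball x₀ R))
    (hG : IntegrableOn G (ball x₀ R)) (h : HasWeakGradientOn (ball x₀ R) f G) {T : ℝ → ℝ}
    (hT : ContDiff ℝ 1 T) {M : NNReal} (hM : ∀ t, ‖deriv T t‖₊ ≤ M) :
    ∀ᵐ x ∂(volume.restrict (ball x₀ R)), ‖T (f x) - ⨍ y in ball x₀ R, T (f y)‖ₑ ≤
      reprConst n * ∫⁻ z in ball x₀ R, ‖deriv T (f z)‖ₑ * ‖G z‖ₑ * ‖x - z‖ₑ ^ (1 - (n : ℝ)) := by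
  have hTL : LipschitzWith M T := lipschitzWith_of_nnnorm_deriv_le (hT.differentiable one_ne_zero) hM
  have hTint : IntegrableOn (fun x => T (f x)) (ball x₀ R) := by
    have h1 : IntegrableOn (fun x => T (f x) - T 0) (ball x₀ R) := by
      refine Integrable.mono' (hf.norm.const_mul (M : ℝ))
        ((hTL.continuous.comp_aestronglyMeasurable hf.1).sub aestronglyMeasurable_const)
        (Eventually.of_forall fun x => ?_)
      simpa [Real.dist_eq] using hTL.dist_le_mul (f x) 0
    have h2 : IntegrableOn (fun _ : EuclideanSpace ℝ (Fin n) => T 0) (ball x₀ R) :=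
      integrableOn_const measure_ball_lt_top.ne
    exact (h1.add h2).congr_fun (fun x _ => by simp) measurableSet_ball
  -- Exhaustion by smaller concentric balls: the averages converge, and each potential over a
  -- smaller ball is at most the full one.
  obtain ⟨r, hrmono, hr, hrlim⟩ := exists_seq_strictMono_tendsto' hR
  have hUnion : ball x₀ R = ⋃ k, ball x₀ (r k) := by
    ext x
    simp only [mem_ball, Set.mem_iUnion]
    constructor
    · intro hx
      exact ((hrlim.eventually (lt_mem_nhds hx))).exists
    · rintro ⟨k, hk⟩
      exact hk.trans (hr k).2
  have hmono : Monotone fun k => ball x₀ (r k) := fun i j hij =>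
    ball_subset_ball (hrmono.monotone hij)
  have hall : ∀ᵐ x ∂(volume.restrict (ball x₀ R)), ∀ k, x ∈ ball x₀ (r k) →
      ‖T (f x) - ⨍ y in ball x₀ (r k), T (f y)‖ₑ ≤ reprConst n *
        ∫⁻ z in ball x₀ (r k), ‖deriv T (f z)‖ₑ * ‖G z‖ₑ * ‖x - z‖ₑ ^ (1 - (n : ℝ)) := by
    rw [ae_all_iff]
    intro k
    have := ae_enorm_sub_average_le_of_lt hn (hr k).1 (hr k).2 hf hG h hT hM
    rw [ae_restrict_iff' measurableSet_ball] at this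
    exact ae_restrict_of_ae this
  have havg : Tendsto (fun k => ⨍ y in ball x₀ (r k), T (f y)) atTop
      (𝓝 (⨍ y in ball x₀ R, T (f y))) := by
    simp_rw [setAverage_eq]
    refine Tendsto.smul ?_ ?_
    · refine Tendsto.inv₀ ?_ (ENNReal.toReal_pos (measure_ball_pos _ _ hR).ne'
        measure_ball_lt_top.ne).ne'
      refine (ENNReal.tendsto_toReal measure_ball_lt_top.ne).comp ?_
      rw [hUnion]
      exact tendsto_measure_iUnion_atTop hmono
    · rw [hUnion]
      exact tendsto_setIntegral_of_monotone (fun k => measurableSet_ball) hmono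
        (by rw [← hUnion]; exact hTint)
  filter_upwards [hall, ae_restrict_mem measurableSet_ball] with x hx hxB
  have hlim : Tendsto (fun k => ‖T (f x) - ⨍ y in ball x₀ (r k), T (f y)‖ₑ) atTop
      (𝓝 ‖T (f x) - ⨍ y in ball x₀ R, T (f y)‖ₑ) := (tendsto_const_nhds.sub havg).enorm
  refine le_of_tendsto hlim ?_
  have hev : ∀ᶠ k in atTop, x ∈ ball x₀ (r k) := hrlim.eventually (lt_mem_nhds hxB)
  filter_upwards [hev] with k hk
  refine (hx k hk).trans (mul_le_mul_right (lintegral_mono_set (ball_subset_ball (hr k).2.le)) _)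

end Representation

/-! ### The two-ball form of the Muckenhoupt condition -/

section Weights

open Filter Topology

variable {n : ℕ}

theorem volume_ball_eq_mul (x y : EuclideanSpace ℝ (Fin n)) {ρ ρ₀ : ℝ} (hρ : 0 < ρ)
    (hρ₀ : 0 < ρ₀) : volume (ball y ρ₀) = ENNReal.ofReal ((ρ₀ / ρ) ^ n) * volume (ball x ρ) := by
  rw [Measure.addHaar_ball_of_pos _ _ hρ₀, Measure.addHaar_ball_of_pos _ _ hρ, ← mul_assoc,
    ← ENNReal.ofReal_mul (by positivity), finrank_euclideanSpace_fin, ← mul_pow,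
    div_mul_cancel₀ _ hρ.ne']

theorem volume_ball_ne_zero (x : EuclideanSpace ℝ (Fin n)) {ρ : ℝ} (hρ : 0 < ρ) :
    volume (ball x ρ) ≠ 0 := (measure_ball_pos _ _ hρ).ne'

theorem volume_ball_ne_top (x : EuclideanSpace ℝ (Fin n)) (ρ : ℝ) :
    volume (ball x ρ) ≠ ⊤ := measure_ball_lt_top.ne

theorem laverage_rpow_le {α : Type*} [MeasurableSpace α] {μ : Measure α} [IsFiniteMeasure μ]
    {g : α → ℝ≥0∞} (hg : AEMeasurable g μ) {t : ℝ} (ht : 1 ≤ t) :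
    (⨍⁻ x, g x ∂μ) ^ t ≤ ⨍⁻ x, g x ^ t ∂μ := by
  rcases eq_or_ne μ 0 with rfl | hμ
  · simp [ENNReal.zero_rpow_of_pos (by linarith : 0 < t)]
  have : NeZero μ := ⟨hμ⟩
  have h := eLpNorm_le_eLpNorm_of_exponent_le (μ := (μ Set.univ)⁻¹ • μ) (f := g)
    (p := 1) (q := ENNReal.ofReal t) (by simpa using ht)
    ((hg.smul_measure _).aestronglyMeasurable)
  rw [eLpNorm_one_eq_lintegral_enorm, eLpNorm_eq_lintegral_rpow_enorm_toReal
    (by simp; linarith) (by simp), ENNReal.toReal_ofReal (by linarith)] at h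
  simp only [enorm_eq_self] at h
  rw [laverage, laverage]
  calc _ ≤ ((∫⁻ x, g x ^ t ∂((μ Set.univ)⁻¹ • μ)) ^ (1 / t)) ^ t := by gcongr
    _ = _ := by rw [← ENNReal.rpow_mul, one_div, inv_mul_cancel₀ (by linarith), ENNReal.rpow_one]

/-- The two-ball form of the Muckenhoupt condition. -/
def HasPairBound (s : ℝ) (K : ℝ≥0∞) (w : EuclideanSpace ℝ (Fin n) → ℝ≥0∞) : Prop :=
  ∀ (x : EuclideanSpace ℝ (Fin n)) (ρ ρ₀ : ℝ), 0 < ρ → ρ ≤ ρ₀ →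
    ∀ g : EuclideanSpace ℝ (Fin n) → ℝ≥0∞, AEMeasurable g (volume.restrict (ball x ρ)) →
      (⨍⁻ y in ball x ρ, g y ∂volume) ^ s * ∫⁻ y in ball x ρ₀, w y ≤
        K * ENNReal.ofReal ((ρ₀ / ρ) ^ (n * s)) * ∫⁻ y in ball x ρ, g y ^ s * w y

/-- Apply the condition to g^(p/s) and use Jensen. The power of g rises to p while the radius ratio
keeps its exponent ns; this mismatch produces the gain 1/p − 1/(ns). -/
theorem HasPairBound.mono_exponent {s p : ℝ} {K : ℝ≥0∞} {w : EuclideanSpace ℝ (Fin n) → ℝ≥0∞}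
    (h : HasPairBound s K w) (hs : 0 < s) (hsp : s ≤ p) {x : EuclideanSpace ℝ (Fin n)} {ρ ρ₀ : ℝ}
    (hρ : 0 < ρ) (hρ₀ : ρ ≤ ρ₀) {g : EuclideanSpace ℝ (Fin n) → ℝ≥0∞}
    (hg : AEMeasurable g (volume.restrict (ball x ρ))) :
    (⨍⁻ y in ball x ρ, g y ∂volume) ^ p * ∫⁻ y in ball x ρ₀, w y ≤
        K * ENNReal.ofReal ((ρ₀ / ρ) ^ (n * s)) * ∫⁻ y in ball x ρ, g y ^ p * w y := by
  have : IsFiniteMeasure (volume.restrict (ball x ρ)) :=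
    ⟨by simpa using (volume_ball_ne_top x ρ).lt_top⟩
  have h1 := h x ρ ρ₀ hρ hρ₀ (fun y => g y ^ (p / s)) (hg.pow_const _)
  have h2 := laverage_rpow_le hg ((one_le_div hs).2 hsp)
  simp_rw [← ENNReal.rpow_mul, div_mul_cancel₀ p hs.ne'] at h1
  refine le_trans ?_ h1
  gcongr
  calc _ = ((⨍⁻ y in ball x ρ, g y ∂volume) ^ (p / s)) ^ s := by
        rw [← ENNReal.rpow_mul, div_mul_cancel₀ p hs.ne']
    _ ≤ _ := by gcongr

/-- Test with g = 1 and equal radii. Besides normalising K, this is the source of the lower bound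
for the A_r constant used for negative β. -/
theorem HasPairBound.one_le {s : ℝ} {K : ℝ≥0∞} {w : EuclideanSpace ℝ (Fin n) → ℝ≥0∞}
    (h : HasPairBound s K w) (h0 : ∫⁻ y in ball 0 1, w y ≠ 0)
    (h1 : ∫⁻ y in ball 0 1, w y ≠ ⊤) : 1 ≤ K := by
  have h2 := h 0 1 1 one_pos le_rfl (fun _ => 1) aemeasurable_const
  rw [setLAverage_const (volume_ball_ne_zero _ one_pos) (volume_ball_ne_top _ _)] at h2
  simp only [ENNReal.one_rpow, one_mul, div_one, Real.one_rpow, ENNReal.ofReal_one, mul_one] at h2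
  have h3 : 1 * ∫⁻ y in ball 0 1, w y ≤ K * ∫⁻ y in ball 0 1, w y := by rwa [one_mul]
  exact (ENNReal.mul_le_mul_iff_left h0 h1).1 h3

/-- The A_1 case: the average over the large ball is at most K w(y) for a.e. y in the small one;
multiply by g(y) and integrate. -/
theorem HasPairBound.of_ae_laverage_le {K : ℝ≥0∞} {w : EuclideanSpace ℝ (Fin n) → ℝ≥0∞}
    (hK : K ≠ ⊤)
    (hw : ∀ (x : EuclideanSpace ℝ (Fin n)) (R : ℝ), 0 < R →
      ∀ᵐ y ∂(volume.restrict (ball x R)), ⨍⁻ z in ball x R, w z ∂volume ≤ K * w y)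
    (hwf : ∀ (x : EuclideanSpace ℝ (Fin n)) (R : ℝ), ∫⁻ y in ball x R, w y ≠ ⊤) :
    HasPairBound 1 K w := by
  intro x ρ ρ₀ hρ hρ₀ g hg
  have hρ0 : 0 < ρ₀ := hρ.trans_le hρ₀
  set V := volume (ball x ρ) with hV
  have hV0 : V ≠ 0 := volume_ball_ne_zero x hρ
  have hVt : V ≠ ⊤ := volume_ball_ne_top x ρ
  have hV₀ := volume_ball_eq_mul x x hρ hρ0
  set L := ENNReal.ofReal ((ρ₀ / ρ) ^ n) with hL
  have hL0 : L ≠ 0 := by rw [hL]; positivity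
  set a := ⨍⁻ z in ball x ρ₀, w z ∂volume with ha
  have ha' : ∫⁻ y in ball x ρ₀, w y = a * (L * V) := by
    rw [ha, setLAverage_eq, hV₀, ENNReal.div_mul_cancel]
    · exact mul_ne_zero hL0 hV0
    · exact ENNReal.mul_ne_top ENNReal.ofReal_ne_top hVt
  have haf : a ≠ ⊤ := by
    rw [ha, setLAverage_eq]
    exact ENNReal.div_ne_top (hwf x ρ₀) (volume_ball_ne_zero x hρ0)
  have hae := ae_mono (Measure.restrict_mono_set volume (ball_subset_ball hρ₀)) (hw x ρ₀ hρ0)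
  have hmain : a * ∫⁻ y in ball x ρ, g y ≤ K * ∫⁻ y in ball x ρ, g y * w y := by
    rw [← lintegral_const_mul' _ _ haf, ← lintegral_const_mul' _ _ hK]
    refine lintegral_mono_ae ?_
    filter_upwards [hae] with y hy
    calc a * g y ≤ (K * w y) * g y := by gcongr
      _ = _ := by ring
  simp only [ENNReal.rpow_one, mul_one, Real.rpow_natCast]
  rw [ha', setLAverage_eq]
  calc (∫⁻ y in ball x ρ, g y) / V * (a * (L * V))
      = L * (a * ∫⁻ y in ball x ρ, g y) * (V / V) := by rw [div_eq_mul_inv, div_eq_mul_inv]; ring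
    _ = L * (a * ∫⁻ y in ball x ρ, g y) := by rw [ENNReal.div_self hV0 hVt, mul_one]
    _ ≤ L * (K * ∫⁻ y in ball x ρ, g y * w y) := by gcongr
    _ = _ := by ring

/-- Hölder on the small ball, with g = (g w^(1/s)) w^(-1/s). The dual integral is then enlarged to
the big ball, where the A_s condition is used; the ratio of volumes contributes (ρ₀/ρ)^(ns). -/
theorem HasPairBound.of_dual {s : ℝ} (hs : 1 < s) {K : ℝ≥0∞}
    {w : EuclideanSpace ℝ (Fin n) → ℝ≥0∞} (hwm : AEMeasurable w)
    (hw : ∀ (x : EuclideanSpace ℝ (Fin n)) (R : ℝ), 0 < R →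
      (⨍⁻ y in ball x R, w y ∂volume) * (⨍⁻ y in ball x R, w y ^ (-(1 / (s - 1))) ∂volume) ^ (s - 1) ≤ K)
    (hw0 : ∀ᵐ y, w y ≠ 0) (hwt : ∀ᵐ y, w y ≠ ⊤) :
    HasPairBound s K w := by
  intro x ρ ρ₀ hρ hρ₀ g hg
  have hρ0 : 0 < ρ₀ := hρ.trans_le hρ₀
  have hs0 : 0 < s := by linarith
  have hs1 : 0 < s - 1 := by linarith
  set V := volume (ball x ρ) with hV
  have hV0 : V ≠ 0 := volume_ball_ne_zero x hρ
  have hVt : V ≠ ⊤ := volume_ball_ne_top x ρ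
  have hV₀ := volume_ball_eq_mul x x hρ hρ0
  set L := ENNReal.ofReal ((ρ₀ / ρ) ^ n) with hL
  have hL0 : L ≠ 0 := by rw [hL]; positivity
  have hLs : ENNReal.ofReal ((ρ₀ / ρ) ^ (n * s)) = L ^ s := by
    rw [hL, ENNReal.ofReal_rpow_of_pos (by positivity), Real.rpow_mul (by positivity),
      Real.rpow_natCast]
  set V₀ := volume (ball x ρ₀) with hV₀d
  have hV₀0 : V₀ ≠ 0 := volume_ball_ne_zero x hρ0
  have hV₀t : V₀ ≠ ⊤ := volume_ball_ne_top x ρ₀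
  set W₀ := ∫⁻ y in ball x ρ₀, w y
  set S₀ := ∫⁻ y in ball x ρ₀, w y ^ (-(1 / (s - 1)))
  set J := ∫⁻ y in ball x ρ, g y ^ s * w y
  have hK : W₀ * S₀ ^ (s - 1) ≤ K * V₀ ^ s := by
    have h1 := hw x ρ₀ hρ0
    rw [setLAverage_eq, setLAverage_eq, ENNReal.div_rpow_of_nonneg _ _ hs1.le] at h1
    have h2 : V₀ ^ s = V₀ * V₀ ^ (s - 1) := by
      conv_lhs => rw [show s = 1 + (s - 1) by ring]
      rw [ENNReal.rpow_add _ _ hV₀0 hV₀t, ENNReal.rpow_one]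
    rw [h2]
    have h3 : V₀ ^ (s - 1) ≠ 0 := by simp [hV₀0, hV₀t]
    have h4 : V₀ ^ (s - 1) ≠ ⊤ := ENNReal.rpow_ne_top_of_nonneg hs1.le hV₀t
    calc W₀ * S₀ ^ (s - 1) = (W₀ / V₀ * V₀) * (S₀ ^ (s - 1) / V₀ ^ (s - 1) * V₀ ^ (s - 1)) := by
          rw [ENNReal.div_mul_cancel hV₀0 hV₀t, ENNReal.div_mul_cancel h3 h4]
      _ = (W₀ / V₀ * (S₀ ^ (s - 1) / V₀ ^ (s - 1))) * (V₀ * V₀ ^ (s - 1)) := by ring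
      _ ≤ _ := by gcongr
  have hH : (∫⁻ y in ball x ρ, g y) ^ s ≤ J * S₀ ^ (s - 1) := by
    have hconj : s.HolderConjugate (s / (s - 1)) := Real.HolderConjugate.conjExponent hs
    have h1 := ENNReal.lintegral_mul_le_Lp_mul_Lq (volume.restrict (ball x ρ)) hconj
      (f := fun y => g y * w y ^ (1 / s)) (g := fun y => w y ^ (-(1 / s)))
      (hg.mul (hwm.restrict.pow_const _)) (hwm.restrict.pow_const _)
    have h2 : ∫⁻ y in ball x ρ, ((fun y => g y * w y ^ (1 / s)) * fun y => w y ^ (-(1 / s))) y =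
        ∫⁻ y in ball x ρ, g y := by
      refine lintegral_congr_ae ?_
      filter_upwards [ae_restrict_of_ae hw0, ae_restrict_of_ae hwt] with y h0 ht
      simp only [Pi.mul_apply]
      rw [mul_assoc, ← ENNReal.rpow_add _ _ h0 ht, add_neg_cancel, ENNReal.rpow_zero, mul_one]
    have h3 : ∀ y, (g y * w y ^ (1 / s)) ^ s = g y ^ s * w y := by
      intro y
      rw [ENNReal.mul_rpow_of_nonneg _ _ hs0.le, ← ENNReal.rpow_mul, one_div,
        inv_mul_cancel₀ hs0.ne', ENNReal.rpow_one]
    have h4 : ∀ y, (w y ^ (-(1 / s))) ^ (s / (s - 1)) = w y ^ (-(1 / (s - 1))) := by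
      intro y
      rw [← ENNReal.rpow_mul]
      congr 1
      field_simp
    rw [h2] at h1
    simp_rw [h3, h4] at h1
    calc (∫⁻ y in ball x ρ, g y) ^ s
        ≤ (J ^ (1 / s) * (∫⁻ y in ball x ρ, w y ^ (-(1 / (s - 1)))) ^ (1 / (s / (s - 1)))) ^ s := by
          gcongr
      _ = J * (∫⁻ y in ball x ρ, w y ^ (-(1 / (s - 1)))) ^ (s - 1) := by
          rw [ENNReal.mul_rpow_of_nonneg _ _ hs0.le, ← ENNReal.rpow_mul, ← ENNReal.rpow_mul,
            one_div, inv_mul_cancel₀ hs0.ne', ENNReal.rpow_one]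
          congr 2
          field_simp
      _ ≤ _ := by
          gcongr
          exact lintegral_mono_set (ball_subset_ball hρ₀)
  rw [setLAverage_eq, ENNReal.div_rpow_of_nonneg _ _ hs0.le, hLs]
  have hVs0 : V ^ s ≠ 0 := by simp [hV0, hVt]
  have hVst : V ^ s ≠ ⊤ := ENNReal.rpow_ne_top_of_nonneg hs0.le hVt
  calc (∫⁻ y in ball x ρ, g y) ^ s / V ^ s * W₀ ≤ (J * S₀ ^ (s - 1)) / V ^ s * W₀ := by gcongr
    _ = J * (W₀ * S₀ ^ (s - 1)) / V ^ s := by rw [div_eq_mul_inv, div_eq_mul_inv]; ring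
    _ ≤ J * (K * V₀ ^ s) / V ^ s := by gcongr
    _ = K * L ^ s * J * (V ^ s / V ^ s) := by
        rw [hV₀, ENNReal.mul_rpow_of_nonneg _ _ hs0.le, div_eq_mul_inv, div_eq_mul_inv]; ring
    _ = _ := by rw [ENNReal.div_self hVs0 hVst, mul_one]

end Weights

/-! ### Dyadic cells and differentiation along them -/

section DyadicCells

open Filter Topology

variable {n : ℕ}

/-- The closed cube with centre `c` and side length `l`. -/
def closedCube (c : EuclideanSpace ℝ (Fin n)) (l : ℝ) : Set (EuclideanSpace ℝ (Fin n)) :=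
  {x | ∀ i, |x i - c i| ≤ l / 2}

theorem cube_subset_closedCube (c : EuclideanSpace ℝ (Fin n)) (l : ℝ) :
    cube c l ⊆ closedCube c l := fun _ hx i => (hx i).le

theorem isOpen_cube (c : EuclideanSpace ℝ (Fin n)) (l : ℝ) : IsOpen (cube c l) := by
  have : cube c l = ⋂ i, {x : EuclideanSpace ℝ (Fin n) | |x i - c i| < l / 2} := by
    ext x; simp [cube]
  rw [this]
  exact isOpen_iInter_of_finite fun i => isOpen_lt (by fun_prop) continuous_const

theorem isClosed_closedCube (c : EuclideanSpace ℝ (Fin n)) (l : ℝ) : IsClosed (closedCube c l) := by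
  have : closedCube c l = ⋂ i, {x : EuclideanSpace ℝ (Fin n) | |x i - c i| ≤ l / 2} := by
    ext x; simp [closedCube]
  rw [this]
  exact isClosed_iInter fun i => isClosed_le (by fun_prop) continuous_const

theorem volume_cube (c : EuclideanSpace ℝ (Fin n)) {l : ℝ} (hl : 0 < l) :
    volume (cube c l) = ENNReal.ofReal (l ^ n) := by
  have h : cube c l = (WithLp.ofLp : EuclideanSpace ℝ (Fin n) → (Fin n → ℝ)) ⁻¹'
      ball (WithLp.ofLp c) (l / 2) := by
    ext x
    simp [cube, dist_pi_lt_iff (half_pos hl), Real.dist_eq]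
  rw [h, (PiLp.volume_preserving_ofLp (Fin n)).measure_preimage
    measurableSet_ball.nullMeasurableSet, Real.volume_pi_ball _ (half_pos hl)]
  simp [mul_div_cancel₀]

theorem volume_closedCube (c : EuclideanSpace ℝ (Fin n)) {l : ℝ} (hl : 0 < l) :
    volume (closedCube c l) = ENNReal.ofReal (l ^ n) := by
  have h : closedCube c l = (WithLp.ofLp : EuclideanSpace ℝ (Fin n) → (Fin n → ℝ)) ⁻¹'
      closedBall (WithLp.ofLp c) (l / 2) := by
    ext x
    simp [closedCube, dist_pi_le_iff (half_pos hl).le, Real.dist_eq]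
  rw [h, (PiLp.volume_preserving_ofLp (Fin n)).measure_preimage
    measurableSet_closedBall.nullMeasurableSet, Real.volume_pi_closedBall _ (half_pos hl).le]
  simp [mul_div_cancel₀]

/-- Faces are null, so the open cubes of the A_∞ constant and the half-open cells of a partition can
be interchanged under integrals. -/
theorem cube_ae_eq_of_subset {c : EuclideanSpace ℝ (Fin n)} {l : ℝ} (hl : 0 < l)
    {s : Set (EuclideanSpace ℝ (Fin n))} (h1 : cube c l ⊆ s) (h2 : s ⊆ closedCube c l) :
    cube c l =ᵐ[volume] s := by
  refine ae_eq_of_subset_of_measure_ge h1 ?_ (isOpen_cube c l).measurableSet.nullMeasurableSet ?_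
  · rw [volume_cube c hl, ← volume_closedCube c hl]
    exact measure_mono h2
  · exact ne_top_of_le_ne_top (by rw [volume_closedCube c hl]; simp) (measure_mono h2)

/-- The index of the dyadic cell of generation `k` containing `x`, for the grid with corner `a`
and side length `l`. -/
noncomputable def cellIndex (a : EuclideanSpace ℝ (Fin n)) (l : ℝ) (k : ℕ)
    (x : EuclideanSpace ℝ (Fin n)) : Fin n → ℤ :=
  fun i => ⌊(x i - a i) * 2 ^ k / l⌋

/-- The half-open dyadic cell of generation `k` with index `z`. -/
def cell (a : EuclideanSpace ℝ (Fin n)) (l : ℝ) (k : ℕ) (z : Fin n → ℤ) :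
    Set (EuclideanSpace ℝ (Fin n)) :=
  {y | cellIndex a l k y = z}

/-- The centre of a dyadic cell. -/
noncomputable def cellCenter (a : EuclideanSpace ℝ (Fin n)) (l : ℝ) (k : ℕ) (z : Fin n → ℤ) :
    EuclideanSpace ℝ (Fin n) :=
  WithLp.toLp 2 fun i => a i + (z i + 1 / 2) * (l / 2 ^ k)

variable {a : EuclideanSpace ℝ (Fin n)} {l : ℝ}

theorem measurable_cellIndex (k : ℕ) : Measurable (cellIndex a l k) := by
  unfold cellIndex
  exact measurable_pi_lambda _ fun i => Int.measurable_floor.comp (by fun_prop)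

theorem measurableSet_cell (k : ℕ) (z : Fin n → ℤ) : MeasurableSet (cell a l k z) :=
  measurable_cellIndex k (measurableSet_singleton z)

theorem mem_cell_iff (hl : 0 < l) {k : ℕ} {z : Fin n → ℤ} {y : EuclideanSpace ℝ (Fin n)} :
    y ∈ cell a l k z ↔ ∀ i, z i * (l / 2 ^ k) ≤ y i - a i ∧ y i - a i < (z i + 1) * (l / 2 ^ k) := by
  have h2 : (0 : ℝ) < l / 2 ^ k := by positivity
  simp only [cell, cellIndex, Set.mem_ofPred_eq, funext_iff]
  refine forall_congr' fun i => ?_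
  have : (y i - a i) * 2 ^ k / l = (y i - a i) / (l / 2 ^ k) := by field_simp
  rw [this, Int.floor_eq_iff, le_div_iff₀ h2, div_lt_iff₀ h2]

theorem cube_subset_cell (hl : 0 < l) (k : ℕ) (z : Fin n → ℤ) :
    cube (cellCenter a l k z) (l / 2 ^ k) ⊆ cell a l k z := by
  intro y hy
  rw [mem_cell_iff hl]
  intro i
  have h := abs_lt.1 (hy i)
  simp only [cellCenter] at h
  constructor <;> linarith [h.1, h.2]

theorem cell_subset_closedCube (hl : 0 < l) (k : ℕ) (z : Fin n → ℤ) :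
    cell a l k z ⊆ closedCube (cellCenter a l k z) (l / 2 ^ k) := by
  intro y hy i
  have h := (mem_cell_iff hl).1 hy i
  rw [abs_le]
  simp only [cellCenter]
  constructor <;> linarith [h.1, h.2]

theorem cube_ae_eq_cell (hl : 0 < l) (k : ℕ) (z : Fin n → ℤ) :
    cube (cellCenter a l k z) (l / 2 ^ k) =ᵐ[volume] cell a l k z :=
  cube_ae_eq_of_subset (by positivity) (cube_subset_cell hl k z) (cell_subset_closedCube hl k z)

theorem volume_cell (hl : 0 < l) (k : ℕ) (z : Fin n → ℤ) :
    volume (cell a l k z) = ENNReal.ofReal ((l / 2 ^ k) ^ n) := by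
  rw [← measure_congr (cube_ae_eq_cell hl k z), volume_cube _ (by positivity)]

theorem cellIndex_eq_of_succ {k : ℕ} {x y : EuclideanSpace ℝ (Fin n)}
    (h : cellIndex a l (k + 1) y = cellIndex a l (k + 1) x) :
    cellIndex a l k y = cellIndex a l k x := by
  funext i
  have hi := congrFun h i
  simp only [cellIndex] at hi ⊢
  -- The index of the parent is the index of the child halved and rounded down; this is the
  -- nestedness of the grid.
  have key : ∀ t : ℝ, ⌊t⌋ = ⌊2 * t⌋ / 2 := by
    intro t
    have h1 := Int.floor_le t
    have h2 := Int.lt_floor_add_one t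
    have h3 : 2 * ⌊t⌋ ≤ ⌊2 * t⌋ := Int.le_floor.2 (by push_cast; linarith)
    have h4 : ⌊2 * t⌋ < 2 * ⌊t⌋ + 2 := Int.floor_lt.2 (by push_cast; linarith)
    omega
  rw [key ((y i - a i) * 2 ^ k / l), key ((x i - a i) * 2 ^ k / l)]
  have e : ∀ t : ℝ, 2 * (t * 2 ^ k / l) = t * 2 ^ (k + 1) / l := fun t => by rw [pow_succ]; ring
  rw [e, e, hi]

theorem cellIndex_eq_of_le {j k : ℕ} (hjk : j ≤ k) {x y : EuclideanSpace ℝ (Fin n)}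
    (h : cellIndex a l k y = cellIndex a l k x) : cellIndex a l j y = cellIndex a l j x := by
  induction k, hjk using Nat.le_induction with
  | base => exact h
  | succ k _ ih => exact ih (cellIndex_eq_of_succ h)

theorem cell_subset_of_le {j k : ℕ} (hjk : j ≤ k) (x : EuclideanSpace ℝ (Fin n)) :
    cell a l k (cellIndex a l k x) ⊆ cell a l j (cellIndex a l j x) :=
  fun _ hy => cellIndex_eq_of_le hjk hy

/-- A comparison of measures on cells of a fixed generation extends to unions of cells. -/
theorem measure_le_of_forall_cell {ρ₁ ρ₂ : Measure (EuclideanSpace ℝ (Fin n))} (k : ℕ)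
    {S : Set (EuclideanSpace ℝ (Fin n))}
    (hS : ∀ x ∈ S, cell a l k (cellIndex a l k x) ⊆ S)
    (h : ∀ x ∈ S, ρ₁ (cell a l k (cellIndex a l k x)) ≤ ρ₂ (cell a l k (cellIndex a l k x))) :
    ρ₁ S ≤ ρ₂ S := by
  set Z := cellIndex a l k '' S
  have hU : S = ⋃ z ∈ Z, cell a l k z := by
    ext x
    simp only [Set.mem_iUnion, Z]
    constructor
    · intro hx; exact ⟨_, ⟨x, hx, rfl⟩, rfl⟩
    · rintro ⟨_, ⟨y, hy, rfl⟩, hx⟩; exact hS y hy hx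
  have hdisj : Z.PairwiseDisjoint (cell a l k) := by
    intro z _ z' _ hzz
    refine Set.disjoint_left.2 fun x hx hx' => hzz ?_
    exact (show cellIndex a l k x = z from hx).symm.trans hx'
  rw [hU, measure_biUnion (Set.to_countable Z) hdisj fun z _ => measurableSet_cell k z,
    measure_biUnion (Set.to_countable Z) hdisj fun z _ => measurableSet_cell k z]
  refine ENNReal.tsum_le_tsum fun z => ?_
  obtain ⟨_, ⟨y, hy, rfl⟩⟩ := z
  exact h y hy

/-- The average of `σ` over the dyadic cell of generation `k` containing `x`. -/
noncomputable def cellAverage (a : EuclideanSpace ℝ (Fin n)) (l : ℝ)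
    (σ : EuclideanSpace ℝ (Fin n) → ℝ≥0∞) (k : ℕ) (x : EuclideanSpace ℝ (Fin n)) : ℝ≥0∞ :=
  (∫⁻ y in cell a l k (cellIndex a l k x), σ y) / ENNReal.ofReal ((l / 2 ^ k) ^ n)

variable {σ : EuclideanSpace ℝ (Fin n) → ℝ≥0∞}

theorem measurable_cellAverage (k : ℕ) : Measurable (cellAverage a l σ k) :=
  (measurable_of_countable fun z : Fin n → ℤ =>
    (∫⁻ y in cell a l k z, σ y) / ENNReal.ofReal ((l / 2 ^ k) ^ n)).comp (measurable_cellIndex k)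

theorem cellAverage_congr {k : ℕ} {x y : EuclideanSpace ℝ (Fin n)}
    (h : cellIndex a l k y = cellIndex a l k x) : cellAverage a l σ k y = cellAverage a l σ k x := by
  rw [cellAverage, cellAverage, h]

theorem cellAverage_mul (hl : 0 < l) (k : ℕ) (x : EuclideanSpace ℝ (Fin n)) :
    cellAverage a l σ k x * ENNReal.ofReal ((l / 2 ^ k) ^ n) =
      ∫⁻ y in cell a l k (cellIndex a l k x), σ y :=
  ENNReal.div_mul_cancel (by positivity) ENNReal.ofReal_ne_top

/-- A parent has 2^n times the volume of its child. This is the 2^n inside τ_n = 2^(n+1); the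
remaining factor 2 pays for an absorption. -/
theorem cellAverage_succ_le (hl : 0 < l) (k : ℕ) (x : EuclideanSpace ℝ (Fin n)) :
    cellAverage a l σ (k + 1) x ≤ 2 ^ n * cellAverage a l σ k x := by
  rw [cellAverage, cellAverage, ← mul_div_assoc]
  have h1 : ENNReal.ofReal ((l / 2 ^ k) ^ n) = 2 ^ n * ENNReal.ofReal ((l / 2 ^ (k + 1)) ^ n) := by
    have : (2 : ℝ≥0∞) ^ n = ENNReal.ofReal (2 ^ n) := by
      rw [ENNReal.ofReal_pow zero_le_two]; simp
    rw [this, ← ENNReal.ofReal_mul (by positivity), ← mul_pow]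
    congr 2
    rw [pow_succ]; field_simp
  rw [h1, ENNReal.mul_div_mul_left _ _ (by simp) (by simp)]
  gcongr
  exact cell_subset_of_le (Nat.le_succ k) x

/-- Competitors in `cubeMaximal` are open cubes containing the point, so the null set of all cell
faces is discarded here once for all generations. -/
theorem ae_forall_mem_cube (hl : 0 < l) :
    ∀ᵐ y : EuclideanSpace ℝ (Fin n), ∀ k : ℕ,
      y ∈ cube (cellCenter a l k (cellIndex a l k y)) (l / 2 ^ k) := by
  rw [ae_all_iff]
  intro k
  have h : ∀ᵐ y : EuclideanSpace ℝ (Fin n), ∀ z : Fin n → ℤ,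
      y ∈ cube (cellCenter a l k z) (l / 2 ^ k) ↔ y ∈ cell a l k z := by
    rw [ae_all_iff]
    intro z
    filter_upwards [cube_ae_eq_cell (a := a) hl k z] with y hy
    exact iff_of_eq hy
  filter_upwards [h] with y hy
  exact (hy _).2 rfl

/-- Lebesgue differentiation along cells that shrink to x without being centred there. The Vitali
family of closed sets comparable to a ball about x admits the closures of the cells. -/
theorem ae_tendsto_cellAverage (hn : 0 < n) (hl : 0 < l) (hσ : AEMeasurable σ) (z₀ : Fin n → ℤ)
    (hfin : ∫⁻ y in cell a l 0 z₀, σ y ≠ ⊤) :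
    ∀ᵐ x ∂(volume.restrict (cell a l 0 z₀)),
      Tendsto (fun k => cellAverage a l σ k x) atTop (𝓝 (σ x)) := by
  set κ := volume (ball (0 : EuclideanSpace ℝ (Fin n)) 1) with hκ
  have hκt : κ ≠ ⊤ := measure_ball_lt_top.ne
  have hn' : (0 : ℝ) < n := by exact_mod_cast hn
  -- The first entry is the doubling constant for tripled balls; the second compares a cube of side
  -- h with a ball of radius 3nh, n h being a crude bound for its diameter.
  set C : NNReal := max (3 ^ n) ((3 * n) ^ n * κ.toNNReal) with hC
  have hcb : ∀ (x : EuclideanSpace ℝ (Fin n)) (r : ℝ), 0 < r →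
      volume (closedBall x r) = ENNReal.ofReal (r ^ n) * κ := by
    intro x r hr
    rw [Measure.addHaar_closedBall _ _ hr.le, finrank_euclideanSpace_fin]
  have hv : ∀ x : EuclideanSpace ℝ (Fin n), ∃ᶠ r in 𝓝[>] (0 : ℝ),
      volume (closedBall x (3 * r)) ≤ C * volume (closedBall x r) := by
    intro x
    refine Eventually.frequently (eventually_mem_nhdsWithin.mono fun r hr => ?_)
    have hr0 : 0 < r := hr
    rw [hcb x _ (by positivity), hcb x _ hr0, mul_pow, ENNReal.ofReal_mul (by positivity),
      mul_assoc]
    gcongr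
    calc ENNReal.ofReal (3 ^ n) = ((3 ^ n : NNReal) : ℝ≥0∞) := by
          rw [ENNReal.ofReal_pow (by norm_num)]; simp
      _ ≤ C := ENNReal.coe_le_coe.2 (le_max_left _ _)
  let v := Vitali.vitaliFamily (volume : Measure (EuclideanSpace ℝ (Fin n))) C hv
  have hQm : MeasurableSet (cell a l 0 z₀) := measurableSet_cell 0 z₀
  have hdiff := v.ae_tendsto_lintegral_div (f := (cell a l 0 z₀).indicator σ)
    (hσ.indicator hQm) (by rwa [lintegral_indicator hQm])
  filter_upwards [ae_restrict_of_ae hdiff, ae_restrict_mem hQm] with x hx hxQ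
  have hxQ' : cellIndex a l 0 x = z₀ := hxQ
  rw [Set.indicator_of_mem hxQ] at hx
  have hsub : ∀ k, closedCube (cellCenter a l k (cellIndex a l k x)) (l / 2 ^ k) ⊆
      closedBall x (n * (l / 2 ^ k)) := by
    intro k y hy
    have hxk := cell_subset_closedCube hl k _ (show x ∈ cell a l k (cellIndex a l k x) from rfl)
    rw [mem_closedBall, dist_eq_norm, ← (EuclideanSpace.basisFun (Fin n) ℝ).sum_repr (y - x)]
    refine (norm_sum_le _ _).trans ?_
    calc _ ≤ ∑ i : Fin n, l / 2 ^ k := by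
          refine Finset.sum_le_sum fun i _ => ?_
          rw [norm_smul, (EuclideanSpace.basisFun (Fin n) ℝ).norm_eq_one, mul_one,
            EuclideanSpace.basisFun_repr, Real.norm_eq_abs]
          have h1 := abs_le.1 (hy i)
          have h2 := abs_le.1 (hxk i)
          rw [abs_le, PiLp.sub_apply]
          constructor <;> linarith [h1.1, h1.2, h2.1, h2.2]
      _ = _ := by simp
  have hlim : Tendsto (fun k : ℕ => l / 2 ^ k) atTop (𝓝 0) :=
    tendsto_const_nhds.div_atTop (tendsto_pow_atTop_atTop_of_one_lt one_lt_two)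
  have ht : Tendsto (fun k => closedCube (cellCenter a l k (cellIndex a l k x)) (l / 2 ^ k)) atTop
      (v.filterAt x) := by
    rw [VitaliFamily.tendsto_filterAt_iff]
    constructor
    · refine Eventually.of_forall fun k => ⟨isClosed_closedCube _ _, ?_, n * (l / 2 ^ k),
        hsub k, ?_⟩
      · refine ⟨cellCenter a l k (cellIndex a l k x), ?_⟩
        refine interior_maximal (cube_subset_closedCube _ _) (isOpen_cube _ _) fun i => ?_
        simp only [sub_self, abs_zero]; positivity
      · rw [hcb x _ (by positivity), volume_closedCube _ (by positivity),
          show (3 * ((n : ℝ) * (l / 2 ^ k))) = (3 * n) * (l / 2 ^ k) by ring, mul_pow,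
          ENNReal.ofReal_mul (by positivity), mul_right_comm]
        gcongr
        calc ENNReal.ofReal ((3 * n) ^ n) * κ
            = (((3 * n) ^ n * κ.toNNReal : NNReal) : ℝ≥0∞) := by
              rw [ENNReal.coe_mul, ENNReal.coe_toNNReal hκt, ENNReal.ofReal_pow (by positivity),
                ENNReal.ofReal_mul (by norm_num)]
              simp
          _ ≤ C := ENNReal.coe_le_coe.2 (le_max_right _ _)
    · intro ε hε
      have h1 : Tendsto (fun k : ℕ => (n : ℝ) * (l / 2 ^ k)) atTop (𝓝 0) := by
        simpa using hlim.const_mul (n : ℝ)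
      filter_upwards [h1.eventually (gt_mem_nhds hε)] with k hk
      exact (hsub k).trans (closedBall_subset_closedBall hk.le)
  refine (hx.comp ht).congr fun k => ?_
  simp only [Function.comp_apply]
  have hae : closedCube (cellCenter a l k (cellIndex a l k x)) (l / 2 ^ k) =ᵐ[volume]
      cell a l k (cellIndex a l k x) :=
    (cube_ae_eq_of_subset (by positivity) (cube_subset_closedCube _ _) subset_rfl).symm.trans
      (cube_ae_eq_cell hl k _)
  rw [cellAverage, volume_closedCube _ (by positivity), setLIntegral_congr hae]
  congr 1
  refine setLIntegral_congr_fun (measurableSet_cell k _) fun y hy => ?_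
  refine Set.indicator_of_mem ?_ σ
  have := cell_subset_of_le (Nat.zero_le k) x hy
  rwa [hxQ'] at this

end DyadicCells

/-! ### Reverse Hölder inequality with the Fujii–Wilson constant -/

section ReverseHolder

open Filter Topology

/-- Integrating a good-lambda type bound between the superlevel sets of two measures. -/
theorem lintegral_rpow_le_of_superlevel_le {α : Type*} [MeasurableSpace α] {ρ μ : Measure α}
    {X : α → ℝ} (hX : Measurable X) (hX0 : ∀ x, 0 ≤ X x) {ε l₀ : ℝ} (hε : 0 < ε) (hl₀ : 0 ≤ l₀)
    {b : ℝ≥0∞} (hb : b ≠ ⊤)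
    (h : ∀ t, l₀ < t → ρ {x | t < X x} ≤ b * ENNReal.ofReal t * μ {x | t < X x}) :
    ∫⁻ x, ENNReal.ofReal (X x ^ ε) ∂ρ ≤ ENNReal.ofReal (l₀ ^ ε) * ρ Set.univ +
      b * ENNReal.ofReal (ε / (1 + ε)) * ∫⁻ x, ENNReal.ofReal (X x ^ (1 + ε)) ∂μ := by
  rw [lintegral_rpow_eq_lintegral_meas_lt_mul ρ (Eventually.of_forall hX0) hX.aemeasurable hε,
    lintegral_rpow_eq_lintegral_meas_lt_mul μ (Eventually.of_forall hX0) hX.aemeasurable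
      (by linarith : 0 < 1 + ε), ← Set.Ioc_union_Ioi_eq_Ioi hl₀,
    lintegral_union measurableSet_Ioi (Set.Ioc_disjoint_Ioi le_rfl), mul_add]
  -- Below l₀ no superlevel information is available, and the total mass of ρ is used.
  have h1 : ENNReal.ofReal ε * ∫⁻ t in Set.Ioc 0 l₀, ρ {x | t < X x} * ENNReal.ofReal (t ^ (ε - 1))
      ≤ ENNReal.ofReal (l₀ ^ ε) * ρ Set.univ := by
    have hint : ∫⁻ t in Set.Ioc 0 l₀, ENNReal.ofReal (t ^ (ε - 1)) =
        ENNReal.ofReal (l₀ ^ ε / ε) := by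
      have hi := intervalIntegral.intervalIntegrable_rpow' (a := 0) (b := l₀) (r := ε - 1)
        (by linarith)
      rw [intervalIntegrable_iff_integrableOn_Ioc_of_le hl₀] at hi
      rw [← ofReal_integral_eq_lintegral_ofReal hi
        ((ae_restrict_iff' measurableSet_Ioc).2 (Eventually.of_forall fun t ht =>
          Real.rpow_nonneg ht.1.le _)), ← intervalIntegral.integral_of_le hl₀,
        integral_rpow (Or.inl (by linarith))]
      simp [Real.zero_rpow hε.ne']
    calc _ ≤ ENNReal.ofReal ε * ∫⁻ t in Set.Ioc 0 l₀,
          ρ Set.univ * ENNReal.ofReal (t ^ (ε - 1)) := by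
          gcongr; exact Set.subset_univ _
      _ = ENNReal.ofReal ε * (ρ Set.univ * ENNReal.ofReal (l₀ ^ ε / ε)) := by
          rw [lintegral_const_mul _ (by fun_prop), hint]
      _ = (ENNReal.ofReal ε * ENNReal.ofReal (l₀ ^ ε / ε)) * ρ Set.univ := by ring
      _ = _ := by
          rw [← ENNReal.ofReal_mul hε.le, mul_div_cancel₀ _ hε.ne']
  refine add_le_add h1 ?_
  -- Above l₀ the extra factor t turns the layer-cake weight for ε into the one for 1 + ε, whence
  -- the ratio ε/(1 + ε).
  calc ENNReal.ofReal ε * ∫⁻ t in Set.Ioi l₀, ρ {x | t < X x} * ENNReal.ofReal (t ^ (ε - 1))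
      ≤ ENNReal.ofReal ε * ∫⁻ t in Set.Ioi l₀,
          b * (μ {x | t < X x} * ENNReal.ofReal (t ^ (1 + ε - 1))) := by
        gcongr 1
        refine setLIntegral_mono' measurableSet_Ioi fun t ht => ?_
        have ht0 : 0 < t := hl₀.trans_lt ht
        have e : ENNReal.ofReal (t ^ (1 + ε - 1)) =
            ENNReal.ofReal t * ENNReal.ofReal (t ^ (ε - 1)) := by
          rw [← ENNReal.ofReal_mul ht0.le, ← Real.rpow_one_add' ht0.le (by linarith)]
          congr 2; ring
        calc _ ≤ (b * ENNReal.ofReal t * μ {x | t < X x}) * ENNReal.ofReal (t ^ (ε - 1)) := by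
              gcongr; exact h t ht
          _ = _ := by rw [e]; ring
    _ = ENNReal.ofReal ε * (b * ∫⁻ t in Set.Ioi l₀,
          μ {x | t < X x} * ENNReal.ofReal (t ^ (1 + ε - 1))) := by
        rw [lintegral_const_mul' _ _ hb]
    _ ≤ ENNReal.ofReal ε * (b * ∫⁻ t in Set.Ioi 0,
          μ {x | t < X x} * ENNReal.ofReal (t ^ (1 + ε - 1))) := by
        gcongr
    _ = _ := by
        have : ENNReal.ofReal ε = ENNReal.ofReal (ε / (1 + ε)) * ENNReal.ofReal (1 + ε) := by
          rw [← ENNReal.ofReal_mul (by positivity), div_mul_cancel₀]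
          positivity
        rw [this, Set.Ioc_union_Ioi_eq_Ioi hl₀]; ring

variable {n : ℕ}

/-- The unit cube itself competes in the maximal function at each of its points. The bound gives
τ_n[σ]_{A_∞} > 1, hence ε > 0. -/
theorem one_le_aInftyConst {σ : EuclideanSpace ℝ (Fin n) → ℝ≥0∞}
    (hσ0 : ∫⁻ x in cube 0 1, σ x ≠ 0) (hσt : ∫⁻ x in cube 0 1, σ x ≠ ⊤) :
    1 ≤ aInftyConst σ := by
  have h1 : ∫⁻ x in cube 0 1, σ x ≤
      ∫⁻ x in cube 0 1, cubeMaximal ((cube (0 : EuclideanSpace ℝ (Fin n)) 1).indicator σ) x := by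
    have hv : volume (cube (0 : EuclideanSpace ℝ (Fin n)) 1) = 1 := by
      rw [volume_cube _ one_pos]; simp
    have hm := (isOpen_cube (0 : EuclideanSpace ℝ (Fin n)) 1).measurableSet
    calc ∫⁻ x in cube 0 1, σ x = ∫⁻ _ in cube (0 : EuclideanSpace ℝ (Fin n)) 1,
          ∫⁻ x in cube 0 1, σ x := by rw [setLIntegral_const, hv, mul_one]
      _ ≤ _ := by
          refine setLIntegral_mono' hm fun x hx => ?_
          refine le_trans (le_of_eq ?_) (le_iSup_of_le 0 (le_iSup_of_le 1
            (le_iSup_of_le one_pos (le_iSup_of_le hx le_rfl))))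
          rw [setLAverage_eq, hv, div_one]
          exact (setLIntegral_congr_fun hm fun y hy => Set.indicator_of_mem hy σ).symm
  refine le_trans ?_ (le_iSup_of_le 0 (le_iSup_of_le 1 (le_iSup_of_le one_pos le_rfl)))
  rw [← ENNReal.div_self hσ0 hσt]
  gcongr

theorem lintegral_cubeMaximal_le {σ : EuclideanSpace ℝ (Fin n) → ℝ≥0∞}
    {c : EuclideanSpace ℝ (Fin n)} {l : ℝ} (hl : 0 < l)
    (hσ0 : ∫⁻ x in cube c l, σ x ≠ 0) (hσt : ∫⁻ x in cube c l, σ x ≠ ⊤) :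
    ∫⁻ x in cube c l, cubeMaximal ((cube c l).indicator σ) x ≤
      aInftyConst σ * ∫⁻ x in cube c l, σ x := by
  rw [← ENNReal.div_le_iff hσ0 hσt]
  exact le_iSup_of_le c (le_iSup_of_le l (le_iSup_of_le hl le_rfl))

/-- The dyadic maximal function over generations at most `m`. -/
noncomputable def cellMaximal (a : EuclideanSpace ℝ (Fin n)) (l : ℝ)
    (σ : EuclideanSpace ℝ (Fin n) → ℝ≥0∞) (m : ℕ) (x : EuclideanSpace ℝ (Fin n)) : ℝ≥0∞ :=
  (Finset.range (m + 1)).sup fun k => cellAverage a l σ k x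

variable {a : EuclideanSpace ℝ (Fin n)} {l : ℝ} {σ : EuclideanSpace ℝ (Fin n) → ℝ≥0∞}

theorem measurable_cellMaximal (m : ℕ) : Measurable (cellMaximal a l σ m) := by
  unfold cellMaximal
  simp_rw [Finset.sup_eq_iSup]
  exact Measurable.iSup fun k => Measurable.iSup fun _ => measurable_cellAverage k

theorem cellAverage_le_cellMaximal {k m : ℕ} (hkm : k ≤ m) (x : EuclideanSpace ℝ (Fin n)) :
    cellAverage a l σ k x ≤ cellMaximal a l σ m x :=
  Finset.le_sup (f := fun k => cellAverage a l σ k x) (Finset.mem_range.2 (Nat.lt_succ_of_le hkm))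

theorem cellAverage_le_pow_mul (hl : 0 < l) (k : ℕ) (x : EuclideanSpace ℝ (Fin n)) :
    cellAverage a l σ k x ≤ (2 ^ n) ^ k * cellAverage a l σ 0 x := by
  induction k with
  | zero => simp
  | succ k ih =>
    refine (cellAverage_succ_le hl k x).trans ?_
    rw [pow_succ' (2 ^ n : ℝ≥0∞) k, mul_assoc]
    gcongr

/-- With only generations up to m the maximal function is bounded on a generation-zero cell of
finite mass; its (1 + ε)-moment is therefore finite and can be absorbed. -/
theorem cellMaximal_le_pow_mul (hl : 0 < l) (m : ℕ) (x : EuclideanSpace ℝ (Fin n)) :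
    cellMaximal a l σ m x ≤ (2 ^ n) ^ m * cellAverage a l σ 0 x := by
  refine Finset.sup_le fun k hk => (cellAverage_le_pow_mul hl k x).trans ?_
  gcongr
  · exact one_le_pow₀ (by norm_num)
  · exact Nat.lt_succ_iff.1 (Finset.mem_range.1 hk)

/-- A cell inside Q does not see the difference between σ and σχ_Q, so such averages are below the
localised maximal function of the Fujii–Wilson constant. -/
theorem cellAverage_le_cubeMaximal (hl : 0 < l) {j k : ℕ} (hkj : k ≤ j)
    {x y : EuclideanSpace ℝ (Fin n)} (hy : cellIndex a l k y = cellIndex a l k x)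
    (hyc : y ∈ cube (cellCenter a l j (cellIndex a l j y)) (l / 2 ^ j)) :
    cellAverage a l σ j y ≤ cubeMaximal ((cube (cellCenter a l k (cellIndex a l k x))
      (l / 2 ^ k)).indicator σ) y := by
  have hlj : 0 < l / 2 ^ j := by positivity
  refine le_trans (le_of_eq ?_) (le_iSup_of_le (cellCenter a l j (cellIndex a l j y))
    (le_iSup_of_le (l / 2 ^ j) (le_iSup_of_le hlj (le_iSup_of_le hyc le_rfl))))
  rw [setLAverage_eq, volume_cube _ hlj, cellAverage, setLIntegral_congr (cube_ae_eq_cell hl j _)]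
  congr 1
  have hmem : ∀ᵐ z : EuclideanSpace ℝ (Fin n),
      z ∈ cube (cellCenter a l k (cellIndex a l k x)) (l / 2 ^ k) ↔
        z ∈ cell a l k (cellIndex a l k x) := by
    filter_upwards [cube_ae_eq_cell (a := a) hl k (cellIndex a l k x)] with z hz
    exact iff_of_eq hz
  refine setLIntegral_congr_fun_ae (measurableSet_cell j _) ?_
  filter_upwards [hmem] with z hz hzj
  rw [Set.indicator_of_mem]
  rw [hz, ← hy]
  exact cell_subset_of_le hkj y hzj

/-- Decomposition of a superlevel set of the dyadic maximal function into maximal cells. -/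
theorem measure_superlevel_cellMaximal_le {z₀ : Fin n → ℤ} {m : ℕ} {t : ℝ≥0∞}
    (ht : ∀ x ∈ cell a l 0 z₀, cellAverage a l σ 0 x ≤ t)
    {ρ₁ ρ₂ : Measure (EuclideanSpace ℝ (Fin n))}
    (h : ∀ x ∈ cell a l 0 z₀, ∀ k, k + 1 ≤ m → t < cellAverage a l σ (k + 1) x →
      (∀ j ≤ k, cellAverage a l σ j x ≤ t) →
      ρ₁ (cell a l (k + 1) (cellIndex a l (k + 1) x)) ≤
        ρ₂ (cell a l (k + 1) (cellIndex a l (k + 1) x))) :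
    ρ₁ (cell a l 0 z₀ ∩ {x | t < cellMaximal a l σ m x}) ≤
      ρ₂ (cell a l 0 z₀ ∩ {x | t < cellMaximal a l σ m x}) := by
  -- Points are grouped by the first generation whose average exceeds t. Each group is a union of
  -- cells of that generation, and generation zero is excluded by the choice of t.
  set S : ℕ → Set (EuclideanSpace ℝ (Fin n)) := fun k =>
    {x | x ∈ cell a l 0 z₀ ∧ t < cellAverage a l σ k x ∧ ∀ j < k, cellAverage a l σ j x ≤ t} with hS
  have hunion : cell a l 0 z₀ ∩ {x | t < cellMaximal a l σ m x} =
      ⋃ k ∈ Finset.range (m + 1), S k := by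
    ext x
    simp only [Set.mem_inter_iff, Set.mem_ofPred_eq, Set.mem_iUnion, hS, cellMaximal,
      Finset.lt_sup_iff]
    constructor
    · rintro ⟨hx, k, hk, hkt⟩
      have hex : ∃ k, t < cellAverage a l σ k x := ⟨k, hkt⟩
      classical
      refine ⟨Nat.find hex, ?_, hx, Nat.find_spec hex, fun j hj => not_lt.1 (Nat.find_min hex hj)⟩
      exact Finset.mem_range.2 ((Nat.find_min' hex hkt).trans_lt (Finset.mem_range.1 hk))
    · rintro ⟨k, hk, hx, hkt, -⟩
      exact ⟨hx, k, hk, hkt⟩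
  have hSm : ∀ k, MeasurableSet (S k) := by
    intro k
    refine (measurableSet_cell 0 z₀).inter ((measurableSet_lt measurable_const
      (measurable_cellAverage k)).inter ?_)
    have : {x | ∀ j < k, cellAverage a l σ j x ≤ t} =
        ⋂ j, ⋂ (_ : j < k), {x | cellAverage a l σ j x ≤ t} := by ext; simp
    change MeasurableSet {x | ∀ j < k, cellAverage a l σ j x ≤ t}
    rw [this]
    exact MeasurableSet.iInter fun j => MeasurableSet.iInter fun _ =>
      measurableSet_le (measurable_cellAverage j) measurable_const
  have hdisj : Set.PairwiseDisjoint (↑(Finset.range (m + 1))) S := by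
    intro i _ j _ hij
    refine Set.disjoint_left.2 fun x hxi hxj => ?_
    rcases lt_or_gt_of_ne hij with h1 | h1
    · exact (hxj.2.2 i h1).not_gt hxi.2.1
    · exact (hxi.2.2 j h1).not_gt hxj.2.1
  rw [hunion, measure_biUnion_finset hdisj fun k _ => hSm k,
    measure_biUnion_finset hdisj fun k _ => hSm k]
  refine Finset.sum_le_sum fun k hk => ?_
  refine measure_le_of_forall_cell (a := a) (l := l) k (fun x hx y hy => ?_) fun x hx => ?_
  · have hle : ∀ j ≤ k, cellIndex a l j y = cellIndex a l j x := fun j hj =>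
      cellIndex_eq_of_le hj hy
    refine ⟨(hle 0 (Nat.zero_le k)).trans hx.1, ?_, fun j hj => ?_⟩
    · rw [cellAverage_congr (hle k le_rfl)]; exact hx.2.1
    · rw [cellAverage_congr (hle j hj.le)]; exact hx.2.2 j hj
  · cases k with
    | zero => exact absurd hx.2.1 (ht x hx.1).not_gt
    | succ k =>
      exact h x hx.1 k (Nat.lt_succ_iff.1 (Finset.mem_range.1 hk)) hx.2.1
        fun j hj => hx.2.2 j (Nat.lt_succ_of_le hj)

/-- On a maximal cell the parent average is still at most t, so ρ of the cell can be compared with t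
times its volume; integrating over t gives the estimate. It is used with density the maximal
function of σ, and then with density σ. -/
theorem lintegral_cellMaximal_rpow_le (hl : 0 < l)
    (hσt : ∀ x, cellAverage a l σ 0 x ≠ ⊤) {q : EuclideanSpace ℝ (Fin n)} {m : ℕ} {ε : ℝ}
    (hε : 0 < ε) {b : ℝ≥0∞} (hb : b ≠ ⊤) {ρ : Measure (EuclideanSpace ℝ (Fin n))}
    (h : ∀ x ∈ cell a l 0 (cellIndex a l 0 q), ∀ k, k + 1 ≤ m → ∀ t : ℝ≥0∞,
      t < cellAverage a l σ (k + 1) x → (∀ j ≤ k, cellAverage a l σ j x ≤ t) →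
      ρ (cell a l (k + 1) (cellIndex a l (k + 1) x)) ≤
        b * t * volume (cell a l (k + 1) (cellIndex a l (k + 1) x))) :
    ∫⁻ x in cell a l 0 (cellIndex a l 0 q), cellMaximal a l σ m x ^ ε ∂ρ ≤
      cellAverage a l σ 0 q ^ ε * ρ (cell a l 0 (cellIndex a l 0 q)) +
      b * ENNReal.ofReal (ε / (1 + ε)) *
        ∫⁻ x in cell a l 0 (cellIndex a l 0 q), cellMaximal a l σ m x ^ (1 + ε) := by
  set Q := cell a l 0 (cellIndex a l 0 q) with hQ
  have hQm : MeasurableSet Q := measurableSet_cell _ _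
  have hMt : ∀ x, cellMaximal a l σ m x ≠ ⊤ := fun x =>
    ne_top_of_le_ne_top (ENNReal.mul_ne_top (by finiteness) (hσt x)) (cellMaximal_le_pow_mul hl m x)
  have hpow : ∀ x (e : ℝ), 0 < e → ENNReal.ofReal ((cellMaximal a l σ m x).toReal ^ e) =
      cellMaximal a l σ m x ^ e := fun x e he => by
    rw [← ENNReal.ofReal_rpow_of_nonneg ENNReal.toReal_nonneg he.le, ENNReal.ofReal_toReal (hMt x)]
  have hlev : ∀ t : ℝ, 0 ≤ t → {x | t < (cellMaximal a l σ m x).toReal} =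
      {x | ENNReal.ofReal t < cellMaximal a l σ m x} := fun t ht => by
    ext x
    exact (ENNReal.ofReal_lt_iff_lt_toReal ht (hMt x)).symm
  have key := lintegral_rpow_le_of_superlevel_le (ρ := ρ.restrict Q) (μ := volume.restrict Q)
    (X := fun x => (cellMaximal a l σ m x).toReal) (measurable_cellMaximal m).ennreal_toReal
    (fun x => ENNReal.toReal_nonneg) hε (l₀ := (cellAverage a l σ 0 q).toReal)
    ENNReal.toReal_nonneg hb (fun t ht => ?_)
  · simp_rw [hpow _ _ hε, hpow _ _ (by linarith : 0 < 1 + ε)] at key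
    rw [← ENNReal.ofReal_rpow_of_nonneg ENNReal.toReal_nonneg hε.le,
      ENNReal.ofReal_toReal (hσt q)] at key
    simpa using key
  · have ht0 : 0 ≤ t := ENNReal.toReal_nonneg.trans ht.le
    have hm : MeasurableSet {x | ENNReal.ofReal t < cellMaximal a l σ m x} :=
      measurableSet_lt measurable_const (measurable_cellMaximal m)
    rw [hlev t ht0, Measure.restrict_apply hm, Measure.restrict_apply hm, Set.inter_comm]
    have h1 := measure_superlevel_cellMaximal_le (a := a) (l := l) (σ := σ)
      (z₀ := cellIndex a l 0 q) (m := m) (t := ENNReal.ofReal t) (ρ₁ := ρ)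
      (ρ₂ := (b * ENNReal.ofReal t) • volume) (fun x hx => ?_) (fun x hx k hk h1 h2 => ?_)
    · simpa using h1
    · rw [cellAverage_congr (show cellIndex a l 0 x = cellIndex a l 0 q from hx)]
      rw [← ENNReal.ofReal_toReal (hσt q)]
      exact ENNReal.ofReal_le_ofReal ht.le
    · simpa using h x hx k hk _ h1 h2

/-- With density the maximal function, the good-λ bound reads I ≤ A s₀^(1+ε)|Q| + I/2 for its (1 +
ε)-moment I, which is finite and can be absorbed. With density σ it then bounds the desired integral
by s₀^(1+ε)|Q| plus a multiple of I. -/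
theorem reverse_holder_cellMaximal (hl : 0 < l) (hσ : AEMeasurable σ)
    (hσ0 : ∀ (c : EuclideanSpace ℝ (Fin n)) (r : ℝ), 0 < r → ∫⁻ x in cube c r, σ x ≠ 0)
    (hσt : ∀ (c : EuclideanSpace ℝ (Fin n)) (r : ℝ), 0 < r → ∫⁻ x in cube c r, σ x ≠ ⊤)
    (hA : aInftyConst σ ≠ ⊤) (q : EuclideanSpace ℝ (Fin n)) (m : ℕ) {ε : ℝ}
    (hε : ε = 1 / (2 ^ (n + 1) * (aInftyConst σ).toReal - 1)) :
    ∫⁻ x in cell a l 0 (cellIndex a l 0 q), σ x * cellMaximal a l σ m x ^ ε ≤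
      2 * cellAverage a l σ 0 q ^ (1 + ε) * ENNReal.ofReal (l ^ n) := by
  set Q := cell a l 0 (cellIndex a l 0 q) with hQ
  set A := aInftyConst σ with hAd
  set s₀ := cellAverage a l σ 0 q with hs₀
  set v := ENNReal.ofReal (l ^ n) with hv
  have hQm : MeasurableSet Q := measurableSet_cell _ _
  have hA1 : 1 ≤ A := one_le_aInftyConst (hσ0 _ _ one_pos) (hσt _ _ one_pos)
  have hA1r : 1 ≤ A.toReal := by
    rw [← ENNReal.toReal_one]; exact ENNReal.toReal_mono hA hA1
  have hp : (2 : ℝ) ≤ 2 ^ (n + 1) := by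
    rw [pow_succ]; linarith [one_le_pow₀ (one_le_two : (1 : ℝ) ≤ 2) (n := n)]
  have hτ : 1 < 2 ^ (n + 1) * A.toReal := by nlinarith
  have hε0 : 0 < ε := by rw [hε]; exact one_div_pos.2 (by linarith)
  have hε2 : ε / (1 + ε) = 1 / (2 ^ (n + 1) * A.toReal) := by
    rw [hε]
    have : 2 ^ (n + 1) * A.toReal - 1 ≠ 0 := by linarith
    field_simp
    ring
  have hAr : A = ENNReal.ofReal A.toReal := (ENNReal.ofReal_toReal hA).symm
  have h2n : (2 : ℝ≥0∞) ^ n = ENNReal.ofReal (2 ^ n) := by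
    rw [ENNReal.ofReal_pow zero_le_two]; simp
  -- The choice of ε makes ε/(1 + ε) = 1/(2^(n+1) A), so the coefficient in front of I is exactly
  -- one half.
  have hhalf : A * 2 ^ n * ENNReal.ofReal (ε / (1 + ε)) = 2⁻¹ := by
    rw [hε2, hAr, h2n, ENNReal.toReal_ofReal ENNReal.toReal_nonneg,
      ← ENNReal.ofReal_mul (by positivity), ← ENNReal.ofReal_mul (by positivity),
      show A.toReal * 2 ^ n * (1 / (2 ^ (n + 1) * A.toReal)) = 2⁻¹ by rw [pow_succ]; field_simp,
      ENNReal.ofReal_inv_of_pos two_pos]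
    simp
  have hcell : ∀ k x, ∫⁻ y in cell a l k (cellIndex a l k x), σ y =
      ∫⁻ y in cube (cellCenter a l k (cellIndex a l k x)) (l / 2 ^ k), σ y := fun k x =>
    (setLIntegral_congr (cube_ae_eq_cell hl k _)).symm
  have hkpos : ∀ k : ℕ, 0 < l / 2 ^ k := fun k => by positivity
  have hcellt : ∀ x, cellAverage a l σ 0 x ≠ ⊤ := fun x => by
    rw [cellAverage, hcell]
    exact ENNReal.div_ne_top (hσt _ _ (hkpos 0)) (by positivity)
  have hvcell : ∀ k x, volume (cell a l k (cellIndex a l k x)) = ENNReal.ofReal ((l / 2 ^ k) ^ n) :=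
    fun k x => volume_cell hl k _
  have hσQ : ∫⁻ y in Q, σ y = s₀ * v := by
    rw [hQ, ← cellAverage_mul hl 0 q]; simp [hv, hs₀]
  have hvQ : volume Q = v := by rw [hQ, hvcell]; simp [hv]
  have hσcell : ∀ x, ∀ k, ∀ t : ℝ≥0∞, (∀ j ≤ k, cellAverage a l σ j x ≤ t) →
      ∫⁻ y in cell a l (k + 1) (cellIndex a l (k + 1) x), σ y ≤
        2 ^ n * t * volume (cell a l (k + 1) (cellIndex a l (k + 1) x)) := by
    intro x k t ht
    rw [← cellAverage_mul hl, hvcell]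
    gcongr
    exact (cellAverage_succ_le hl k x).trans (by gcongr; exact ht k le_rfl)
  -- On a stopping cell the coarser averages are at most t, hence below the average over the cell
  -- itself. Only cells inside it matter, and the Fujii–Wilson constant applies.
  have hMae : ∀ x k, k ≤ m → ∀ t : ℝ≥0∞, t < cellAverage a l σ k x →
      (∀ j < k, cellAverage a l σ j x ≤ t) →
      ∫⁻ y in cell a l k (cellIndex a l k x), cellMaximal a l σ m y ≤
        A * ∫⁻ y in cell a l k (cellIndex a l k x), σ y := by
    intro x k hk t ht hj
    rw [hcell]
    refine le_trans ?_ (lintegral_cubeMaximal_le (hkpos k) (hσ0 _ _ (hkpos k)) (hσt _ _ (hkpos k)))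
    rw [setLIntegral_congr (cube_ae_eq_cell hl k _)]
    refine lintegral_mono_ae ?_
    filter_upwards [ae_restrict_of_ae (ae_forall_mem_cube (a := a) hl),
      ae_restrict_mem (measurableSet_cell k _)] with y hy hyk
    refine Finset.sup_le fun j hjm => ?_
    rcases lt_or_ge j k with hjk | hjk
    · rw [cellAverage_congr (cellIndex_eq_of_le hjk.le hyk)]
      refine (hj j hjk).trans (ht.le.trans ?_)
      rw [← cellAverage_congr (show cellIndex a l k y = cellIndex a l k x from hyk)]
      exact cellAverage_le_cubeMaximal hl le_rfl hyk (hy k)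
    · exact cellAverage_le_cubeMaximal hl hjk hyk (hy j)
  have hMQ : ∫⁻ y in Q, cellMaximal a l σ m y ≤ A * (s₀ * v) := by
    rw [← hσQ]
    rcases eq_or_ne s₀ 0 with h0 | h0
    · exfalso
      refine hσ0 (cellCenter a l 0 (cellIndex a l 0 q)) (l / 2 ^ 0) (hkpos 0) ?_
      rw [← hcell, ← hQ, hσQ, h0, zero_mul]
    · exact hMae q 0 (Nat.zero_le m) 0 (pos_iff_ne_zero.2 h0) (by simp)
  set I := ∫⁻ x in Q, cellMaximal a l σ m x ^ (1 + ε) with hI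
  have hIt : I ≠ ⊤ := by
    refine ne_top_of_le_ne_top ?_ (setLIntegral_mono' hQm fun x hx => ?_ :
      I ≤ ∫⁻ _ in Q, ((2 ^ n) ^ m * s₀) ^ (1 + ε))
    · rw [setLIntegral_const, hvQ]
      have : s₀ ≠ ⊤ := hcellt q
      refine ENNReal.mul_ne_top (ENNReal.rpow_ne_top_of_nonneg (by linarith) ?_)
        ENNReal.ofReal_ne_top
      finiteness
    · have := cellMaximal_le_pow_mul (a := a) (σ := σ) hl m x
      rw [cellAverage_congr (show cellIndex a l 0 x = cellIndex a l 0 q from hx)] at this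
      gcongr
  have hMm : Measurable (cellMaximal a l σ m) := measurable_cellMaximal m
  have hpow1 : ∀ y : ℝ≥0∞, y ^ (1 + ε) = y * y ^ ε := fun y => by
    rw [ENNReal.rpow_add_of_nonneg _ _ zero_le_one hε0.le, ENNReal.rpow_one]
  have hIle : I ≤ 2 * (A * s₀ ^ (1 + ε) * v) := by
    have h1 := lintegral_cellMaximal_rpow_le (a := a) (l := l) (σ := σ) hl hcellt (q := q) (m := m)
      hε0 (b := A * 2 ^ n) (by finiteness)
      (ρ := volume.withDensity (cellMaximal a l σ m)) (fun x _ k hk t ht hj => by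
        rw [withDensity_apply _ (measurableSet_cell _ _)]
        refine (hMae x (k + 1) hk t ht fun j hjk => hj j (Nat.lt_succ_iff.1 hjk)).trans ?_
        rw [mul_assoc, mul_assoc]
        gcongr
        rw [← mul_assoc]
        exact hσcell x k t hj)
    rw [hhalf, withDensity_apply _ (measurableSet_cell _ _), ← hQ,
      restrict_withDensity hQm, lintegral_withDensity_eq_lintegral_mul _ hMm (hMm.pow_const _)] at h1
    simp only [Pi.mul_apply, ← hpow1] at h1
    rw [← hI] at h1
    have h2 : I ≤ A * s₀ ^ (1 + ε) * v + 2⁻¹ * I := by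
      have h5 : s₀ ^ ε * ∫⁻ y in Q, cellMaximal a l σ m y ≤ A * s₀ ^ (1 + ε) * v :=
        calc _ ≤ s₀ ^ ε * (A * (s₀ * v)) := mul_le_mul_right hMQ _
          _ = _ := by rw [hpow1]; ring
      exact h1.trans (add_le_add h5 le_rfl)
    have h3 : 2⁻¹ * I + 2⁻¹ * I = I := by
      rw [← add_mul, ENNReal.inv_two_add_inv_two, one_mul]
    have h4 : 2⁻¹ * I ≤ A * s₀ ^ (1 + ε) * v := by
      have hfin : 2⁻¹ * I ≠ ⊤ := by finiteness
      refine (ENNReal.add_le_add_iff_right hfin).1 ?_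
      rwa [h3]
    calc I = 2 * (2⁻¹ * I) := by
          rw [← mul_assoc, ENNReal.mul_inv_cancel (by simp) (by simp), one_mul]
      _ ≤ _ := by gcongr
  have h1 := lintegral_cellMaximal_rpow_le (a := a) (l := l) (σ := σ) hl hcellt (q := q) (m := m)
    hε0 (b := 2 ^ n) (by finiteness)
    (ρ := volume.withDensity σ) (fun x _ k _ t _ hj => by
      rw [withDensity_apply _ (measurableSet_cell _ _)]
      exact hσcell x k t hj)
  rw [withDensity_apply _ (measurableSet_cell _ _), ← hQ, restrict_withDensity hQm,
    lintegral_withDensity_eq_lintegral_mul₀ hσ.restrict (hMm.pow_const _).aemeasurable, hσQ] at h1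
  refine h1.trans ?_
  calc s₀ ^ ε * (s₀ * v) + 2 ^ n * ENNReal.ofReal (ε / (1 + ε)) * I
      ≤ s₀ ^ ε * (s₀ * v) + 2 ^ n * ENNReal.ofReal (ε / (1 + ε)) * (2 * (A * s₀ ^ (1 + ε) * v)) := by
        gcongr
    _ = s₀ ^ (1 + ε) * v +
        2 * (A * 2 ^ n * ENNReal.ofReal (ε / (1 + ε))) * (s₀ ^ (1 + ε) * v) := by
        rw [hpow1]; ring
    _ = _ := by
        rw [hhalf, ENNReal.mul_inv_cancel (by simp) (by simp), one_mul]; ring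

/-- The reverse Hölder inequality with the Fujii-Wilson constant. -/
theorem reverse_holder (hn : 0 < n) (hσ : AEMeasurable σ)
    (hσ0 : ∀ (c : EuclideanSpace ℝ (Fin n)) (r : ℝ), 0 < r → ∫⁻ x in cube c r, σ x ≠ 0)
    (hσt : ∀ (c : EuclideanSpace ℝ (Fin n)) (r : ℝ), 0 < r → ∫⁻ x in cube c r, σ x ≠ ⊤)
    (hA : aInftyConst σ ≠ ⊤) {ε : ℝ} (hε0 : 0 ≤ ε)
    (hε : ε = 1 / (2 ^ (n + 1) * (aInftyConst σ).toReal - 1)) (c : EuclideanSpace ℝ (Fin n))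
    (hl : 0 < l) :
    ⨍⁻ x in cube c l, σ x ^ (1 + ε) ∂volume ≤ 2 * (⨍⁻ x in cube c l, σ x ∂volume) ^ (1 + ε) := by
  -- The corner of the grid is chosen so that the given cube is, up to a null set, the cell of
  -- generation 0 and index 0.
  set a : EuclideanSpace ℝ (Fin n) := WithLp.toLp 2 fun i => c i - l / 2 with ha
  have hcq : cellIndex a l 0 c = 0 := by
    funext i
    simp only [cellIndex, ha, Pi.zero_apply]
    rw [Int.floor_eq_iff]
    have : (c i - (c i - l / 2)) * 2 ^ 0 / l = 1 / 2 := by field_simp; ring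
    rw [this]; norm_num
  have hcc : cellCenter a l 0 0 = c := by
    ext i; simp [cellCenter, ha]; ring
  have hae : cube c l =ᵐ[volume] cell a l 0 (cellIndex a l 0 c) := by
    have := cube_ae_eq_cell (a := a) hl 0 0
    rw [hcc] at this
    rw [hcq]
    simpa using this
  have hv : volume (cube c l) = ENNReal.ofReal (l ^ n) := volume_cube c hl
  have hav : ⨍⁻ x in cube c l, σ x ∂volume = cellAverage a l σ 0 c := by
    rw [setLAverage_eq, hv, cellAverage, setLIntegral_congr hae]; simp
  have hQt : ∫⁻ y in cell a l 0 (cellIndex a l 0 c), σ y ≠ ⊤ := by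
    rw [← setLIntegral_congr hae]; exact hσt c l hl
  have hpow1 : ∀ y : ℝ≥0∞, y ^ (1 + ε) = y * y ^ ε := fun y => by
    rw [ENNReal.rpow_add_of_nonneg _ _ zero_le_one hε0, ENNReal.rpow_one]
  rw [hav, setLAverage_eq, hv, setLIntegral_congr hae,
    ENNReal.div_le_iff (by positivity) ENNReal.ofReal_ne_top]
  have hσfin : ∀ᵐ x ∂(volume.restrict (cell a l 0 (cellIndex a l 0 c))), σ x < ⊤ :=
    ae_lt_top' hσ.restrict hQt
  -- By differentiation σ^(1+ε) is at most the liminf of σ times the ε-th power of the truncated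
  -- maximal function; Fatou then removes the truncation m.
  calc ∫⁻ x in cell a l 0 (cellIndex a l 0 c), σ x ^ (1 + ε)
      ≤ ∫⁻ x in cell a l 0 (cellIndex a l 0 c),
          liminf (fun m => σ x * cellMaximal a l σ m x ^ ε) atTop := by
        refine lintegral_mono_ae ?_
        filter_upwards [ae_tendsto_cellAverage hn hl hσ _ hQt, hσfin] with x hx hxt
        have h1 : Tendsto (fun m => σ x * cellAverage a l σ m x ^ ε) atTop (𝓝 (σ x * σ x ^ ε)) :=
          ENNReal.Tendsto.const_mul ((ENNReal.continuous_rpow_const.tendsto _).comp hx)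
            (Or.inr hxt.ne)
        rw [hpow1, ← h1.liminf_eq]
        refine liminf_le_liminf (Eventually.of_forall fun m => ?_)
        gcongr
        exact cellAverage_le_cellMaximal le_rfl x
    _ ≤ liminf (fun m => ∫⁻ x in cell a l 0 (cellIndex a l 0 c),
          σ x * cellMaximal a l σ m x ^ ε) atTop :=
        lintegral_liminf_le' fun m =>
          hσ.restrict.mul ((measurable_cellMaximal m).pow_const _).aemeasurable
    _ ≤ liminf (fun _ : ℕ => 2 * cellAverage a l σ 0 c ^ (1 + ε) * ENNReal.ofReal (l ^ n)) atTop :=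
        liminf_le_liminf (Eventually.of_forall fun m =>
          reverse_holder_cellMaximal hl hσ hσ0 hσt hA c m hε)
    _ = _ := by simp

end ReverseHolder

/-! ### Positivity, finiteness and self-improvement of A_r weights -/

section ApWeights

open Filter Topology

variable {n : ℕ}

theorem setLAverage_le_mul {α : Type*} [MeasurableSpace α] {μ : Measure α} {S S' : Set α}
    (hSS : S ⊆ S') {D : ℝ≥0∞} (hS : μ S' ≤ D * μ S) (h0 : μ S ≠ 0) (h1 : μ S' ≠ ⊤)
    (f : α → ℝ≥0∞) : ⨍⁻ x in S, f x ∂μ ≤ D * ⨍⁻ x in S', f x ∂μ := by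
  have h2 : μ S ≠ ⊤ := ne_top_of_le_ne_top h1 (measure_mono hSS)
  have h3 : μ S' ≠ 0 := fun h => h0 (le_antisymm (h ▸ measure_mono hSS) zero_le)
  rw [setLAverage_eq, setLAverage_eq, ENNReal.div_le_iff h0 h2]
  calc ∫⁻ x in S, f x ∂μ ≤ ∫⁻ x in S', f x ∂μ := lintegral_mono_set hSS
    _ = (∫⁻ x in S', f x ∂μ) / μ S' * μ S' := (ENNReal.div_mul_cancel h3 h1).symm
    _ ≤ (∫⁻ x in S', f x ∂μ) / μ S' * (D * μ S) := by gcongr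
    _ = _ := by ring

theorem ae_of_forall_ball {P : EuclideanSpace ℝ (Fin n) → Prop} {R₀ : ℝ}
    (h : ∀ R, R₀ ≤ R → ∀ᵐ x ∂(volume.restrict (ball (0 : EuclideanSpace ℝ (Fin n)) R)), P x) :
    ∀ᵐ x, P x := by
  have h1 : ∀ᵐ x : EuclideanSpace ℝ (Fin n), ∀ k : ℕ, R₀ ≤ k →
      x ∈ ball (0 : EuclideanSpace ℝ (Fin n)) k → P x := by
    rw [ae_all_iff]
    intro k
    by_cases hk : R₀ ≤ k
    · filter_upwards [(ae_restrict_iff' measurableSet_ball).1 (h k hk)] with x hx _ using hx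
    · exact Eventually.of_forall fun x h => absurd h hk
  filter_upwards [h1] with x hx
  obtain ⟨k, hk⟩ := exists_nat_gt (max R₀ ‖x‖)
  exact hx k ((le_max_left _ _).trans hk.le)
    (mem_ball_zero_iff.2 ((le_max_right _ _).trans_lt hk))

theorem exists_forall_lintegral_ball_ne_zero {w : EuclideanSpace ℝ (Fin n) → ℝ≥0∞}
    (hm : AEMeasurable w) (h : ¬ w =ᵐ[volume] 0) :
    ∃ R₀ : ℝ, 0 < R₀ ∧ ∀ R, R₀ ≤ R → ∫⁻ x in ball 0 R, w x ≠ 0 := by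
  by_contra! hcon
  refine h (ae_of_forall_ball (R₀ := 1) fun R hR => ?_)
  obtain ⟨R', hR', h0⟩ := hcon R (by linarith)
  have := (lintegral_eq_zero_iff' hm.restrict).1 h0
  exact ae_mono (Measure.restrict_mono_set volume (ball_subset_ball hR')) this

theorem cube_subset_ball (hn : 0 < n) (x : EuclideanSpace ℝ (Fin n)) {R : ℝ} (hR : 0 < R) :
    cube x (2 * R) ⊆ ball x (2 * n * R) := by
  intro y hy
  have hn' : (0 : ℝ) < n := by exact_mod_cast hn
  rw [mem_ball, dist_eq_norm, ← (EuclideanSpace.basisFun (Fin n) ℝ).sum_repr (y - x)]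
  refine (norm_sum_le _ _).trans_lt ?_
  calc _ ≤ ∑ i : Fin n, R := by
        refine Finset.sum_le_sum fun i _ => ?_
        rw [norm_smul, (EuclideanSpace.basisFun (Fin n) ℝ).norm_eq_one, mul_one,
          EuclideanSpace.basisFun_repr, Real.norm_eq_abs, PiLp.sub_apply]
        linarith [hy i]
    _ = n * R := by simp
    _ < _ := by nlinarith

theorem ball_subset_cube (x : EuclideanSpace ℝ (Fin n)) (R : ℝ) :
    ball x R ⊆ cube x (2 * R) := by
  intro y hy i
  have h1 : |y i - x i| ≤ ‖y - x‖ := by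
    simpa using PiLp.norm_apply_le (y - x) i
  rw [mem_ball, dist_eq_norm] at hy
  linarith

theorem one_sub_conjExponent {r : ℝ} (hr : 1 < r) :
    1 - Real.conjExponent r = -(1 / (r - 1)) := by
  have : r - 1 ≠ 0 := by linarith
  rw [Real.conjExponent]; field_simp; ring

namespace IsApWeight

variable {r : ℝ} {w : EuclideanSpace ℝ (Fin n) → ℝ≥0∞}

theorem ae_ne_top (hw : IsApWeight r w) : ∀ᵐ x, w x ≠ ⊤ :=
  ae_of_forall_ball (R₀ := 0) fun R _ =>
    (ae_lt_top' hw.aemeasurable.restrict (hw.lintegral_ball_lt_top 0 R).ne).mono fun _ h => h.ne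

theorem ae_ballMaximal_le (hw : IsApWeight 1 w) :
    ∀ᵐ x, ballMaximal w x ≤ apConst 1 w * w x := by
  have hK := hw.apConst_lt_top
  rw [apConst, if_pos rfl] at hK ⊢
  filter_upwards [ENNReal.ae_le_essSup (μ := volume) fun x => ballMaximal w x / w x,
    hw.ae_ne_top] with x hx hxt
  exact (ENNReal.div_le_iff_le_mul (Or.inr hK.ne) (Or.inl hxt)).1 hx

theorem laverage_mul_le (hr : 1 < r) (c : EuclideanSpace ℝ (Fin n)) {R : ℝ} (hR : 0 < R) :
    (⨍⁻ y in ball c R, w y ∂volume) *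
      (⨍⁻ y in ball c R, dualWeight r w y ∂volume) ^ (r - 1) ≤ apConst r w := by
  rw [apConst, if_neg hr.ne']
  exact le_iSup_of_le c (le_iSup_of_le R (le_iSup_of_le hR le_rfl))

/-- Enlarge the ball until w has positive mass on it; an infinite dual integral there would make the
A_r product infinite. -/
theorem lintegral_dualWeight_ball_ne_top (hr : 1 < r) (hw : IsApWeight r w)
    (c : EuclideanSpace ℝ (Fin n)) (R : ℝ) : ∫⁻ y in ball c R, dualWeight r w y ≠ ⊤ := by
  obtain ⟨R₀, hR₀, h0⟩ := exists_forall_lintegral_ball_ne_zero hw.aemeasurable hw.not_ae_zero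
  set R' := max R₀ (R + dist c 0) with hR'
  have hR'0 : 0 < R' := lt_max_of_lt_left hR₀
  have hsub : ball c R ⊆ ball 0 R' := ball_subset_ball' (le_max_right _ _)
  refine ne_top_of_le_ne_top ?_ (lintegral_mono_set hsub)
  intro htop
  have h1 := laverage_mul_le (w := w) hr 0 hR'0
  rw [setLAverage_eq, setLAverage_eq, htop, ENNReal.top_div_of_ne_top (volume_ball_ne_top _ _),
    ENNReal.top_rpow_of_pos (by linarith), ENNReal.mul_top] at h1
  · exact hw.apConst_lt_top.ne (top_le_iff.1 h1)
  · exact (ENNReal.div_pos (h0 R' (le_max_left _ _)) (volume_ball_ne_top _ _)).ne'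

/-- For r = 1, w(x) = 0 would force Mw(x) = 0, which a large ball about the origin contradicts. For
r > 1 the dual weight would be infinite there, though it is locally integrable. -/
theorem ae_ne_zero (hr : 1 ≤ r) (hw : IsApWeight r w) : ∀ᵐ x, w x ≠ 0 := by
  obtain ⟨R₀, hR₀, h0⟩ := exists_forall_lintegral_ball_ne_zero hw.aemeasurable hw.not_ae_zero
  rcases hr.eq_or_lt with rfl | hr1
  · filter_upwards [hw.ae_ballMaximal_le] with x hx hx0
    rw [hx0, mul_zero] at hx
    set R := max R₀ (‖x‖ + 1)
    have hxR : x ∈ ball (0 : EuclideanSpace ℝ (Fin n)) R := by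
      rw [mem_ball_zero_iff]; exact (lt_add_one _).trans_le (le_max_right _ _)
    have h1 : ⨍⁻ y in ball 0 R, w y ∂volume ≤ ballMaximal w x :=
      le_iSup_of_le 0 (le_iSup_of_le R (le_iSup_of_le hxR le_rfl))
    rw [setLAverage_eq] at h1
    exact (ENNReal.div_pos (h0 R (le_max_left _ _)) (volume_ball_ne_top _ _)).ne'
      (le_antisymm (h1.trans hx) zero_le)
  · refine ae_of_forall_ball (R₀ := 0) fun R _ => ?_
    filter_upwards [ae_lt_top' (hw.aemeasurable.restrict.pow_const (1 - Real.conjExponent r))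
      (lintegral_dualWeight_ball_ne_top hr1 hw 0 R)] with x hx hx0
    rw [hx0, ENNReal.zero_rpow_of_neg] at hx
    · exact hx.ne rfl
    · rw [one_sub_conjExponent hr1, neg_lt_zero]; exact one_div_pos.2 (by linarith)

theorem lintegral_ball_ne_zero (hr : 1 ≤ r) (hw : IsApWeight r w)
    (c : EuclideanSpace ℝ (Fin n)) {R : ℝ} (hR : 0 < R) : ∫⁻ x in ball c R, w x ≠ 0 := by
  intro h
  have h1 := (lintegral_eq_zero_iff' hw.aemeasurable.restrict).1 h
  have h2 : ∀ᵐ x ∂(volume.restrict (ball c R)), False := by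
    filter_upwards [h1, ae_restrict_of_ae (hw.ae_ne_zero hr)] with x hx hx0 using hx0 hx
  rw [eventually_false_iff_eq_bot, ae_eq_bot, Measure.restrict_eq_zero] at h2
  exact volume_ball_ne_zero c hR h2

/-- A weight in `A_r` satisfies the two-ball condition with the self-improved exponent. -/
theorem exists_hasPairBound (hn : 0 < n) {D : ℝ} (hD : D = (2 * n) ^ n) (hr : 1 ≤ r) (hrn : r ≤ n)
    (hw : IsApWeight r w) :
    ∃ s, 1 ≤ s ∧ s ≤ r ∧
      HasPairBound s (ENNReal.ofReal (D * (2 * D) ^ n * D ^ n) * apConst r w) w ∧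
      ∀ p, r ≤ p → p < n → p ≤ weightedSobolevExponent p r w ∧
        weightedSobolevExponent p r w ≤ (1 / p - 1 / (n * s))⁻¹ := by
  have hn' : (1 : ℝ) ≤ n := by exact_mod_cast hn
  have hD1 : 1 ≤ D := by rw [hD]; exact one_le_pow₀ (by linarith)
  have hDC : 1 ≤ D * (2 * D) ^ n * D ^ n :=
    one_le_mul_of_one_le_of_one_le (one_le_mul_of_one_le_of_one_le hD1
      (one_le_pow₀ (by linarith))) (one_le_pow₀ hD1)
  have hKle : apConst r w ≤ ENNReal.ofReal (D * (2 * D) ^ n * D ^ n) * apConst r w :=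
    le_mul_of_one_le_left zero_le (ENNReal.one_le_ofReal.2 hDC)
  have hlow : ∀ p s : ℝ, 1 ≤ s → 1 ≤ p → p < n → 0 < 1 / p - 1 / (n * s) ∧
      p ≤ (1 / p - 1 / (n * s))⁻¹ := by
    intro p s hs hp hpn
    have h1 : 1 / (n * s) < 1 / p := one_div_lt_one_div_of_lt (by linarith) (by nlinarith)
    have h2 : 0 < 1 / p - 1 / (n * s) := by linarith
    refine ⟨h2, ?_⟩
    rw [le_inv_comm₀ (by linarith) h2, ← one_div]
    have : 0 < 1 / (n * s) := by positivity
    linarith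
  rcases hr.eq_or_lt with rfl | hr1
  · refine ⟨1, le_rfl, le_rfl, ?_, fun p hp hpn => ?_⟩
    · refine HasPairBound.of_ae_laverage_le
        (ENNReal.mul_ne_top ENNReal.ofReal_ne_top hw.apConst_lt_top.ne) (fun x R hR => ?_)
        (fun x R => (hw.lintegral_ball_lt_top x R).ne)
      filter_upwards [ae_restrict_of_ae hw.ae_ballMaximal_le, ae_restrict_mem measurableSet_ball]
        with y hy hyB
      calc _ ≤ ballMaximal w y := le_iSup_of_le x (le_iSup_of_le R (le_iSup_of_le hyB le_rfl))
        _ ≤ _ := hy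
        _ ≤ _ := by gcongr
    · have h := hlow p 1 le_rfl hp hpn
      have e : weightedSobolevExponent p 1 w = (1 / p - 1 / (n * 1))⁻¹ := by
        rw [weightedSobolevExponent, if_pos rfl, sobolevExponent]
        have : (n : ℝ) - p ≠ 0 := by linarith
        have : p ≠ 0 := by linarith
        have : (n : ℝ) ≠ 0 := by linarith
        field_simp
      rw [e]
      exact ⟨h.2, le_rfl⟩
  · set σ := dualWeight r w with hσ
    have hσm : AEMeasurable σ := hw.aemeasurable.pow_const _
    have he : 1 - Real.conjExponent r = -(1 / (r - 1)) := one_sub_conjExponent hr1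
    have hσball := lintegral_dualWeight_ball_ne_top hr1 hw
    have hσt : ∀ (c : EuclideanSpace ℝ (Fin n)) (l : ℝ), 0 < l → ∫⁻ x in cube c l, σ x ≠ ⊤ := by
      intro c l hl
      have := cube_subset_ball hn c (half_pos hl)
      rw [mul_div_cancel₀ _ two_ne_zero] at this
      exact ne_top_of_le_ne_top (hσball c _) (lintegral_mono_set this)
    have hσ0 : ∀ (c : EuclideanSpace ℝ (Fin n)) (l : ℝ), 0 < l → ∫⁻ x in cube c l, σ x ≠ 0 := by
      intro c l hl h
      have h1 := (lintegral_eq_zero_iff' hσm.restrict).1 h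
      have h2 : ∀ᵐ x ∂(volume.restrict (cube c l)), False := by
        filter_upwards [h1, ae_restrict_of_ae hw.ae_ne_top] with x hx hxt
        rw [hσ, dualWeight, Pi.zero_apply, he, ENNReal.rpow_eq_zero_iff] at hx
        rcases hx with ⟨-, h3⟩ | ⟨h3, -⟩
        · have : 0 < 1 / (r - 1) := one_div_pos.2 (by linarith)
          linarith
        · exact hxt h3
      rw [eventually_false_iff_eq_bot, ae_eq_bot, Measure.restrict_eq_zero, volume_cube _ hl] at h2
      exact (by positivity : ENNReal.ofReal (l ^ n) ≠ 0) h2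
    -- `toReal` sends an infinite constant to 0, so that q_r = p. Then s = r suffices, since only
    -- q_r ≤ (1/p − 1/(ns))⁻¹ is required.
    by_cases hA : aInftyConst σ = ⊤
    · refine ⟨r, hr, le_rfl, ?_, fun p hp hpn => ?_⟩
      · refine HasPairBound.of_dual hr1 hw.aemeasurable (fun x R hR => ?_) (hw.ae_ne_zero hr)
          hw.ae_ne_top
        rw [← he]
        exact (laverage_mul_le hr1 x hR).trans hKle
      · have e : weightedSobolevExponent p r w = p := by
          rw [weightedSobolevExponent, if_neg hr1.ne', ← hσ, hA]; simp
        rw [e]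
        exact ⟨le_rfl, (hlow p r hr (by linarith) hpn).2⟩
    · have hA1 : 1 ≤ (aInftyConst σ).toReal := by
        rw [← ENNReal.toReal_one]
        exact ENNReal.toReal_mono hA (one_le_aInftyConst (hσ0 _ _ one_pos) (hσt _ _ one_pos))
      set T := 2 ^ (n + 1) * (aInftyConst σ).toReal with hT
      have hp2 : (2 : ℝ) ≤ 2 ^ (n + 1) := by
        rw [pow_succ]; linarith [one_le_pow₀ (one_le_two : (1 : ℝ) ≤ 2) (n := n)]
      have hT1 : 1 < T := by nlinarith
      -- Equivalently s − 1 = (r − 1)/(1 + ε), so that w^(-1/(s-1)) = σ^(1+ε); and 1/s = T/(1 + r(T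
      -- − 1)), the fraction in the definition of q_r.
      set s := r - (r - 1) / T with hs
      have hs1' : s - 1 = (r - 1) * ((T - 1) / T) := by rw [hs]; field_simp; ring
      have hs1 : 1 < s := by
        have : 0 < (r - 1) * ((T - 1) / T) :=
          mul_pos (by linarith) (div_pos (by linarith) (by linarith))
        linarith
      have hsr : s ≤ r := by
        have : 0 ≤ (r - 1) / T := div_nonneg (by linarith) (by linarith)
        linarith
      set ε := 1 / (T - 1) with hεd
      have hε0 : 0 ≤ ε := one_div_nonneg.2 (by linarith)
      have hTn : T - 1 ≠ 0 := by linarith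
      have hrn0 : r - 1 ≠ 0 := by linarith
      have hse : (s - 1) * (1 + ε) = r - 1 := by
        rw [hs1', hεd]; field_simp; ring
      have hexp : -(1 / (s - 1)) = (1 - Real.conjExponent r) * (1 + ε) := by
        rw [he, hs1', hεd]; field_simp; ring
      refine ⟨s, hs1.le, hsr, ?_, fun p hp hpn => ?_⟩
      · refine HasPairBound.of_dual hs1 hw.aemeasurable (fun x R hR => ?_) (hw.ae_ne_zero hr)
          hw.ae_ne_top
        set d := ENNReal.ofReal D with hd
        have hd1 : 1 ≤ d := ENNReal.one_le_ofReal.2 hD1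
        have hBB : volume (ball x (2 * n * R)) = d * volume (ball x R) := by
          rw [volume_ball_eq_mul x x hR (by positivity), hd, hD, mul_div_cancel_right₀ _ hR.ne']
        have hR2 : 0 < 2 * R := by positivity
        -- Reverse Hölder is about cubes and A_r about balls: a cube is placed between the balls of
        -- radius R and 2nR, at the price of factors D = (2n)^n.
        have hBQ := ball_subset_cube x R
        have hQB := cube_subset_ball hn x hR
        have hQ0 : volume (cube x (2 * R)) ≠ 0 := by rw [volume_cube _ hR2]; positivity
        have hQt : volume (cube x (2 * R)) ≠ ⊤ := by rw [volume_cube _ hR2]; finiteness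
        have h1 := setLAverage_le_mul (μ := volume) (hBQ.trans hQB) hBB.le (volume_ball_ne_zero x hR)
          (volume_ball_ne_top _ _) w
        have h2 := setLAverage_le_mul (μ := volume) hBQ ((measure_mono hQB).trans hBB.le)
          (volume_ball_ne_zero x hR) hQt (fun y => σ y ^ (1 + ε))
        have h3 := setLAverage_le_mul (μ := volume) hQB
          (hBB.le.trans (by gcongr)) hQ0 (volume_ball_ne_top _ _) σ
        have h4 := reverse_holder hn hσm hσ0 hσt hA hε0 hεd x hR2
        have h5 : ∀ y, w y ^ (-(1 / (s - 1))) = σ y ^ (1 + ε) := by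
          intro y; rw [hσ, dualWeight, ← ENNReal.rpow_mul, hexp]
        simp_rw [h5]
        have hs0 : 0 ≤ s - 1 := by linarith
        have hr0 : 0 ≤ r - 1 := by linarith
        -- Both s − 1 and r − 1 are at most n, so powers of these factors are bounded by a constant
        -- depending on n alone.
        have hdt : ∀ {e : ℝ}, 0 ≤ e → e ≤ n → ∀ {z : ℝ≥0∞}, 1 ≤ z → z ^ e ≤ z ^ n := by
          intro e _ hen z hz
          rw [← ENNReal.rpow_natCast]
          exact ENNReal.rpow_le_rpow_of_exponent_le hz hen
        set W := ⨍⁻ y in ball x (2 * n * R), w y ∂volume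
        set S := ⨍⁻ y in ball x (2 * n * R), σ y ∂volume
        have h6 : (⨍⁻ y in ball x R, σ y ^ (1 + ε) ∂volume) ^ (s - 1) ≤
            (2 * d) ^ n * d ^ n * S ^ (r - 1) := by
          calc _ ≤ (d * (2 * (d * S) ^ (1 + ε))) ^ (s - 1) := by
                gcongr
                exact h2.trans (mul_le_mul_right (h4.trans (by gcongr)) _)
            _ = ((2 * d) * (d * S) ^ (1 + ε)) ^ (s - 1) := by ring_nf
            _ = (2 * d) ^ (s - 1) * (d ^ (r - 1) * S ^ (r - 1)) := by
                rw [ENNReal.mul_rpow_of_nonneg _ _ hs0, ← ENNReal.rpow_mul,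
                  show (1 + ε) * (s - 1) = r - 1 by rw [← hse]; ring,
                  ENNReal.mul_rpow_of_nonneg _ _ hr0]
            _ ≤ (2 * d) ^ n * (d ^ n * S ^ (r - 1)) := by
                gcongr
                · exact hdt hs0 (by linarith) (one_le_mul one_le_two hd1)
                · exact hdt hr0 (by linarith) hd1
            _ = _ := by ring
        calc _ ≤ (d * W) * ((2 * d) ^ n * d ^ n * S ^ (r - 1)) := mul_le_mul' h1 h6
          _ = (d * (2 * d) ^ n * d ^ n) * (W * S ^ (r - 1)) := by ring
          _ ≤ (d * (2 * d) ^ n * d ^ n) * apConst r w := by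
              gcongr
              exact laverage_mul_le hr1 x (by positivity)
          _ = _ := by
              have e2 : ENNReal.ofReal (D * (2 * D) ^ n * D ^ n) = d * (2 * d) ^ n * d ^ n := by
                rw [ENNReal.ofReal_mul (by positivity), ENNReal.ofReal_mul (by positivity),
                  ENNReal.ofReal_pow (by positivity), ENNReal.ofReal_pow (by positivity),
                  ENNReal.ofReal_mul (by positivity)]
                simp [hd]
              rw [e2]
      · have h := hlow p s hs1.le (by linarith) hpn
        have e : weightedSobolevExponent p r w = (1 / p - 1 / (n * s))⁻¹ := by
          rw [weightedSobolevExponent, if_neg hr1.ne', ← hσ, ← hT]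
          have h7 : s = (1 + r * (T - 1)) / T := by rw [hs]; field_simp; ring
          have h8 : 1 + r * (T - 1) ≠ 0 := by nlinarith
          have h9 : T ≠ 0 := by linarith
          congr 2
          rw [h7]
          field_simp
        rw [e]
        exact ⟨h.2, le_rfl⟩

end IsApWeight

end ApWeights

/-! ### Besicovitch covering and Hedberg's splitting -/

section WeakType

open Filter Topology

variable {n : ℕ}

/-- The Besicovitch covering theorem as a comparison of measures. -/
theorem exists_measure_le_of_forall_closedBall (n : ℕ) :
    ∃ N : ℕ, 0 < N ∧ ∀ (μ ν : Measure (EuclideanSpace ℝ (Fin n)))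
      (S : Set (EuclideanSpace ℝ (Fin n))) (r : EuclideanSpace ℝ (Fin n) → ℝ) (R : ℝ),
      (∀ x ∈ S, 0 < r x ∧ r x ≤ R ∧ μ (closedBall x (r x)) ≤ ν (closedBall x (r x))) →
      μ S ≤ N * ν Set.univ := by
  -- The centres are covered by N families of disjoint balls; neither doubling of μ nor
  -- measurability of S plays a role.
  obtain ⟨N, τ, hτ, hN⟩ :=
    HasBesicovitchCovering.no_satelliteConfig (α := EuclideanSpace ℝ (Fin n))
  refine ⟨N + 1, Nat.succ_pos N, fun μ ν S r R h => ?_⟩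
  let q : Besicovitch.BallPackage S (EuclideanSpace ℝ (Fin n)) :=
    { c := fun x => x
      r := fun x => r x
      rpos := fun x => (h x x.2).1
      r_bound := R
      r_le := fun x => (h x x.2).2.1 }
  obtain ⟨s, hdisj, hcov⟩ := Besicovitch.exist_disjoint_covering_families hτ hN q
  have hcount : ∀ i, (s i).Countable := fun i =>
    (hdisj i).countable_of_nonempty_interior fun x _ =>
      (nonempty_ball.2 (h x x.2).1).mono ball_subset_interior_closedBall
  have hone : ∀ i, μ (⋃ j ∈ s i, ball (q.c j) (q.r j)) ≤ ν Set.univ := by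
    intro i
    calc _ ≤ ∑' j : s i, μ (ball (q.c j) (q.r j)) := measure_biUnion_le _ (hcount i) _
      _ ≤ ∑' j : s i, ν (closedBall (q.c j) (q.r j)) :=
          ENNReal.tsum_le_tsum fun j => (measure_mono ball_subset_closedBall).trans (h _ j.1.2).2.2
      _ = ν (⋃ j ∈ s i, closedBall (q.c j) (q.r j)) :=
          (measure_biUnion (hcount i) (hdisj i) fun _ _ => measurableSet_closedBall).symm
      _ ≤ _ := measure_mono (Set.subset_univ _)
  have hS : S ⊆ ⋃ i, ⋃ j ∈ s i, ball (q.c j) (q.r j) := by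
    refine Set.Subset.trans ?_ hcov
    intro x hx
    exact ⟨⟨x, hx⟩, rfl⟩
  calc μ S ≤ ∑ i, μ (⋃ j ∈ s i, ball (q.c j) (q.r j)) :=
        (measure_mono hS).trans (measure_iUnion_fintype_le μ _)
    _ ≤ ∑ _i : Fin N, ν Set.univ := Finset.sum_le_sum fun i _ => hone i
    _ = N * ν Set.univ := by simp
    _ ≤ _ := by gcongr; simp

/-- The dyadic annulus of index `k` about `x`. -/
def annulus (x : EuclideanSpace ℝ (Fin n)) (R : ℝ) (k : ℕ) : Set (EuclideanSpace ℝ (Fin n)) :=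
  ball x (R / 2 ^ k) \ ball x (R / 2 ^ (k + 1))

theorem measurableSet_annulus (x : EuclideanSpace ℝ (Fin n)) (R : ℝ) (k : ℕ) :
    MeasurableSet (annulus x R k) := measurableSet_ball.diff measurableSet_ball

theorem div_two_pow_anti {R : ℝ} (hR : 0 < R) {j k : ℕ} (h : j ≤ k) : R / 2 ^ k ≤ R / 2 ^ j := by
  gcongr
  norm_num

theorem pairwise_disjoint_annulus (x : EuclideanSpace ℝ (Fin n)) {R : ℝ} (hR : 0 < R) :
    Pairwise (Function.onFun Disjoint (annulus x R)) := by
  have key : ∀ i j, i < j → Disjoint (annulus x R i) (annulus x R j) := fun i j hij =>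
    Set.disjoint_left.2 fun y hi hj =>
      hi.2 (ball_subset_ball (div_two_pow_anti hR (Nat.succ_le_of_lt hij)) hj.1)
  intro i j hij
  rcases lt_or_gt_of_ne hij with h | h
  · exact key i j h
  · exact (key j i h).symm

theorem iUnion_annulus (x : EuclideanSpace ℝ (Fin n)) {R : ℝ} (hR : 0 < R) :
    ⋃ k, annulus x R k = ball x R \ {x} := by
  ext y
  simp only [Set.mem_iUnion, annulus, Set.mem_sdiff, mem_ball, not_lt, Set.mem_singleton_iff]
  constructor
  · rintro ⟨k, h1, h2⟩
    refine ⟨h1.trans_le ?_, fun h => ?_⟩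
    · simpa using div_two_pow_anti hR (Nat.zero_le k)
    · rw [h, dist_self] at h2
      exact absurd h2 (by positivity : 0 < R / 2 ^ (k + 1)).not_ge
  · rintro ⟨h1, h2⟩
    have hd : 0 < dist y x := dist_pos.2 h2
    obtain ⟨k, hk1, hk2⟩ := exists_nat_pow_near (x := R / dist y x) (y := (2 : ℝ))
      ((one_le_div hd).2 h1.le) one_lt_two
    rw [le_div_iff₀ hd] at hk1
    rw [div_lt_iff₀ hd] at hk2
    have hex : ∃ k, R / 2 ^ (k + 1) ≤ dist y x :=
      ⟨k, by rw [div_le_iff₀ (by positivity)]; linarith⟩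
    classical
    refine ⟨Nat.find hex, ?_, Nat.find_spec hex⟩
    rcases Nat.eq_zero_or_pos (Nat.find hex) with h0 | h0
    · rw [h0]; simpa using h1
    · have := Nat.find_min hex (Nat.sub_lt h0 one_pos)
      rw [Nat.sub_add_cancel (show 1 ≤ Nat.find hex from h0)] at this
      exact not_le.1 this

/-- On the k-th annulus the kernel times the volume of the ball is at most of order R 2^(-k). The
annuli are kept inside the averages, because their disjointness is what later sums the p-th powers.
-/
theorem lintegral_rieszKernel_le_tsum {x₀ x : EuclideanSpace ℝ (Fin n)} {R : ℝ} (hn : 1 ≤ n)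
    (hx : x ∈ ball x₀ R) (g : EuclideanSpace ℝ (Fin n) → ℝ≥0∞) :
    ∫⁻ z in ball x₀ R, g z * ‖x - z‖ₑ ^ (1 - (n : ℝ)) ≤
      ENNReal.ofReal (2 ^ n * R) * volume (ball (0 : EuclideanSpace ℝ (Fin n)) 1) *
        ∑' k : ℕ, ENNReal.ofReal (1 / 2 ^ k) * ⨍⁻ z in ball x (2 * R / 2 ^ k),
          (annulus x (2 * R) k).indicator ((ball x₀ R).indicator g) z ∂volume := by
  have hfin : Nonempty (Fin n) := ⟨⟨0, hn⟩⟩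
  have hR : 0 < R := dist_nonneg.trans_lt hx
  set γ := (ball x₀ R).indicator g with hγ
  have hsub : ball x₀ R ⊆ ball x (2 * R) := ball_subset_ball' (by
    rw [mem_ball'] at hx; linarith)
  have h1 : ∫⁻ z in ball x₀ R, g z * ‖x - z‖ₑ ^ (1 - (n : ℝ)) ≤
      ∫⁻ z in ⋃ k, annulus x (2 * R) k, γ z * ‖x - z‖ₑ ^ (1 - (n : ℝ)) := by
    rw [iUnion_annulus x (by positivity)]
    have hae : (ball x (2 * R) \ {x} : Set (EuclideanSpace ℝ (Fin n))) =ᵐ[volume]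
        ball x (2 * R) := sdiff_null_ae_eq_self (by simp)
    rw [setLIntegral_congr hae]
    calc _ = ∫⁻ z in ball x₀ R, γ z * ‖x - z‖ₑ ^ (1 - (n : ℝ)) :=
          setLIntegral_congr_fun measurableSet_ball fun z hz => by
            simp only [hγ, Set.indicator_of_mem hz]
      _ ≤ _ := lintegral_mono_set hsub
  refine h1.trans ?_
  rw [lintegral_iUnion (measurableSet_annulus x _) (pairwise_disjoint_annulus x (by positivity)),
    ← ENNReal.tsum_mul_left]
  refine ENNReal.tsum_le_tsum fun k => ?_
  have hρ : (0 : ℝ) < 2 * R / 2 ^ k := by positivity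
  have hρ1 : (0 : ℝ) < 2 * R / 2 ^ (k + 1) := by positivity
  have hA : annulus x (2 * R) k ⊆ ball x (2 * R / 2 ^ k) := fun z hz => hz.1
  have hn0 : 1 - (n : ℝ) ≤ 0 := by
    have : (1 : ℝ) ≤ n := by exact_mod_cast hn
    linarith
  have hexp : ENNReal.ofReal ((2 * R / 2 ^ (k + 1)) ^ (1 - (n : ℝ))) *
      volume (ball x (2 * R / 2 ^ k)) = ENNReal.ofReal (2 ^ n * R) *
        volume (ball (0 : EuclideanSpace ℝ (Fin n)) 1) * ENNReal.ofReal (1 / 2 ^ k) := by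
    rw [Measure.addHaar_ball_of_pos _ _ hρ, ← mul_assoc, ← ENNReal.ofReal_mul (by positivity),
      mul_right_comm, ← ENNReal.ofReal_mul (by positivity), finrank_euclideanSpace_fin]
    congr 2
    rw [Real.rpow_sub hρ1, Real.rpow_one, Real.rpow_natCast, pow_succ, div_mul_eq_mul_div,
      ← mul_div, ← div_pow, show 2 * R / 2 ^ k / (2 * R / (2 ^ k * 2)) = 2 by field_simp]
    field_simp
  calc ∫⁻ z in annulus x (2 * R) k, γ z * ‖x - z‖ₑ ^ (1 - (n : ℝ))
      ≤ ∫⁻ z in annulus x (2 * R) k,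
          ENNReal.ofReal ((2 * R / 2 ^ (k + 1)) ^ (1 - (n : ℝ))) * γ z := by
        refine setLIntegral_mono' (measurableSet_annulus x _ k) fun z hz => ?_
        rw [mul_comm]
        gcongr
        have hd : 2 * R / 2 ^ (k + 1) ≤ dist z x := not_lt.1 hz.2
        have hd0 : 0 < dist z x := hρ1.trans_le hd
        rw [← edist_eq_enorm_sub, edist_comm, edist_dist, ENNReal.ofReal_rpow_of_pos hd0]
        exact ENNReal.ofReal_le_ofReal (Real.rpow_le_rpow_of_nonpos hρ1 hd hn0)
    _ = ENNReal.ofReal ((2 * R / 2 ^ (k + 1)) ^ (1 - (n : ℝ))) *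
          ∫⁻ z in annulus x (2 * R) k, γ z := lintegral_const_mul' _ _ ENNReal.ofReal_ne_top
    _ = ENNReal.ofReal ((2 * R / 2 ^ (k + 1)) ^ (1 - (n : ℝ))) *
          ((⨍⁻ z in ball x (2 * R / 2 ^ k), (annulus x (2 * R) k).indicator γ z ∂volume) *
            volume (ball x (2 * R / 2 ^ k))) := by
        rw [setLAverage_eq, ENNReal.div_mul_cancel (volume_ball_ne_zero x hρ)
          (volume_ball_ne_top _ _), lintegral_indicator (measurableSet_annulus x _ k),
          Measure.restrict_restrict (measurableSet_annulus x _ k), Set.inter_eq_left.2 hA]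
    _ = _ := by
        rw [mul_comm (⨍⁻ z in ball x (2 * R / 2 ^ k), _ ∂volume), ← mul_assoc, hexp, mul_assoc]

/-- Geometric sum with 2^α − 1 ≥ α/2, which holds since log 2 > 1/2. The constant is linear in q,
however small α is. -/
theorem sum_two_rpow_le {α q : ℝ} (hα : 0 < α) (hq : 2 / α ≤ q) (κ : ℕ) :
    ∑ k ∈ Finset.range κ, (2 : ℝ) ^ (k * α) ≤ q * 2 ^ (κ * α) := by
  have hx : (2 : ℝ) ^ α ≥ 1 + α / 2 := by
    have h1 : (2 : ℝ) ^ α = Real.exp (Real.log 2 * α) := by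
      rw [Real.rpow_def_of_pos two_pos]
    have h2 := Real.add_one_le_exp (Real.log 2 * α)
    have h3 := Real.log_two_gt_d9
    rw [h1]; nlinarith
  have hpow : ∀ k : ℕ, (2 : ℝ) ^ (k * α) = ((2 : ℝ) ^ α) ^ k := fun k => by
    rw [mul_comm, Real.rpow_mul two_pos.le, Real.rpow_natCast]
  simp_rw [hpow]
  have hne : (2 : ℝ) ^ α ≠ 1 := by linarith
  rw [geom_sum_eq hne, div_le_iff₀ (by linarith)]
  have hP : 0 < ((2 : ℝ) ^ α) ^ κ := by positivity
  have h1 : 1 ≤ q * (2 ^ α - 1) := by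
    rw [div_le_iff₀ hα] at hq
    have : 0 < q := by nlinarith
    nlinarith
  nlinarith

/-- Hedberg's splitting of a dyadic sum. -/
theorem tsum_le_hedberg {b g : ℕ → ℝ≥0∞} {K L Y : ℝ≥0∞} {p α q : ℝ} (hp : 1 ≤ p) (hα : 0 < α)
    (hq : 2 / α ≤ q) (h1 : ∀ k, b k ≤ K * L)
    (h2 : ∀ k : ℕ, b k ≤ K * ENNReal.ofReal (2 ^ (k * (α + 1))) * g k) (h3 : ∑' k, g k ^ p ≤ Y ^ p)
    (κ : ℕ) :
    ∑' k : ℕ, ENNReal.ofReal (1 / 2 ^ k) * b k ≤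
      K * (ENNReal.ofReal (2 / 2 ^ κ) * L +
        ENNReal.ofReal (q ^ (1 - 1 / p) * 2 ^ (κ * α)) * Y) := by
  have hp0 : 0 < p := by linarith
  have hq0 : 0 < q := lt_of_lt_of_le (by positivity) hq
  have hpinv : 0 ≤ 1 - p⁻¹ := by
    have := inv_le_one_of_one_le₀ hp
    linarith
  rw [← ENNReal.summable.sum_add_tsum_nat_add' (k := κ), add_comm, mul_add]
  refine add_le_add ?_ ?_
  -- Fine scales k ≥ κ: the uniform bound by L and a geometric series.
  · have hgeo : ∑' k : ℕ, ENNReal.ofReal (1 / 2 ^ (k + κ)) = ENNReal.ofReal (2 / 2 ^ κ) := by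
      have h4 : ∀ k : ℕ, (1 : ℝ) / 2 ^ (k + κ) = 1 / 2 ^ κ * (1 / 2) ^ k := fun k => by
        rw [pow_add, one_div_pow]; field_simp
      simp_rw [h4]
      rw [← ENNReal.ofReal_tsum_of_nonneg (fun k => by positivity)
        (summable_geometric_two.mul_left _), tsum_mul_left, tsum_geometric_two]
      congr 1; ring
    calc _ ≤ ∑' k : ℕ, ENNReal.ofReal (1 / 2 ^ (k + κ)) * (K * L) :=
          ENNReal.tsum_le_tsum fun k => by gcongr; exact h1 _
      _ = _ := by rw [ENNReal.tsum_mul_right, hgeo]; ring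
  -- Coarse scales k < κ: Hölder with weights 2^(kα), then the geometric sum bound. This yields
  -- q^(1-1/p) rather than q.
  · set c : ℕ → ℝ≥0∞ := fun k => ENNReal.ofReal (2 ^ (k * α)) with hc
    have hcsum : ∑ k ∈ Finset.range κ, c k ≤ ENNReal.ofReal q * c κ := by
      rw [hc, ← ENNReal.ofReal_sum_of_nonneg (fun k _ => by positivity),
        ← ENNReal.ofReal_mul hq0.le]
      exact ENNReal.ofReal_le_ofReal (sum_two_rpow_le hα hq κ)
    have hc0 : c κ ≠ 0 := by rw [hc]; positivity
    have hct : c κ ≠ ⊤ := ENNReal.ofReal_ne_top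
    have hcmono : ∀ k ∈ Finset.range κ, c k ≤ c κ := fun k hk => by
      refine ENNReal.ofReal_le_ofReal (Real.rpow_le_rpow_of_exponent_le one_le_two ?_)
      have : (k : ℝ) ≤ κ := by exact_mod_cast (Finset.mem_range.1 hk).le
      gcongr
    have hterm : ∀ k : ℕ, ENNReal.ofReal (1 / 2 ^ k) * b k ≤ K * (c k * g k) := fun k => by
      have : ENNReal.ofReal (1 / 2 ^ k) * ENNReal.ofReal (2 ^ (k * (α + 1))) = c k := by
        rw [hc, ← ENNReal.ofReal_mul (by positivity)]
        congr 1
        rw [mul_add, mul_one, Real.rpow_add two_pos, Real.rpow_natCast]; field_simp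
      calc _ ≤ ENNReal.ofReal (1 / 2 ^ k) * (K * ENNReal.ofReal (2 ^ (k * (α + 1))) * g k) := by
            gcongr; exact h2 k
        _ = K * ((ENNReal.ofReal (1 / 2 ^ k) * ENNReal.ofReal (2 ^ (k * (α + 1)))) * g k) := by ring
        _ = _ := by rw [this]
    calc ∑ k ∈ Finset.range κ, ENNReal.ofReal (1 / 2 ^ k) * b k
        ≤ ∑ k ∈ Finset.range κ, K * (c k * g k) := Finset.sum_le_sum fun k _ => hterm k
      _ = K * ∑ k ∈ Finset.range κ, c k * g k := by rw [Finset.mul_sum]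
      _ ≤ K * ((∑ k ∈ Finset.range κ, c k) ^ (1 - p⁻¹) *
            (∑ k ∈ Finset.range κ, c k * g k ^ p) ^ p⁻¹) := by
          gcongr
          exact ENNReal.inner_le_weight_mul_Lp_of_nonneg _ hp _ _
      _ ≤ K * ((ENNReal.ofReal q * c κ) ^ (1 - p⁻¹) * (c κ * Y ^ p) ^ p⁻¹) := by
          gcongr
          calc _ ≤ ∑ k ∈ Finset.range κ, c κ * g k ^ p :=
                Finset.sum_le_sum fun k hk => by gcongr; exact hcmono k hk
            _ = c κ * ∑ k ∈ Finset.range κ, g k ^ p := by rw [Finset.mul_sum]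
            _ ≤ c κ * Y ^ p := by gcongr; exact (ENNReal.sum_le_tsum _).trans h3
      _ = K * (ENNReal.ofReal q ^ (1 - p⁻¹) * (c κ ^ (1 - p⁻¹) * c κ ^ p⁻¹) * Y) := by
          rw [ENNReal.mul_rpow_of_nonneg _ _ hpinv,
            ENNReal.mul_rpow_of_nonneg _ _ (inv_nonneg.2 hp0.le), ENNReal.rpow_rpow_inv hp0.ne']
          ring
      _ = _ := by
          rw [← ENNReal.rpow_add _ _ hc0 hct, sub_add_cancel, ENNReal.rpow_one, one_div,
            ENNReal.ofReal_mul (by positivity), ENNReal.ofReal_rpow_of_nonneg hq0.le hpinv]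

/-- Optimisation of the splitting parameter in Hedberg's inequality. -/
theorem hedberg_optimize {l D Q Y p α : ℝ} (hp : 0 < p) (hα : 0 < α) (hD : 0 < D) (hQ : 0 < Q)
    (hY : 0 < Y) {X L : ℝ≥0∞} (hX : ENNReal.ofReal l < X) (hl : 2 * D * Q * Y ≤ l)
    (h : ∀ κ : ℕ, X ≤ ENNReal.ofReal D * (ENNReal.ofReal (2 / 2 ^ κ) * L +
      ENNReal.ofReal (Q * 2 ^ (κ * α)) * ENNReal.ofReal Y)) :
    ENNReal.ofReal ((l / (8 * D)) ^ p * (l / (2 * D * Q * Y)) ^ (p / α)) < L ^ p := by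
  have hm : 0 < 2 * D * Q * Y := by positivity
  have hl0 : 0 < l := hm.trans_le hl
  rcases eq_or_ne L ⊤ with rfl | hL
  · rw [ENNReal.top_rpow_of_pos hp]; exact ENNReal.ofReal_lt_top
  have hy1 : 1 < (2 : ℝ) ^ α := Real.one_lt_rpow one_lt_two hα
  -- The largest κ for which the coarse term is still at most l/2; the fine term must then exceed
  -- l/2, which bounds L from below.
  obtain ⟨κ, hκ1, hκ2⟩ := exists_nat_pow_near ((one_le_div hm).2 hl) hy1
  have hpow : (2 : ℝ) ^ (κ * α) = ((2 : ℝ) ^ α) ^ κ := by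
    rw [mul_comm, Real.rpow_mul two_pos.le, Real.rpow_natCast]
  have h1 := hX.trans_le (h κ)
  set ℓ := L.toReal with hℓ
  have hLℓ : L = ENNReal.ofReal ℓ := (ENNReal.ofReal_toReal hL).symm
  have hℓ0 : 0 ≤ ℓ := ENNReal.toReal_nonneg
  rw [hLℓ, ← ENNReal.ofReal_mul (by positivity), ← ENNReal.ofReal_mul (by positivity),
    ← ENNReal.ofReal_add (by positivity) (by positivity), ← ENNReal.ofReal_mul hD.le,
    ENNReal.ofReal_lt_ofReal_iff_of_nonneg hl0.le, hpow] at h1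
  rw [le_div_iff₀ hm] at hκ1
  have h2 : l / 2 < D * (2 / 2 ^ κ * ℓ) := by nlinarith
  have h3 : l * 2 ^ κ / (4 * D) < ℓ := by
    rw [div_lt_iff₀ (by positivity)]
    have : D * (2 / 2 ^ κ * ℓ) * 2 ^ κ = 2 * D * ℓ := by field_simp
    have h4 : l / 2 * 2 ^ κ < D * (2 / 2 ^ κ * ℓ) * 2 ^ κ := by gcongr
    linarith
  have h5 : (l / (2 * D * Q * Y)) ^ (1 / α) ≤ 2 ^ κ * 2 := by
    have h6 : ((2 : ℝ) ^ α) ^ (κ + 1) = ((2 : ℝ) ^ (κ + 1)) ^ α := by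
      rw [← Real.rpow_natCast, ← Real.rpow_natCast, ← Real.rpow_mul two_pos.le,
        ← Real.rpow_mul two_pos.le, mul_comm]
    rw [h6] at hκ2
    calc _ ≤ (((2 : ℝ) ^ (κ + 1)) ^ α) ^ (1 / α) := by gcongr
      _ = _ := by
        rw [← Real.rpow_mul (by positivity), mul_one_div_cancel hα.ne', Real.rpow_one, pow_succ]
  have h7 : l / (8 * D) * (l / (2 * D * Q * Y)) ^ (1 / α) < ℓ := by
    refine lt_of_le_of_lt ?_ h3
    calc _ ≤ l / (8 * D) * (2 ^ κ * 2) := by gcongr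
      _ = _ := by field_simp; ring
  have h8 : (l / (8 * D)) ^ p * (l / (2 * D * Q * Y)) ^ (p / α) =
      (l / (8 * D) * (l / (2 * D * Q * Y)) ^ (1 / α)) ^ p := by
    rw [Real.mul_rpow (by positivity) (by positivity), ← Real.rpow_mul (by positivity)]
    congr 2; ring
  rw [h8, hLℓ, ENNReal.ofReal_rpow_of_nonneg hℓ0 hp.le, ENNReal.ofReal_lt_ofReal_iff_of_nonneg
    (by positivity)]
  exact Real.rpow_lt_rpow (by positivity) h7 hp

end WeakType

/-! ### Weak type estimate for Riesz potentials -/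

section WeakTypeRiesz

open Filter Topology

/-- The denominator is the threshold from Hedberg's optimisation with p/α = q − p. After the power
p/q all powers of l cancel, and q survives with exponent (p − 1)(q − p)/q ≤ p − 1, which is what
makes the final constant linear in q. -/
theorem hedberg_level_le {l D y p q N : ℝ} (hl : 0 < l) (hD : 0 < D) (hy : 0 < y) (hp : 1 ≤ p)
    (hpq : p ≤ q) (hN : 1 ≤ N) :
    l ^ p * (N * y ^ p / ((l / (8 * D)) ^ p *
      (l / (2 * D * q ^ (1 - 1 / p) * y)) ^ (q - p))) ^ (p / q) ≤
      (8 * N * D) ^ p * q ^ (p - 1) * y ^ p := by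
  have hp0 : 0 < p := by linarith
  have hq0 : 0 < q := by linarith
  have hq1 : 1 ≤ q := by linarith
  set Q := q ^ (1 - 1 / p) with hQ
  have hQ0 : 0 < Q := by positivity
  have hqp : 0 ≤ q - p := by linarith
  have h1 : (l / (8 * D)) ^ q / (Q * y) ^ (q - p) ≤
      (l / (8 * D)) ^ p * (l / (2 * D * Q * y)) ^ (q - p) := by
    have h2 : (l / (8 * D)) ^ q = (l / (8 * D)) ^ p * (l / (8 * D)) ^ (q - p) := by
      rw [← Real.rpow_add (by positivity)]; congr 1; ring
    rw [h2, mul_div_assoc, ← Real.div_rpow (by positivity) (by positivity)]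
    gcongr (l / (8 * D)) ^ p * ?_ ^ (q - p)
    rw [div_div]
    refine div_le_div_of_nonneg_left hl.le (by positivity) ?_
    have : 0 < D * Q * y := by positivity
    nlinarith
  have h3 : N * y ^ p / ((l / (8 * D)) ^ p * (l / (2 * D * Q * y)) ^ (q - p)) ≤
      N * (y ^ p * (Q * y) ^ (q - p)) / (l / (8 * D)) ^ q := by
    calc _ ≤ N * y ^ p / ((l / (8 * D)) ^ q / (Q * y) ^ (q - p)) := by gcongr
      _ = _ := by field_simp
  have h4 : y ^ p * (Q * y) ^ (q - p) = y ^ q * Q ^ (q - p) := by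
    rw [Real.mul_rpow hQ0.le hy.le, mul_left_comm, ← Real.rpow_add hy, add_sub_cancel, mul_comm]
  have h5 : Q ^ ((q - p) * (p / q)) ≤ q ^ (p - 1) := by
    rw [hQ, ← Real.rpow_mul hq0.le]
    refine Real.rpow_le_rpow_of_exponent_le hq1 ?_
    have e : (1 - 1 / p) * ((q - p) * (p / q)) = (p - 1) * ((q - p) / q) := by field_simp
    rw [e]
    refine mul_le_of_le_one_right (by linarith) ?_
    rw [div_le_one hq0]; linarith
  have h6 : N ^ (p / q) ≤ N ^ p :=
    Real.rpow_le_rpow_of_exponent_le hN (by rw [div_le_iff₀ hq0]; nlinarith)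
  calc _ ≤ l ^ p * (N * (y ^ q * Q ^ (q - p)) / (l / (8 * D)) ^ q) ^ (p / q) := by
        rw [← h4]; gcongr
    _ = l ^ p * (N ^ (p / q) * (y ^ p * Q ^ ((q - p) * (p / q))) / (l / (8 * D)) ^ p) := by
        rw [Real.div_rpow (by positivity) (by positivity), Real.mul_rpow (by positivity)
          (by positivity), Real.mul_rpow (by positivity) (by positivity), ← Real.rpow_mul hy.le,
          ← Real.rpow_mul hQ0.le, ← Real.rpow_mul (by positivity : 0 ≤ l / (8 * D)),
          mul_div_cancel₀ _ hq0.ne']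
    _ = (8 * D) ^ p * N ^ (p / q) * Q ^ ((q - p) * (p / q)) * y ^ p := by
        rw [Real.div_rpow hl.le (by positivity)]; field_simp
    _ ≤ (8 * D) ^ p * N ^ p * q ^ (p - 1) * y ^ p := by gcongr
    _ = _ := by
        rw [← Real.mul_rpow (by positivity) (by positivity)]; congr 3; ring

variable {n : ℕ}

/-- Weak type bound, up to an additional parameter `y`, for functions dominated by a Riesz
potential. -/
theorem exists_weak_type_of_le (hn : 2 ≤ n) :
    ∃ C : ℝ, 1 ≤ C ∧ ∀ {s p : ℝ} {K : ℝ≥0∞} {w : EuclideanSpace ℝ (Fin n) → ℝ≥0∞}, 1 ≤ s → s ≤ p →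
      p < n → K ≠ ⊤ → HasPairBound s K w → AEMeasurable w →
      (∀ (c : EuclideanSpace ℝ (Fin n)) (R : ℝ), 0 < R → ∫⁻ x in ball c R, w x ≠ 0) →
      (∀ (c : EuclideanSpace ℝ (Fin n)) (R : ℝ), ∫⁻ x in ball c R, w x ≠ ⊤) →
      ∀ (x₀ : EuclideanSpace ℝ (Fin n)) (R : ℝ), 0 < R →
      ∀ g : EuclideanSpace ℝ (Fin n) → ℝ≥0∞, AEMeasurable g (volume.restrict (ball x₀ R)) →
      ∀ (h : EuclideanSpace ℝ (Fin n) → ℝ≥0∞) (c₁ : ℝ), 0 < c₁ →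
      (∀ᵐ x ∂(volume.restrict (ball x₀ R)), h x ≤ ENNReal.ofReal c₁ *
        ∫⁻ z in ball x₀ R, g z * ‖x - z‖ₑ ^ (1 - (n : ℝ))) →
      ∀ l : ℝ, 0 < l → ∀ y : ℝ, 0 < y →
      (∫⁻ x in ball x₀ R, g x ^ p * w x) / ∫⁻ x in ball x₀ R, w x ≤ ENNReal.ofReal (y ^ p) →
      ENNReal.ofReal (l ^ p) * ((∫⁻ x in {x ∈ ball x₀ R | ENNReal.ofReal l < h x}, w x) /
        ∫⁻ x in ball x₀ R, w x) ^ (p / (1 / p - 1 / (n * s))⁻¹) ≤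
      ENNReal.ofReal ((C * c₁ * R) ^ p * (1 / p - 1 / (n * s))⁻¹ ^ (p - 1) * K.toReal * y ^ p) := by
  obtain ⟨N, hN0, hN⟩ := exists_measure_le_of_forall_closedBall n
  set vb := volume (ball (0 : EuclideanSpace ℝ (Fin n)) 1) with hvb
  have hvbt : vb ≠ ⊤ := volume_ball_ne_top _ _
  set v := vb.toReal with hv
  have hv0 : 0 < v := ENNReal.toReal_pos (volume_ball_ne_zero _ one_pos) hvbt
  have hN1 : (1 : ℝ) ≤ N := by exact_mod_cast hN0
  refine ⟨max 1 (8 * N * 2 ^ n * v), le_max_left _ _, ?_⟩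
  intro s p K w hs hsp hpn hK hpair hwm hw0 hwt x₀ R hR g hg h c₁ hc₁ hh l hl y hy hY
  have hn2 : (2 : ℝ) ≤ n := by exact_mod_cast hn
  have : Nonempty (Fin n) := ⟨⟨0, by omega⟩⟩
  have hp : 1 ≤ p := hs.trans hsp
  have hp0 : 0 < p := by linarith
  have hs0 : 0 < s := by linarith
  have hns : p < n * s := by nlinarith
  set q := (1 / p - 1 / (n * s))⁻¹ with hq
  -- With this α one has q = ns/α and p/α = q − p.
  set α := n * s / p - 1 with hαd
  have hα : 0 < α := by
    rw [hαd, sub_pos, one_lt_div hp0]; exact hns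
  have hqα : q = n * s / α := by
    rw [hq, hαd]
    have : n * s - p ≠ 0 := by linarith
    have : n * s / p - 1 ≠ 0 := hα.ne'
    field_simp
  have hq2 : 2 / α ≤ q := by rw [hqα]; gcongr; nlinarith
  have hpα : p / α = q - p := by
    rw [hqα, hαd]
    have : n * s - p ≠ 0 := by linarith
    field_simp
    ring
  have hpq : p ≤ q := by
    have : 0 < p / α := by positivity
    linarith
  have hq0 : 0 < q := by linarith
  have hK1 : 1 ≤ K := hpair.one_le (hw0 _ _ one_pos) (hwt _ _)
  have hKr1 : 1 ≤ K.toReal := by rw [← ENNReal.toReal_one]; exact ENNReal.toReal_mono hK hK1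
  set k₁ := K.toReal ^ (1 / p) with hk₁
  have hk₁0 : 0 < k₁ := by positivity
  have hKk : K ^ (1 / p) = ENNReal.ofReal k₁ := by
    rw [hk₁, ← ENNReal.ofReal_rpow_of_nonneg (by positivity) (by positivity),
      ENNReal.ofReal_toReal hK]
  set D := c₁ * (2 ^ n * R) * v * k₁ with hD
  have hD0 : 0 < D := by positivity
  set Q := q ^ (1 - 1 / p) with hQ
  have hQ0 : 0 < Q := by positivity
  set W := ∫⁻ x in ball x₀ R, w x with hW
  have hW0 : W ≠ 0 := hw0 _ _ hR
  have hWt : W ≠ ⊤ := hwt _ _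
  have hfinal : (8 * N * D) ^ p * q ^ (p - 1) * y ^ p ≤
      (max 1 (8 * N * 2 ^ n * v) * c₁ * R) ^ p * q ^ (p - 1) * K.toReal * y ^ p := by
    have e1 : 8 * N * D = (8 * N * 2 ^ n * v) * c₁ * R * k₁ := by rw [hD]; ring
    have e2 : k₁ ^ p = K.toReal := by
      rw [hk₁, ← Real.rpow_mul (by positivity), one_div_mul_cancel hp0.ne', Real.rpow_one]
    rw [e1, Real.mul_rpow (by positivity) hk₁0.le, e2]
    calc _ = (8 * N * 2 ^ n * v * c₁ * R) ^ p * q ^ (p - 1) * K.toReal * y ^ p := by ring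
      _ ≤ _ := by gcongr; exact le_max_right _ _
  set S := {x ∈ ball x₀ R | ENNReal.ofReal l < h x} with hS
  have hSsub : S ⊆ ball x₀ R := fun x hx => hx.1
  have hratio : (∫⁻ x in S, w x) / W ≤ 1 := by
    rw [ENNReal.div_le_iff hW0 hWt, one_mul]
    exact lintegral_mono_set hSsub
  have hpq0 : 0 ≤ p / q := by positivity
  -- Small levels are trivial: the mass ratio is at most one and l^p is already below the right
  -- side.
  rcases lt_or_ge l (2 * D * Q * y) with hlt | hge
  · calc _ ≤ ENNReal.ofReal (l ^ p) * 1 := by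
          gcongr
          exact ENNReal.rpow_le_one hratio hpq0
      _ ≤ _ := by
          rw [mul_one]
          refine ENNReal.ofReal_le_ofReal (le_trans ?_ hfinal)
          have e3 : Q ^ p = q ^ (p - 1) := by
            rw [hQ, ← Real.rpow_mul hq0.le]; congr 1; field_simp
          calc l ^ p ≤ (2 * D * Q * y) ^ p := by gcongr
            _ = (2 * D) ^ p * q ^ (p - 1) * y ^ p := by
                rw [Real.mul_rpow (by positivity) hy.le, Real.mul_rpow (by positivity) hQ0.le, e3]
            _ ≤ _ := by gcongr; nlinarith
  set γ := (ball x₀ R).indicator g with hγ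
  have hγm : AEMeasurable γ := (aemeasurable_indicator_iff measurableSet_ball).2 hg
  have hγint : ∫⁻ z, γ z ^ p * w z = ∫⁻ x in ball x₀ R, g x ^ p * w x := by
    rw [← lintegral_indicator measurableSet_ball]
    refine lintegral_congr fun z => ?_
    by_cases hz : z ∈ ball x₀ R
    · simp only [hγ, Set.indicator_of_mem hz]
    · simp only [hγ, Set.indicator_of_notMem hz]
      rw [ENNReal.zero_rpow_of_pos hp0, zero_mul]
  have hYint : ∫⁻ x in ball x₀ R, g x ^ p * w x ≤ ENNReal.ofReal (y ^ p) * W :=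
    (ENNReal.div_le_iff hW0 hWt).1 hY
  have hR2 : 0 < 2 * R := by positivity
  have hρ : ∀ k : ℕ, 0 < 2 * R / 2 ^ k := fun k => by positivity
  set I := fun (x : EuclideanSpace ℝ (Fin n)) (k : ℕ) => ∫⁻ z in ball x (2 * R / 2 ^ k), γ z ^ p * w z
  set Wk := fun (x : EuclideanSpace ℝ (Fin n)) (k : ℕ) => ∫⁻ z in ball x (2 * R / 2 ^ k), w z
  -- The p-th root of the centred dyadic maximal function of γ^p with respect to the measure w.
  set L := fun x => (⨆ k, I x k / Wk x k) ^ (1 / p) with hL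
  have hLp : ∀ x, L x ^ p = ⨆ k, I x k / Wk x k := fun x => by
    rw [hL, ← ENNReal.rpow_mul, one_div_mul_cancel hp0.ne', ENNReal.rpow_one]
  set A := (l / (8 * D)) ^ p * (l / (2 * D * Q * y)) ^ (p / α) with hA
  have hA0 : 0 < A := by positivity
  -- the pointwise bound
  have hpoint : ∀ x ∈ ball x₀ R, h x ≤ ENNReal.ofReal c₁ *
      ∫⁻ z in ball x₀ R, g z * ‖x - z‖ₑ ^ (1 - (n : ℝ)) → ENNReal.ofReal l < h x →
      ENNReal.ofReal A < L x ^ p := by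
    intro x hx hhx hlx
    set b : ℕ → ℝ≥0∞ := fun k => ⨍⁻ z in ball x (2 * R / 2 ^ k),
      (annulus x (2 * R) k).indicator γ z ∂volume with hb
    set J : ℕ → ℝ≥0∞ := fun k => ∫⁻ z in annulus x (2 * R) k, γ z ^ p * w z with hJ
    have hAm := measurableSet_annulus x (2 * R)
    have hAsub : ∀ k, annulus x (2 * R) k ⊆ ball x (2 * R / 2 ^ k) := fun k z hz => hz.1
    have hindm : ∀ k, AEMeasurable ((annulus x (2 * R) k).indicator γ)
        (volume.restrict (ball x (2 * R / 2 ^ k))) := fun k => (hγm.indicator (hAm k)).restrict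
    have hindJ : ∀ k, ∫⁻ z in ball x (2 * R / 2 ^ k),
        (annulus x (2 * R) k).indicator γ z ^ p * w z = J k := by
      intro k
      have : ∀ z, (annulus x (2 * R) k).indicator γ z ^ p * w z =
          (annulus x (2 * R) k).indicator (fun z => γ z ^ p * w z) z := fun z => by
        by_cases hz : z ∈ annulus x (2 * R) k
        · simp only [Set.indicator_of_mem hz]
        · simp only [Set.indicator_of_notMem hz]
          rw [ENNReal.zero_rpow_of_pos hp0, zero_mul]
      simp_rw [this]
      rw [lintegral_indicator (hAm k), Measure.restrict_restrict (hAm k),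
        Set.inter_eq_left.2 (hAsub k)]
    -- Pair bound with equal radii.
    have hb1 : ∀ k, b k ≤ ENNReal.ofReal k₁ * L x := by
      intro k
      have h1 := hpair.mono_exponent hs0 hsp (hρ k) le_rfl (hindm k)
      rw [hindJ, div_self (hρ k).ne', Real.one_rpow, ENNReal.ofReal_one, mul_one] at h1
      have hWk0 : Wk x k ≠ 0 := hw0 _ _ (hρ k)
      have hWkt : Wk x k ≠ ⊤ := hwt _ _
      have h2 : b k ^ p ≤ K * L x ^ p := by
        rw [hLp]
        calc b k ^ p ≤ K * J k / Wk x k :=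
              (ENNReal.le_div_iff_mul_le (Or.inl hWk0) (Or.inl hWkt)).2 h1
          _ ≤ K * I x k / Wk x k := by gcongr; exact lintegral_mono_set (hAsub k)
          _ ≤ _ := by
              rw [mul_div_assoc]; gcongr; exact le_iSup (fun k => I x k / Wk x k) k
      rw [← hKk]
      calc b k = (b k ^ p) ^ (1 / p) := by
            rw [← ENNReal.rpow_mul, mul_one_div_cancel hp0.ne', ENNReal.rpow_one]
        _ ≤ (K * L x ^ p) ^ (1 / p) := by gcongr
        _ = _ := by
            rw [ENNReal.mul_rpow_of_nonneg _ _ (by positivity), ← ENNReal.rpow_mul,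
              mul_one_div_cancel hp0.ne', ENNReal.rpow_one]
    have hsubx : ball x₀ R ⊆ ball x (2 * R) := ball_subset_ball' (by
      rw [mem_ball'] at hx; linarith)
    -- Pair bound with radii 2R/2^k and 2R: the ratio contributes 2^(kns/p) = 2^(k(α+1)), and the
    -- larger ball contains B.
    have hb2 : ∀ k : ℕ, b k ≤ ENNReal.ofReal k₁ * ENNReal.ofReal (2 ^ (k * (α + 1))) *
        (J k / W) ^ (1 / p) := by
      intro k
      have h1 := hpair.mono_exponent hs0 hsp (hρ k)
        (div_le_self hR2.le (one_le_pow₀ one_le_two)) (hindm k)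
      rw [hindJ, div_div_cancel₀ hR2.ne'] at h1
      have h2 : b k ^ p ≤ K * ENNReal.ofReal ((2 ^ k) ^ (n * s)) * (J k / W) := by
        rw [← mul_div_assoc, ENNReal.le_div_iff_mul_le (Or.inl hW0) (Or.inl hWt)]
        refine le_trans ?_ h1
        gcongr
        exact lintegral_mono_set hsubx
      have e : ENNReal.ofReal ((2 ^ k : ℝ) ^ (n * s)) ^ (1 / p) =
          ENNReal.ofReal (2 ^ (k * (α + 1))) := by
        rw [ENNReal.ofReal_rpow_of_nonneg (by positivity) (by positivity), ← Real.rpow_mul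
          (by positivity), ← Real.rpow_natCast, ← Real.rpow_mul two_pos.le]
        congr 2; rw [hαd]; field_simp; ring
      rw [← hKk, ← e]
      calc b k = (b k ^ p) ^ (1 / p) := by
            rw [← ENNReal.rpow_mul, mul_one_div_cancel hp0.ne', ENNReal.rpow_one]
        _ ≤ (K * ENNReal.ofReal ((2 ^ k) ^ (n * s)) * (J k / W)) ^ (1 / p) := by gcongr
        _ = _ := by
            rw [ENNReal.mul_rpow_of_nonneg _ _ (by positivity),
              ENNReal.mul_rpow_of_nonneg _ _ (by positivity)]
    -- Disjointness of the annuli: the p-th powers add up to at most the average of g^p w over B.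
    have hb3 : ∑' k, ((J k / W) ^ (1 / p)) ^ p ≤ ENNReal.ofReal y ^ p := by
      have : ∀ k, ((J k / W) ^ (1 / p)) ^ p = J k * W⁻¹ := fun k => by
        rw [← ENNReal.rpow_mul, one_div_mul_cancel hp0.ne', ENNReal.rpow_one, div_eq_mul_inv]
      simp_rw [this]
      rw [ENNReal.tsum_mul_right, ← div_eq_mul_inv, ENNReal.div_le_iff hW0 hWt,
        ENNReal.ofReal_rpow_of_pos hy, hJ,
        ← lintegral_iUnion hAm (pairwise_disjoint_annulus x hR2)]
      refine le_trans ?_ hYint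
      rw [← hγint]
      exact setLIntegral_le_lintegral _ _
    rw [hA]
    refine hedberg_optimize hp0 hα hD0 hQ0 hy hlx hge fun κ => ?_
    refine hhx.trans ?_
    have h1 := lintegral_rieszKernel_le_tsum (by linarith) hx g
    have h2 := tsum_le_hedberg hp hα hq2 hb1 hb2 hb3 κ
    calc _ ≤ ENNReal.ofReal c₁ * (ENNReal.ofReal (2 ^ n * R) * vb *
          (ENNReal.ofReal k₁ * (ENNReal.ofReal (2 / 2 ^ κ) * L x +
            ENNReal.ofReal (q ^ (1 - 1 / p) * 2 ^ (κ * α)) * ENNReal.ofReal y))) := by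
          gcongr
          exact h1.trans (by gcongr)
      _ = _ := by
          have eD : ENNReal.ofReal D =
              ENNReal.ofReal c₁ * ENNReal.ofReal (2 ^ n * R) * vb * ENNReal.ofReal k₁ := by
            rw [hD, ENNReal.ofReal_mul (p := c₁ * (2 ^ n * R) * v) (by positivity),
              ENNReal.ofReal_mul (p := c₁ * (2 ^ n * R)) (by positivity),
              ENNReal.ofReal_mul (p := c₁) hc₁.le, hv, ENNReal.ofReal_toReal hvbt]
          rw [eD]
          ring
  -- the covering argument
  have hmain : ∫⁻ x in S, w x ≤ N * ((ENNReal.ofReal A)⁻¹ * (ENNReal.ofReal (y ^ p) * W)) := by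
    -- Besicovitch needs a radius at every point, so the null set where the potential bound fails is
    -- removed first.
    set S' := S ∩ {x | h x ≤ ENNReal.ofReal c₁ *
      ∫⁻ z in ball x₀ R, g z * ‖x - z‖ₑ ^ (1 - (n : ℝ))} with hS'
    have hSS : S' =ᵐ[volume] S := by
      rw [ae_restrict_iff' measurableSet_ball] at hh
      filter_upwards [hh] with x hx
      refine propext ⟨fun hx' => hx'.1, fun hx' => ⟨hx', hx hx'.1⟩⟩
    have hex : ∀ x ∈ S', ∃ k, ENNReal.ofReal A * Wk x k < I x k := by
      intro x hx
      have h1 := hpoint x hx.1.1 hx.2 hx.1.2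
      rw [hLp, lt_iSup_iff] at h1
      obtain ⟨k, hk⟩ := h1
      exact ⟨k, (ENNReal.lt_div_iff_mul_lt (Or.inl (hw0 _ _ (hρ k))) (Or.inl (hwt _ _))).1 hk⟩
    choose! κ hκ using hex
    have hAe0 : ENNReal.ofReal A ≠ 0 := by positivity
    have h2 := hN (volume.withDensity w)
      ((ENNReal.ofReal A)⁻¹ • volume.withDensity fun z => γ z ^ p * w z) S'
      (fun x => 2 * R / 2 ^ κ x) (2 * R) (fun x hx => ⟨hρ _, ?_, ?_⟩)
    · rw [← setLIntegral_congr hSS, ← withDensity_apply' w S']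
      refine h2.trans ?_
      rw [Measure.smul_apply, smul_eq_mul, withDensity_apply _ MeasurableSet.univ,
        Measure.restrict_univ, hγint]
      gcongr
    · exact div_le_self hR2.le (one_le_pow₀ one_le_two)
    · have hball : closedBall x (2 * R / 2 ^ κ x) =ᵐ[volume] ball x (2 * R / 2 ^ κ x) :=
        (ae_eq_of_subset_of_measure_ge ball_subset_closedBall
          (Measure.addHaar_closedBall_eq_addHaar_ball _ _ _).le
          measurableSet_ball.nullMeasurableSet measure_closedBall_lt_top.ne).symm
      rw [Measure.smul_apply, smul_eq_mul, withDensity_apply _ measurableSet_closedBall,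
        withDensity_apply _ measurableSet_closedBall, setLIntegral_congr hball,
        setLIntegral_congr hball, ← ENNReal.mul_le_iff_le_inv hAe0 ENNReal.ofReal_ne_top]
      exact (hκ x hx).le
  have hratio2 : (∫⁻ x in S, w x) / W ≤ ENNReal.ofReal (N * y ^ p / A) := by
    rw [ENNReal.div_le_iff hW0 hWt]
    refine hmain.trans (le_of_eq ?_)
    have e : ENNReal.ofReal (N * y ^ p / A) =
        N * ENNReal.ofReal (y ^ p) * (ENNReal.ofReal A)⁻¹ := by
      rw [div_eq_mul_inv, ENNReal.ofReal_mul (p := N * y ^ p) (by positivity),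
        ENNReal.ofReal_mul (p := (N : ℝ)) (by positivity),
        ENNReal.ofReal_inv_of_pos hA0, ENNReal.ofReal_natCast]
    rw [e]
    ring
  calc _ ≤ ENNReal.ofReal (l ^ p) * ENNReal.ofReal (N * y ^ p / A) ^ (p / q) := by gcongr
    _ = ENNReal.ofReal (l ^ p * (N * y ^ p / A) ^ (p / q)) := by
        rw [ENNReal.ofReal_rpow_of_nonneg (by positivity) hpq0, ← ENNReal.ofReal_mul (by positivity)]
    _ ≤ _ := by
        refine ENNReal.ofReal_le_ofReal (le_trans ?_ hfinal)
        rw [hA, hpα]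
        exact hedberg_level_le hl hD0 hy hp hpq hN1

/-- Weak type bound for functions dominated by a Riesz potential. -/
theorem exists_weak_type (hn : 2 ≤ n) :
    ∃ C : ℝ, 1 ≤ C ∧ ∀ {s p : ℝ} {K : ℝ≥0∞} {w : EuclideanSpace ℝ (Fin n) → ℝ≥0∞}, 1 ≤ s → s ≤ p →
      p < n → K ≠ ⊤ → HasPairBound s K w → AEMeasurable w →
      (∀ (c : EuclideanSpace ℝ (Fin n)) (R : ℝ), 0 < R → ∫⁻ x in ball c R, w x ≠ 0) →
      (∀ (c : EuclideanSpace ℝ (Fin n)) (R : ℝ), ∫⁻ x in ball c R, w x ≠ ⊤) →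
      ∀ (x₀ : EuclideanSpace ℝ (Fin n)) (R : ℝ), 0 < R →
      ∀ g : EuclideanSpace ℝ (Fin n) → ℝ≥0∞, AEMeasurable g (volume.restrict (ball x₀ R)) →
      ∀ (h : EuclideanSpace ℝ (Fin n) → ℝ≥0∞) (c₁ : ℝ), 0 < c₁ →
      (∀ᵐ x ∂(volume.restrict (ball x₀ R)), h x ≤ ENNReal.ofReal c₁ *
        ∫⁻ z in ball x₀ R, g z * ‖x - z‖ₑ ^ (1 - (n : ℝ))) →
      ∀ l : ℝ, 0 < l →
      ENNReal.ofReal (l ^ p) * ((∫⁻ x in {x ∈ ball x₀ R | ENNReal.ofReal l < h x}, w x) /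
        ∫⁻ x in ball x₀ R, w x) ^ (p / (1 / p - 1 / (n * s))⁻¹) ≤
      ENNReal.ofReal ((C * c₁ * R) ^ p * (1 / p - 1 / (n * s))⁻¹ ^ (p - 1)) * K *
        ((∫⁻ x in ball x₀ R, g x ^ p * w x) / ∫⁻ x in ball x₀ R, w x) := by
  obtain ⟨C, hC1, hC⟩ := exists_weak_type_of_le hn
  refine ⟨C, hC1, ?_⟩
  intro s p K w hs hsp hpn hK hpair hwm hw0 hwt x₀ R hR g hg h c₁ hc₁ hh l hl
  have key := hC hs hsp hpn hK hpair hwm hw0 hwt x₀ R hR g hg h c₁ hc₁ hh l hl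
  have hp0 : 0 < p := by linarith
  have hns : p < n * s := by
    have : (0 : ℝ) < n := by linarith
    nlinarith
  set q := (1 / p - 1 / (n * s))⁻¹ with hq
  have hq0 : 0 < q := inv_pos.2 (sub_pos.2 (one_div_lt_one_div_of_lt hp0 hns))
  have hK1 : 1 ≤ K := hpair.one_le (hw0 _ _ one_pos) (hwt _ _)
  have hKr1 : 1 ≤ K.toReal := by rw [← ENNReal.toReal_one]; exact ENNReal.toReal_mono hK hK1
  set Y := (∫⁻ x in ball x₀ R, g x ^ p * w x) / ∫⁻ x in ball x₀ R, w x with hY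
  set M := (C * c₁ * R) ^ p * q ^ (p - 1) with hM
  have hM0 : 0 < M := by positivity
  rcases eq_or_ne Y ⊤ with hYt | hYt
  · rw [hYt, ENNReal.mul_top]
    · exact le_top
    · have : ENNReal.ofReal M ≠ 0 := by positivity
      exact mul_ne_zero this (by positivity)
  -- Take y^p slightly above Y, which also covers Y = 0; the excess δ is chosen to contribute
  -- exactly ε.
  · refine ENNReal.le_of_forall_pos_le_add fun ε hε _ => ?_
    have hε' : (0 : ℝ) < ε := hε
    set δ := (ε : ℝ) / (M * K.toReal) with hδ
    have hδ0 : 0 < δ := by positivity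
    have hsum : 0 < Y.toReal + δ := by positivity
    have hpow : ((Y.toReal + δ) ^ (1 / p)) ^ p = Y.toReal + δ := by
      rw [← Real.rpow_mul hsum.le, one_div_mul_cancel hp0.ne', Real.rpow_one]
    have h1 := key ((Y.toReal + δ) ^ (1 / p)) (by positivity) (by
      rw [hpow, ENNReal.ofReal_add ENNReal.toReal_nonneg hδ0.le, ENNReal.ofReal_toReal hYt]
      exact le_self_add)
    refine h1.trans (le_of_eq ?_)
    rw [hpow, mul_add, hδ, mul_div_cancel₀ _ (by positivity), ENNReal.ofReal_add (by positivity)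
      (by positivity), ENNReal.ofReal_mul (by positivity), ENNReal.ofReal_mul (by positivity),
      ENNReal.ofReal_toReal hK, ENNReal.ofReal_toReal hYt, ENNReal.ofReal_coe_nnreal]

end WeakTypeRiesz

/-! ### Smooth truncations and dyadic levels -/

section Truncation

open Filter Topology

/-- Smooth truncations at the levels `l` and `2 * l`. -/
theorem exists_truncation : ∃ M : NNReal, 0 < M ∧ ∀ (m : ℝ) {l : ℝ}, 0 < l → ∃ T : ℝ → ℝ,
    ContDiff ℝ 1 T ∧ (∀ v, 0 ≤ T v) ∧ (∀ v, T v ≤ |v - m| / l) ∧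
    (∀ v, 2 * l ≤ |v - m| → T v = 1) ∧ (∀ v, ‖deriv T v‖₊ ≤ M / l.toNNReal) ∧
    ∀ v, ¬ (l < |v - m| ∧ |v - m| ≤ 2 * l) → deriv T v = 0 := by
  -- The map v ↦ (v² − 1)/3 takes |v| = 1 to 0 and |v| = 2 to 1, and squaring avoids the kink of |v|
  -- at the origin.
  set T₁ : ℝ → ℝ := fun v => Real.smoothTransition ((v ^ 2 - 1) / 3) with hT₁
  have hT₁c : ContDiff ℝ 1 T₁ :=
    Real.smoothTransition.contDiff.comp (((contDiff_id.pow 2).sub contDiff_const).div_const 3)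
  have h0 : ∀ v, 0 ≤ T₁ v := fun v => Real.smoothTransition.nonneg _
  have h1 : ∀ v, T₁ v ≤ 1 := fun v => Real.smoothTransition.le_one _
  have hz : ∀ v, |v| ≤ 1 → T₁ v = 0 := fun v hv => by
    refine Real.smoothTransition.zero_of_nonpos ?_
    have : v ^ 2 ≤ 1 := (sq_le_one_iff_abs_le_one v).2 hv
    linarith
  have ho : ∀ v, 2 ≤ |v| → T₁ v = 1 := fun v hv => by
    refine Real.smoothTransition.one_of_one_le ?_
    have : 4 ≤ v ^ 2 := by rw [← sq_abs]; nlinarith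
    linarith
  -- Outside the shell T₁ attains its global minimum or maximum, so the derivative vanishes there,
  -- endpoints included.
  have hd0 : ∀ v, ¬ (1 < |v| ∧ |v| < 2) → deriv T₁ v = 0 := by
    intro v hv
    rcases le_or_gt |v| 1 with h | h
    · refine IsLocalMin.deriv_eq_zero (Eventually.of_forall fun u => ?_)
      rw [hz v h]; exact h0 u
    · refine IsLocalMax.deriv_eq_zero (Eventually.of_forall fun u => ?_)
      rw [ho v (by by_contra hc; exact hv ⟨h, not_le.1 hc⟩)]; exact h1 u
  obtain ⟨M, hM⟩ := (isCompact_Icc (a := (-2 : ℝ)) (b := 2)).exists_bound_of_continuousOn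
    (hT₁c.continuous_deriv le_rfl).continuousOn
  have hM0 : 0 ≤ M := (norm_nonneg _).trans (hM 0 (by norm_num))
  have hMall : ∀ v, ‖deriv T₁ v‖ ≤ M + 1 := fun v => by
    by_cases hv : 1 < |v| ∧ |v| < 2
    · exact (hM v (abs_le.1 hv.2.le)).trans (by linarith)
    · rw [hd0 v hv, norm_zero]; linarith
  refine ⟨(M + 1).toNNReal, Real.toNNReal_pos.2 (by linarith), fun m l hl => ?_⟩
  have habs : ∀ v, |(v - m) / l| = |v - m| / l := fun v => by rw [abs_div, abs_of_pos hl]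
  have hder : ∀ v, deriv (fun v => T₁ ((v - m) / l)) v = deriv T₁ ((v - m) / l) * (1 / l) := by
    intro v
    have h2 : HasDerivAt (fun v => (v - m) / l) (1 / l) v :=
      ((hasDerivAt_id v).sub_const m).div_const l
    exact (((hT₁c.differentiable one_ne_zero) _).hasDerivAt.comp v h2).deriv
  refine ⟨fun v => T₁ ((v - m) / l),
    hT₁c.comp ((contDiff_id.sub contDiff_const).div_const l), fun v => h0 _, fun v => ?_,
    fun v hv => ho _ ?_, fun v => ?_, fun v hv => ?_⟩
  · rcases le_or_gt |(v - m) / l| 1 with h | h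
    · simp only [hz _ h]; positivity
    · rw [← habs]; exact (h1 _).trans h.le
  · rw [habs, le_div_iff₀ hl]; exact hv
  · rw [hder, ← NNReal.coe_le_coe, coe_nnnorm, norm_mul, NNReal.coe_div,
      Real.coe_toNNReal _ (by linarith), Real.coe_toNNReal _ hl.le, Real.norm_of_nonneg
      (one_div_nonneg.2 hl.le), mul_one_div]
    gcongr
    exact hMall _
  · rw [hder, hd0, zero_mul]
    rw [habs, lt_div_iff₀ hl, div_lt_iff₀ hl, one_mul]
    exact fun h => hv ⟨h.1, h.2.le⟩

/-- Since Φ decreases, on each dyadic interval it is at most its value at the left endpoint; the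
interval (0, a] is estimated by Φ ≤ 1. -/
theorem lintegral_Ioi_le_dyadic {Φ : ℝ → ℝ≥0∞} (hΦ : Antitone Φ) (hΦ1 : ∀ t, Φ t ≤ 1) {a p : ℝ}
    (ha : 0 < a) (hp : 1 ≤ p) :
    ∫⁻ t in Set.Ioi (0 : ℝ), ENNReal.ofReal t ^ p * Φ t / ENNReal.ofReal t ≤
      ENNReal.ofReal (a ^ p) + ENNReal.ofReal (2 ^ p) *
        ∑' j : ℕ, ENNReal.ofReal ((a * 2 ^ j) ^ p) * Φ (a * 2 ^ j) := by
  have hstep : ∀ (u v : ℝ) (c : ℝ≥0∞), 0 ≤ u → u < v → (∀ t, u < t → Φ t ≤ c) →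
      ∫⁻ t in Set.Ioc u v, ENNReal.ofReal t ^ p * Φ t / ENNReal.ofReal t ≤
        ENNReal.ofReal (v ^ p) * c := by
    intro u v c hu huv hc
    have hv : 0 < v := hu.trans_lt huv
    calc _ ≤ ∫⁻ _ in Set.Ioc u v, ENNReal.ofReal (v ^ (p - 1)) * c := by
          refine setLIntegral_mono' measurableSet_Ioc fun t ht => ?_
          have ht0 : 0 < t := hu.trans_lt ht.1
          have h0 : ENNReal.ofReal t ≠ 0 := by positivity
          rw [ENNReal.mul_div_right_comm]
          refine mul_le_mul' ?_ (hc t ht.1)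
          calc ENNReal.ofReal t ^ p / ENNReal.ofReal t = ENNReal.ofReal t ^ (p - 1) := by
                rw [ENNReal.rpow_sub _ _ h0 ENNReal.ofReal_ne_top, ENNReal.rpow_one]
            _ = ENNReal.ofReal (t ^ (p - 1)) := ENNReal.ofReal_rpow_of_pos ht0
            _ ≤ _ := ENNReal.ofReal_le_ofReal
                (Real.rpow_le_rpow ht0.le ht.2 (by linarith))
      _ = ENNReal.ofReal (v ^ (p - 1)) * c * ENNReal.ofReal (v - u) := by
          rw [setLIntegral_const, Real.volume_Ioc]
      _ ≤ ENNReal.ofReal (v ^ (p - 1)) * c * ENNReal.ofReal v := by gcongr; linarith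
      _ = _ := by
          rw [mul_right_comm, ← ENNReal.ofReal_mul (by positivity), ← Real.rpow_add_one hv.ne',
            sub_add_cancel]
  have hcover : Set.Ioi (0 : ℝ) ⊆
      Set.Ioc 0 a ∪ ⋃ j : ℕ, Set.Icc (a * 2 ^ j) (a * 2 ^ (j + 1)) := by
    intro t ht
    rcases le_or_gt t a with h | h
    · exact Or.inl ⟨ht, h⟩
    · obtain ⟨j, hj, hj'⟩ := exists_nat_pow_near ((one_le_div ha).2 h.le) one_lt_two
      refine Or.inr (Set.mem_iUnion.2 ⟨j, ?_, ?_⟩)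
      · rwa [le_div_iff₀' ha] at hj
      · rw [div_lt_iff₀' ha] at hj'
        exact hj'.le
  calc _ ≤ ∫⁻ t in Set.Ioc 0 a ∪ ⋃ j : ℕ, Set.Icc (a * 2 ^ j) (a * 2 ^ (j + 1)),
        ENNReal.ofReal t ^ p * Φ t / ENNReal.ofReal t := lintegral_mono_set hcover
    _ ≤ _ := (lintegral_union_le _ _ _).trans (add_le_add ?_ ?_)
  · simpa using hstep 0 a 1 le_rfl ha fun t _ => hΦ1 t
  · refine (lintegral_iUnion_le _ _).trans ?_
    rw [← ENNReal.tsum_mul_left]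
    refine ENNReal.tsum_le_tsum fun j => ?_
    have h2 : (0 : ℝ) < 2 ^ j := by positivity
    rw [← setLIntegral_congr Ioc_ae_eq_Icc]
    refine (hstep _ _ (Φ (a * 2 ^ j)) (by positivity) (by gcongr <;> simp)
      fun t ht => hΦ ht.le).trans (le_of_eq ?_)
    rw [pow_succ, ← mul_assoc, mul_comm _ (2 : ℝ), Real.mul_rpow two_pos.le (by positivity),
      ENNReal.ofReal_mul (by positivity), mul_assoc]

variable {n : ℕ}

/-- The unweighted `L¹` Poincaré inequality, weighted on the right-hand side. -/
theorem lintegral_enorm_sub_average_le (hn : 2 ≤ n) {x₀ : EuclideanSpace ℝ (Fin n)} {R : ℝ}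
    (hR : 0 < R) {f : EuclideanSpace ℝ (Fin n) → ℝ}
    {G : EuclideanSpace ℝ (Fin n) → EuclideanSpace ℝ (Fin n)} (hf : IntegrableOn f (ball x₀ R))
    (hG : IntegrableOn G (ball x₀ R)) (h : HasWeakGradientOn (ball x₀ R) f G) :
    ⨍⁻ x in ball x₀ R, ‖f x - ⨍ y in ball x₀ R, f y‖ₑ ∂volume ≤
      reprConst n * ENNReal.ofReal (n * (2 * R)) *
        volume (ball (0 : EuclideanSpace ℝ (Fin n)) 1) * ⨍⁻ x in ball x₀ R, ‖G x‖ₑ ∂volume := by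
  have hne : Nonempty (Fin n) := ⟨⟨0, by omega⟩⟩
  have h1 := ae_enorm_sub_average_le (by omega) hR hf hG h (T := id) contDiff_id (M := 1)
    (fun t => by simp)
  simp only [id, deriv_id', enorm_one, one_mul] at h1
  have hGm : AEMeasurable (fun z => ‖G z‖ₑ) (volume.restrict (ball x₀ R)) :=
    hG.aestronglyMeasurable.enorm
  have h2 : ∫⁻ x in ball x₀ R, ‖f x - ⨍ y in ball x₀ R, f y‖ₑ ≤
      reprConst n * (ENNReal.ofReal (n * (2 * R)) *
        volume (ball (0 : EuclideanSpace ℝ (Fin n)) 1) * ∫⁻ x in ball x₀ R, ‖G x‖ₑ) := by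
    calc _ ≤ ∫⁻ x in ball x₀ R, reprConst n *
          ∫⁻ z in ball x₀ R, ‖G z‖ₑ * ‖x - z‖ₑ ^ (1 - (n : ℝ)) := lintegral_mono_ae h1
      _ = reprConst n * ∫⁻ z in ball x₀ R, ∫⁻ x in ball x₀ R,
            ‖G z‖ₑ * ‖x - z‖ₑ ^ (1 - (n : ℝ)) := by
          rw [lintegral_const_mul' _ _ (reprConst_ne_top n), lintegral_lintegral_swap]
          exact hGm.comp_snd.mul (by fun_prop)
      _ ≤ reprConst n * ∫⁻ z in ball x₀ R, ‖G z‖ₑ * (ENNReal.ofReal (n * (2 * R)) *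
            volume (ball (0 : EuclideanSpace ℝ (Fin n)) 1)) := by
          gcongr reprConst n * ?_
          refine setLIntegral_mono' measurableSet_ball fun z hz => ?_
          rw [lintegral_const_mul _ (by fun_prop)]
          gcongr
          have := lintegral_ball_enorm_sub_rpow_le
            (volume : Measure (EuclideanSpace ℝ (Fin n))) hR hz
          simpa using this
      _ = _ := by rw [lintegral_mul_const'' _ hGm, mul_comm (∫⁻ _ in _, _)]
  rw [setLAverage_eq, setLAverage_eq, ← mul_div_assoc]
  gcongr
  exact h2.trans (le_of_eq (by ring))

end Truncation

/-! ### From weak type to the Lorentz norm -/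

section Lorentz

open Filter Topology

variable {n : ℕ}

/-- Maz'ya's truncation at one level. If the mean of |f − m| is at most l/2, then T ∘ f has mean at
most 1/2, so T ∘ f is away from its mean where |f − m| > 2l, and the weak bound applies there. The
resulting g vanishes off the shell between l and 2l, so levels can be summed. -/
theorem exists_truncated_level_le (hn : 2 ≤ n) :
    ∃ C : ℝ, 1 ≤ C ∧ ∀ {s p : ℝ} {K : ℝ≥0∞} {w : EuclideanSpace ℝ (Fin n) → ℝ≥0∞}, 1 ≤ s → s ≤ p →
      p < n → K ≠ ⊤ → HasPairBound s K w → AEMeasurable w →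
      (∀ (c : EuclideanSpace ℝ (Fin n)) (R : ℝ), 0 < R → ∫⁻ x in ball c R, w x ≠ 0) →
      (∀ (c : EuclideanSpace ℝ (Fin n)) (R : ℝ), ∫⁻ x in ball c R, w x ≠ ⊤) →
      ∀ (x₀ : EuclideanSpace ℝ (Fin n)) (R : ℝ), 0 < R →
      ∀ (f : EuclideanSpace ℝ (Fin n) → ℝ)
        (G : EuclideanSpace ℝ (Fin n) → EuclideanSpace ℝ (Fin n)),
      IntegrableOn f (ball x₀ R) → IntegrableOn G (ball x₀ R) →
      HasWeakGradientOn (ball x₀ R) f G → ∀ m l : ℝ, 0 < l →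
      ⨍⁻ x in ball x₀ R, ‖f x - m‖ₑ ∂volume ≤ ENNReal.ofReal (l / 2) →
      ∃ g : EuclideanSpace ℝ (Fin n) → ℝ≥0∞, AEMeasurable g (volume.restrict (ball x₀ R)) ∧
        (∀ x, g x ≤ ‖G x‖ₑ) ∧ (∀ x, ¬ (l < |f x - m| ∧ |f x - m| ≤ 2 * l) → g x = 0) ∧
        ENNReal.ofReal (l ^ p) * ((∫⁻ x in {x ∈ ball x₀ R | 2 * l < |f x - m|}, w x) /
          ∫⁻ x in ball x₀ R, w x) ^ (p / (1 / p - 1 / (n * s))⁻¹) ≤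
        ENNReal.ofReal ((C * R) ^ p * (1 / p - 1 / (n * s))⁻¹ ^ (p - 1)) * K *
          ((∫⁻ x in ball x₀ R, g x ^ p * w x) / ∫⁻ x in ball x₀ R, w x) := by
  obtain ⟨C, hC1, hC⟩ := exists_weak_type hn
  obtain ⟨M, hM0, hM⟩ := exists_truncation
  set c₁ := (reprConst n).toReal + 1 with hc₁
  have hc₁0 : 0 < c₁ := by positivity
  have hc₁le : reprConst n ≤ ENNReal.ofReal c₁ := by
    rw [hc₁, ENNReal.ofReal_add ENNReal.toReal_nonneg zero_le_one,
      ENNReal.ofReal_toReal (reprConst_ne_top n)]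
    exact le_self_add
  have hM0' : (0 : ℝ) < M := hM0
  refine ⟨max 1 (4 * C * c₁ * M), le_max_left _ _, ?_⟩
  intro s p K w hs hsp hpn hK hpair hwm hw0 hwt x₀ R hR f G hf hG hfG m l hl hml
  obtain ⟨T, hTc, hT0, hTle, hT1, hTd, hTz⟩ := hM m hl
  have hp0 : 0 < p := by linarith
  have hns : p < n * s := by
    have : (0 : ℝ) < n := by linarith
    nlinarith
  set q := (1 / p - 1 / (n * s))⁻¹ with hq
  have hq0 : 0 < q := inv_pos.2 (sub_pos.2 (one_div_lt_one_div_of_lt hp0 hns))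
  set B := ball x₀ R with hB
  have hTd' : ∀ v, ‖deriv T v‖ₑ ≤ ENNReal.ofReal (M / l) := fun v => by
    have : ENNReal.ofReal (M / l) = ((M / l.toNNReal : NNReal) : ℝ≥0∞) := by
      rw [ENNReal.ofReal, Real.toNNReal_div (by positivity), Real.toNNReal_coe]
    rw [this]
    exact ENNReal.coe_le_coe.2 (hTd v)
  have hMl : ENNReal.ofReal (l / M) * ENNReal.ofReal (M / l) = 1 := by
    rw [← ENNReal.ofReal_mul (by positivity)]
    simp [field]
  -- Since |T'| ≤ M/l, the factor l/M makes g at most |G|.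
  set g : EuclideanSpace ℝ (Fin n) → ℝ≥0∞ := fun x =>
    ENNReal.ofReal (l / M) * (‖deriv T (f x)‖ₑ * ‖G x‖ₑ) with hg
  have hgm : AEMeasurable g (volume.restrict B) := by
    have h1 : AEMeasurable (fun x => ‖deriv T (f x)‖ₑ) (volume.restrict B) :=
      ((hTc.continuous_deriv le_rfl).comp_aestronglyMeasurable hf.aestronglyMeasurable).enorm
    exact (h1.mul hG.aestronglyMeasurable.enorm).const_mul _
  refine ⟨g, hgm, fun x => ?_, fun x hx => ?_, ?_⟩
  · calc g x ≤ ENNReal.ofReal (l / M) * (ENNReal.ofReal (M / l) * ‖G x‖ₑ) := by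
          simp only [hg]; gcongr; exact hTd' _
      _ = _ := by rw [← mul_assoc, hMl, one_mul]
  · simp only [hg, hTz _ hx, enorm_zero, zero_mul, mul_zero]
  -- the average of the truncation is small
  have hav : ⨍ y in B, T (f y) ≤ 1 / 2 := by
    have hint : IntegrableOn (fun x => |f x - m| / l) B :=
      ((hf.sub (integrableOn_const measure_ball_lt_top.ne)).abs).div_const l
    have hTint : IntegrableOn (fun x => T (f x)) B := by
      refine hint.mono' (hTc.continuous.comp_aestronglyMeasurable hf.aestronglyMeasurable)
        (Eventually.of_forall fun x => ?_)
      rw [Real.norm_of_nonneg (hT0 _)]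
      exact hTle _
    have h1 : ⨍ y in B, T (f y) ≤ ⨍ y in B, |f y - m| / l := by
      rw [setAverage_eq, setAverage_eq]
      exact smul_le_smul_of_nonneg_left (integral_mono hTint hint fun x => hTle _)
        (by positivity)
    refine h1.trans ?_
    have h2 : ⨍ y in B, |f y - m| ≤ l / 2 := by
      have h3 : (⨍⁻ x in B, ‖f x - m‖ₑ ∂volume).toReal = ⨍ y in B, |f y - m| := by
        have h4 : ∫ x in B, |f x - m| = (∫⁻ x in B, ‖f x - m‖ₑ).toReal :=
          integral_norm_eq_lintegral_enorm
            (hf.aestronglyMeasurable.sub aestronglyMeasurable_const)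
        rw [setLAverage_eq, setAverage_eq, ENNReal.toReal_div, smul_eq_mul, h4, div_eq_inv_mul]
        rfl
      rw [← h3]
      exact ENNReal.toReal_le_of_le_ofReal (by positivity) hml
    rw [setAverage_eq, integral_div, smul_eq_mul, ← mul_div_assoc, ← smul_eq_mul, ← setAverage_eq]
    rw [div_le_div_iff₀ hl two_pos]
    linarith
  have hrepr := ae_enorm_sub_average_le (by omega) hR hf hG hfG hTc hTd
  have hrepr' : ∀ᵐ x ∂(volume.restrict B), ‖T (f x) - ⨍ y in B, T (f y)‖ₑ ≤
      ENNReal.ofReal (c₁ * (M / l)) * ∫⁻ z in B, g z * ‖x - z‖ₑ ^ (1 - (n : ℝ)) := by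
    filter_upwards [hrepr] with x hx
    refine hx.trans ?_
    rw [ENNReal.ofReal_mul hc₁0.le, mul_assoc, ← lintegral_const_mul' _ _ ENNReal.ofReal_ne_top]
    refine mul_le_mul' hc₁le (lintegral_mono fun z => le_of_eq ?_)
    simp only [hg]
    rw [← mul_assoc, ← mul_assoc, mul_comm (ENNReal.ofReal (M / l)), hMl, one_mul]
  -- On the superlevel set T ∘ f differs from its mean by at least 1/2; testing at 1/4 leaves room
  -- for the strict inequality.
  have hweak := hC hs hsp hpn hK hpair hwm hw0 hwt x₀ R hR g hgm _ _ (by positivity) hrepr'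
    (1 / 4) (by norm_num)
  have hsub : {x ∈ B | 2 * l < |f x - m|} ⊆
      {x ∈ B | ENNReal.ofReal (1 / 4) < ‖T (f x) - ⨍ y in B, T (f y)‖ₑ} := by
    refine fun x hx => ⟨hx.1, ?_⟩
    rw [hT1 _ hx.2.le, Real.enorm_eq_ofReal (by linarith)]
    exact (ENNReal.ofReal_lt_ofReal_iff (by linarith)).2 (by linarith)
  have hpq : 0 ≤ p / q := by positivity
  calc _ = ENNReal.ofReal ((4 * l) ^ p) * (ENNReal.ofReal ((1 / 4) ^ p) *
        ((∫⁻ x in {x ∈ B | 2 * l < |f x - m|}, w x) / ∫⁻ x in B, w x) ^ (p / q)) := by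
        rw [← mul_assoc, ← ENNReal.ofReal_mul (by positivity), ← Real.mul_rpow (by positivity)
          (by positivity)]
        congr 4
        ring
    _ ≤ ENNReal.ofReal ((4 * l) ^ p) *
        (ENNReal.ofReal ((C * (c₁ * (M / l)) * R) ^ p * q ^ (p - 1)) * K *
          ((∫⁻ x in B, g x ^ p * w x) / ∫⁻ x in B, w x)) := by
        gcongr ENNReal.ofReal ((4 * l) ^ p) * ?_
        refine le_trans ?_ hweak
        gcongr
    _ = ENNReal.ofReal ((4 * C * c₁ * M * R) ^ p * q ^ (p - 1)) * K *
          ((∫⁻ x in B, g x ^ p * w x) / ∫⁻ x in B, w x) := by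
        rw [← mul_assoc, ← mul_assoc, ← ENNReal.ofReal_mul (by positivity), ← mul_assoc,
          ← Real.mul_rpow (by positivity) (by positivity)]
        congr 5
        field_simp
    _ ≤ _ := by
        gcongr
        exact le_max_right _ _

/-- The Poincaré-Sobolev inequality in Lorentz norms under the pair bound. -/
theorem exists_weightedLorentzAvg_le (hn : 2 ≤ n) :
    ∃ C : ℝ, 1 ≤ C ∧ ∀ {s p : ℝ} {K : ℝ≥0∞} {w : EuclideanSpace ℝ (Fin n) → ℝ≥0∞}, 1 ≤ s → s ≤ p →
      p < n → K ≠ ⊤ → HasPairBound s K w → AEMeasurable w →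
      (∀ (c : EuclideanSpace ℝ (Fin n)) (R : ℝ), 0 < R → ∫⁻ x in ball c R, w x ≠ 0) →
      (∀ (c : EuclideanSpace ℝ (Fin n)) (R : ℝ), ∫⁻ x in ball c R, w x ≠ ⊤) →
      ∀ (x₀ : EuclideanSpace ℝ (Fin n)) (R : ℝ), 0 < R →
      ∀ (f : EuclideanSpace ℝ (Fin n) → ℝ)
        (G : EuclideanSpace ℝ (Fin n) → EuclideanSpace ℝ (Fin n)),
      IntegrableOn f (ball x₀ R) → HasWeakGradientOn (ball x₀ R) f G →
      weightedLorentzAvg (1 / p - 1 / (n * s))⁻¹ p w (ball x₀ R)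
          (fun x => f x - ⨍ y in ball x₀ R, f y) ≤
        ENNReal.ofReal (C * (1 / p - 1 / (n * s))⁻¹) * K ^ (1 / p) * ENNReal.ofReal R *
          weightedLpAvg p w (ball x₀ R) G := by
  obtain ⟨C, hC1, hC⟩ := exists_truncated_level_le hn
  set c₂ := (reprConst n * ENNReal.ofReal (n * 2) *
        volume (ball (0 : EuclideanSpace ℝ (Fin n)) 1)).toReal with hc₂
  have hc₂t : reprConst n * ENNReal.ofReal (n * 2) *
      volume (ball (0 : EuclideanSpace ℝ (Fin n)) 1) = ENNReal.ofReal c₂ :=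
    (ENNReal.ofReal_toReal (ENNReal.mul_ne_top (ENNReal.mul_ne_top (reprConst_ne_top n)
      ENNReal.ofReal_ne_top) (volume_ball_ne_top _ _))).symm
  have hc₂0 : 0 ≤ c₂ := ENNReal.toReal_nonneg
  refine ⟨4 * c₂ + 4 * C, by linarith, ?_⟩
  intro s p K w hs hsp hpn hK hpair hwm hw0 hwt x₀ R hR f G hf hfG
  have hp : 1 ≤ p := hs.trans hsp
  have hp0 : 0 < p := by linarith
  have hs0 : 0 < s := by linarith
  have hns : p < n * s := by
    have : (0 : ℝ) < n := by linarith
    nlinarith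
  set q := (1 / p - 1 / (n * s))⁻¹ with hq
  have hq1 : 1 ≤ q := by
    rw [hq, one_le_inv₀ (sub_pos.2 (one_div_lt_one_div_of_lt hp0 hns))]
    have h1 : 1 / p ≤ 1 := (div_le_one hp0).2 hp
    have h2 : 0 < 1 / (n * s) := by positivity
    linarith
  have hq0 : 0 < q := by linarith
  have hpq : 0 < p / q := by positivity
  set B := ball x₀ R with hB
  set m := ⨍ y in B, f y with hm
  have hK1 : 1 ≤ K := hpair.one_le (hw0 _ _ one_pos) (hwt _ _)
  have hK0 : K ≠ 0 := (one_pos.trans_le hK1).ne'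
  set W := ∫⁻ x in B, w x with hW
  have hW0 : W ≠ 0 := hw0 _ _ hR
  have hWt : W ≠ ⊤ := hwt _ _
  set Y := (∫⁻ x in B, ‖G x‖ₑ ^ p * w x) / W with hY
  have hYN : weightedLpAvg p w B G = Y ^ (1 / p) := rfl
  rcases eq_or_ne Y ⊤ with hYt | hYt
  · rw [hYN, hYt, ENNReal.top_rpow_of_pos (by positivity), ENNReal.mul_top]
    · exact le_top
    · have h1 : ENNReal.ofReal ((4 * c₂ + 4 * C) * q) ≠ 0 := by positivity
      have h2 : ENNReal.ofReal R ≠ 0 := by positivity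
      have h3 : K ^ (1 / p) ≠ 0 := by positivity
      positivity
  have hGm : AEStronglyMeasurable G (volume.restrict B) :=
    hfG.locallyIntegrableOn_grad.aestronglyMeasurable
  have hGe : AEMeasurable (fun x => ‖G x‖ₑ) (volume.restrict B) := hGm.enorm
  have hvol0 := volume_ball_ne_zero x₀ hR
  have hvolt := volume_ball_ne_top x₀ R
  have hav : (⨍⁻ y in B, ‖G y‖ₑ ∂volume) ^ p ≤ K * Y := by
    have h1 := hpair.mono_exponent hs0 hsp hR le_rfl hGe
    rw [div_self hR.ne', Real.one_rpow, ENNReal.ofReal_one, mul_one] at h1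
    rw [hY, ← mul_div_assoc]
    exact (ENNReal.le_div_iff_mul_le (Or.inl hW0) (Or.inl hWt)).2 h1
  -- The gradient is assumed only locally integrable; finiteness of the right side makes it
  -- integrable up to the boundary.
  have hG : IntegrableOn G B := by
    refine ⟨hGm, ?_⟩
    have h1 : ⨍⁻ y in B, ‖G y‖ₑ ∂volume ≠ ⊤ := by
      intro h
      rw [h, ENNReal.top_rpow_of_pos hp0, top_le_iff] at hav
      exact ENNReal.mul_ne_top hK hYt hav
    rw [setLAverage_eq] at h1
    refine lt_top_iff_ne_top.2 fun h => h1 ?_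
    rw [h, ENNReal.top_div_of_ne_top hvolt]
  set X := ⨍⁻ x in B, ‖f x - m‖ₑ ∂volume with hX
  have hXle : X ≤ ENNReal.ofReal (c₂ * R) * ⨍⁻ y in B, ‖G y‖ₑ ∂volume := by
    refine (lintegral_enorm_sub_average_le hn hR hf hG hfG).trans (le_of_eq ?_)
    rw [ENNReal.ofReal_mul hc₂0, ← hc₂t, ← mul_assoc (n : ℝ), ENNReal.ofReal_mul (by positivity)]
    ring
  have hfm : AEMeasurable (fun x => ‖f x - m‖ₑ) (volume.restrict B) :=
    (hf.aestronglyMeasurable.sub aestronglyMeasurable_const).enorm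
  have hXt : X ≠ ⊤ := by
    rw [hX, setLAverage_eq]
    refine ENNReal.div_ne_top ?_ hvol0
    exact (hf.sub (integrableOn_const measure_ball_lt_top.ne)).2.ne
  set Φ : ℝ → ℝ≥0∞ := fun t => ((∫⁻ x in {x ∈ B | t < |f x - m|}, w x) / W) ^ (p / q) with hΦ
  have hLz : weightedLorentzAvg q p w B (fun x => f x - m) =
      (ENNReal.ofReal q * ∫⁻ t in Set.Ioi (0 : ℝ),
        ENNReal.ofReal t ^ p * Φ t / ENNReal.ofReal t) ^ (1 / p) := rfl
  rcases eq_or_ne X 0 with hX0 | hX0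
  · have h0 : ∀ᵐ x ∂(volume.restrict B), f x - m = 0 := by
      rw [hX, setLAverage_eq, ENNReal.div_eq_zero_iff] at hX0
      filter_upwards [(lintegral_eq_zero_iff' hfm).1 (hX0.resolve_right hvolt)] with x hx
      simpa using hx
    have h1 : ∀ t ∈ Set.Ioi (0 : ℝ),
        ENNReal.ofReal t ^ p * Φ t / ENNReal.ofReal t = (0 : ℝ → ℝ≥0∞) t := by
      intro t ht
      have h2 : volume {x ∈ B | t < |f x - m|} = 0 := by
        rw [ae_restrict_iff' measurableSet_ball] at h0
        refine measure_mono_null (fun x hx => ?_) (ae_iff.1 h0)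
        refine fun hx' => ?_
        have := hx' hx.1
        have h3 := hx.2
        rw [this, abs_zero] at h3
        exact lt_asymm h3 ht
      simp only [hΦ]
      rw [setLIntegral_measure_zero _ _ h2, ENNReal.zero_div, ENNReal.zero_rpow_of_pos hpq,
        mul_zero, ENNReal.zero_div, Pi.zero_apply]
    rw [hLz, setLIntegral_congr_fun measurableSet_Ioi h1]
    simp [hp0]
  -- The mean oscillation of f. All levels start at 2t₀, so the smallness condition of the
  -- truncation lemma holds; heights below 4t₀ are covered by the unweighted L¹ Poincaré inequality.
  set t₀ := X.toReal with ht₀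
  have ht₀0 : 0 < t₀ := ENNReal.toReal_pos hX0 hXt
  have hXt₀ : X = ENNReal.ofReal t₀ := (ENNReal.ofReal_toReal hXt).symm
  have hΦanti : Antitone Φ := fun a b hab => by
    simp only [hΦ]
    gcongr
  have hΦ1 : ∀ t, Φ t ≤ 1 := fun t => by
    refine ENNReal.rpow_le_one ?_ hpq.le
    rw [ENNReal.div_le_iff hW0 hWt, one_mul]
    exact lintegral_mono_set fun x hx => hx.1
  have hlev : ∀ j : ℕ, 0 < 2 * t₀ * 2 ^ j := fun j => by positivity
  have hex := fun j : ℕ => hC hs hsp hpn hK hpair hwm hw0 hwt x₀ R hR f G hf hG hfG m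
    (2 * t₀ * 2 ^ j) (hlev j) (by
      rw [← hX, hXt₀]
      refine ENNReal.ofReal_le_ofReal ?_
      have : (1 : ℝ) ≤ 2 ^ j := one_le_pow₀ one_le_two
      nlinarith)
  choose g hgm hgG hgz hgle using hex
  -- The half-open shells (l, 2l] for dyadic l are disjoint, so at each point at most one g_j is
  -- nonzero.
  have hsum : ∑' j, ∫⁻ x in B, g j x ^ p * w x ≤ ∫⁻ x in B, ‖G x‖ₑ ^ p * w x := by
    have h1 := lintegral_tsum (f := fun j x => g j x ^ p * w x)
      fun j => ((hgm j).pow_const p).mul hwm.restrict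
    rw [← h1]
    refine lintegral_mono fun x => ?_
    rw [ENNReal.tsum_mul_right]
    gcongr
    by_cases h : ∃ j, g j x ≠ 0
    · obtain ⟨j, hj⟩ := h
      rw [tsum_eq_single j]
      · gcongr; exact hgG j x
      · intro i hij
        rw [ENNReal.rpow_eq_zero_iff]
        refine Or.inl ⟨hgz i x fun hi => ?_, hp0⟩
        have hj' := not_not.1 (mt (hgz j x) hj)
        rcases lt_or_gt_of_ne hij with hlt | hlt
        · have : (2 : ℝ) ^ (i + 1) ≤ 2 ^ j := pow_le_pow_right₀ one_le_two hlt
          rw [pow_succ] at this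
          nlinarith [hi.2, hj'.1]
        · have : (2 : ℝ) ^ (j + 1) ≤ 2 ^ i := pow_le_pow_right₀ one_le_two hlt
          rw [pow_succ] at this
          nlinarith [hj'.2, hi.1]
    · push Not at h
      simp [h, hp0]
  set A := ENNReal.ofReal ((C * R) ^ p * q ^ (p - 1)) with hA
  have hΦsum : ∑' j : ℕ, ENNReal.ofReal ((4 * t₀ * 2 ^ j) ^ p) * Φ (4 * t₀ * 2 ^ j) ≤
      ENNReal.ofReal (2 ^ p) * (A * K * Y) := by
    calc _ ≤ ∑' j : ℕ, ENNReal.ofReal (2 ^ p) * (A * K * ((∫⁻ x in B, g j x ^ p * w x) / W)) := by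
          refine ENNReal.tsum_le_tsum fun j => ?_
          refine le_trans (le_of_eq ?_) (mul_le_mul_right (hgle j) _)
          have e : 4 * t₀ * 2 ^ j = 2 * (2 * t₀ * 2 ^ j) := by ring
          rw [e, Real.mul_rpow two_pos.le (hlev j).le, ENNReal.ofReal_mul (by positivity), mul_assoc]
      _ ≤ _ := by
          simp_rw [div_eq_mul_inv]
          rw [ENNReal.tsum_mul_left, ENNReal.tsum_mul_left, ENNReal.tsum_mul_right]
          rw [hY, div_eq_mul_inv]
          gcongr
  have hXp : ENNReal.ofReal ((4 * t₀) ^ p) ≤ ENNReal.ofReal ((4 * c₂ * R) ^ p) * (K * Y) := by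
    rw [← ENNReal.ofReal_rpow_of_pos (by positivity), ENNReal.ofReal_mul (by norm_num), ← hXt₀,
      ← ENNReal.ofReal_rpow_of_nonneg (by positivity) hp0.le]
    calc _ ≤ (ENNReal.ofReal 4 * (ENNReal.ofReal (c₂ * R) * ⨍⁻ y in B, ‖G y‖ₑ ∂volume)) ^ p := by
          gcongr
      _ = ENNReal.ofReal (4 * c₂ * R) ^ p * (⨍⁻ y in B, ‖G y‖ₑ ∂volume) ^ p := by
          rw [← mul_assoc, ENNReal.mul_rpow_of_nonneg _ _ hp0.le,
            ← ENNReal.ofReal_mul (by norm_num), mul_assoc 4]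
      _ ≤ _ := by gcongr
  have hmain : ENNReal.ofReal q * ∫⁻ t in Set.Ioi (0 : ℝ),
      ENNReal.ofReal t ^ p * Φ t / ENNReal.ofReal t ≤
      ENNReal.ofReal (((4 * c₂ + 4 * C) * q * R) ^ p) * (K * Y) := by
    calc _ ≤ ENNReal.ofReal q * (ENNReal.ofReal ((4 * c₂ * R) ^ p) * (K * Y) +
          ENNReal.ofReal (2 ^ p) * (ENNReal.ofReal (2 ^ p) * (A * K * Y))) := by
          gcongr
          refine (lintegral_Ioi_le_dyadic hΦanti hΦ1 (by positivity : 0 < 4 * t₀) hp).trans ?_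
          gcongr
      _ = ENNReal.ofReal (q * ((4 * c₂ * R) ^ p + (4 * C * R) ^ p * q ^ (p - 1))) * (K * Y) := by
          have e : (4 * C * R) ^ p * q ^ (p - 1) = 2 ^ p * 2 ^ p * ((C * R) ^ p * q ^ (p - 1)) := by
            rw [← mul_assoc, ← Real.mul_rpow two_pos.le two_pos.le,
              ← Real.mul_rpow (by norm_num) (by positivity)]
            congr 2; ring
          rw [e, ENNReal.ofReal_mul hq0.le, ENNReal.ofReal_add (by positivity) (by positivity),
            ENNReal.ofReal_mul (p := 2 ^ p * 2 ^ p) (by positivity),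
            ENNReal.ofReal_mul (p := 2 ^ p) (by positivity), ← hA]
          ring
      _ ≤ _ := by
          gcongr
          -- The prefactor q times q^(p-1) is q^p, and superadditivity of t ↦ t^p merges the low and
          -- high levels; the p-th root is then linear in q.
          have h1 : q ≤ q ^ p := by
            conv_lhs => rw [← Real.rpow_one q]
            exact Real.rpow_le_rpow_of_exponent_le hq1 hp
          have h2 : q * q ^ (p - 1) = q ^ p := by
            rw [mul_comm, ← Real.rpow_add_one hq0.ne', sub_add_cancel]
          have h3 := Real.add_rpow_le_rpow_add (by positivity : 0 ≤ 4 * c₂ * R)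
            (by positivity : 0 ≤ 4 * C * R) hp
          calc _ = q * (4 * c₂ * R) ^ p + (4 * C * R) ^ p * (q * q ^ (p - 1)) := by ring
            _ ≤ q ^ p * (4 * c₂ * R) ^ p + (4 * C * R) ^ p * q ^ p := by
                rw [h2]; gcongr
            _ = q ^ p * ((4 * c₂ * R) ^ p + (4 * C * R) ^ p) := by ring
            _ ≤ q ^ p * (4 * c₂ * R + 4 * C * R) ^ p := by gcongr
            _ = _ := by
                rw [← Real.mul_rpow hq0.le (by positivity)]; congr 1; ring
  rw [hLz, hYN]
  calc _ ≤ (ENNReal.ofReal (((4 * c₂ + 4 * C) * q * R) ^ p) * (K * Y)) ^ (1 / p) := by gcongr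
    _ = _ := by
        rw [← ENNReal.ofReal_rpow_of_nonneg (by positivity) hp0.le,
          ENNReal.mul_rpow_of_nonneg _ _ (by positivity), ← ENNReal.rpow_mul,
          mul_one_div_cancel hp0.ne', ENNReal.rpow_one,
          ENNReal.mul_rpow_of_nonneg _ _ (by positivity), ENNReal.ofReal_mul (by positivity)]
        ring

end Lorentz

/-! ### Embedding of Lorentz into Lebesgue spaces, and the inequality for A_r weights -/

section Embedding

open Filter Topology

variable {n : ℕ}

/-- The mass ratio is at most one, so lowering the power s/q increases the integrand. Needed because
q_r is only bounded above by (1/p − 1/(ns))⁻¹. -/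
theorem weightedLorentzAvg_mono_exponent {q q' s : ℝ} (hq : 0 < q) (hqq : q ≤ q') (hs : 0 < s)
    (w : EuclideanSpace ℝ (Fin n) → ℝ≥0∞) (B : Set (EuclideanSpace ℝ (Fin n)))
    (h : EuclideanSpace ℝ (Fin n) → ℝ) :
    weightedLorentzAvg q s w B h ≤ weightedLorentzAvg q' s w B h := by
  unfold weightedLorentzAvg
  have key : ∀ t : ℝ, ((∫⁻ x in {x ∈ B | t < |h x|}, w x) / ∫⁻ x in B, w x) ^ (s / q) ≤
      ((∫⁻ x in {x ∈ B | t < |h x|}, w x) / ∫⁻ x in B, w x) ^ (s / q') := fun t => by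
    refine ENNReal.rpow_le_rpow_of_exponent_ge ?_ (by gcongr)
    exact (ENNReal.div_le_div_right (lintegral_mono_set fun x hx => hx.1) _).trans
      ENNReal.div_self_le_one
  have h1 : ENNReal.ofReal q ≤ ENNReal.ofReal q' := ENNReal.ofReal_le_ofReal hqq
  refine ENNReal.rpow_le_rpow (mul_le_mul' h1 (lintegral_mono fun t => ?_)) (by positivity)
  exact ENNReal.div_le_div_right (mul_le_mul_right (key t) _) _

theorem lintegral_Ioc_rpow_sub_one {p t : ℝ} (hp : 0 < p) (ht : 0 ≤ t) :
    ∫⁻ τ in Set.Ioc 0 t, ENNReal.ofReal (τ ^ (p - 1)) = ENNReal.ofReal (t ^ p / p) := by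
  have hint : IntegrableOn (fun τ : ℝ => τ ^ (p - 1)) (Set.Ioc 0 t) :=
    (intervalIntegrable_iff_integrableOn_Ioc_of_le ht).1
      (intervalIntegral.intervalIntegrable_rpow' (by linarith))
  rw [← ofReal_integral_eq_lintegral_ofReal hint, ← intervalIntegral.integral_of_le ht,
    integral_rpow (Or.inl (by linarith)), sub_add_cancel, Real.zero_rpow hp.ne', sub_zero]
  filter_upwards [ae_restrict_mem measurableSet_Ioc] with τ hτ
  exact Real.rpow_nonneg hτ.1.le _

/-- The embedding of the Lorentz space `L^{q,p}` into `L^q` for `p ≤ q`. -/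
theorem weightedLpAvg_le_weightedLorentzAvg {p q : ℝ} (hp : 0 < p) (hpq : p ≤ q)
    {w : EuclideanSpace ℝ (Fin n) → ℝ≥0∞} (hw : AEMeasurable w)
    {B : Set (EuclideanSpace ℝ (Fin n))} {h : EuclideanSpace ℝ (Fin n) → ℝ}
    (hh : AEMeasurable h (volume.restrict B)) :
    weightedLpAvg q w B h ≤ weightedLorentzAvg q p w B h := by
  have hq : 0 < q := hp.trans_le hpq
  set W := ∫⁻ x in B, w x with hW
  set ψ : ℝ → ℝ≥0∞ := fun t => (∫⁻ x in {x ∈ B | t < |h x|}, w x) / W with hψ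
  have hψanti : Antitone ψ := fun a b hab => by
    simp only [hψ]
    gcongr
  set J := ENNReal.ofReal q * ∫⁻ t in Set.Ioi (0 : ℝ),
    ENNReal.ofReal t ^ p * ψ t ^ (p / q) / ENNReal.ofReal t with hJ
  have hker : ∀ t : ℝ, 0 < t → ENNReal.ofReal t ^ p * ψ t ^ (p / q) / ENNReal.ofReal t =
      ENNReal.ofReal (t ^ (p - 1)) * ψ t ^ (p / q) := by
    intro t ht
    have h0 : ENNReal.ofReal t ≠ 0 := by positivity
    rw [ENNReal.mul_div_right_comm, ← ENNReal.ofReal_rpow_of_pos ht,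
      ENNReal.rpow_sub _ _ h0 ENNReal.ofReal_ne_top, ENNReal.rpow_one]
  have hJ' : J = ENNReal.ofReal q * ∫⁻ t in Set.Ioi (0 : ℝ),
      ENNReal.ofReal (t ^ (p - 1)) * ψ t ^ (p / q) := by
    rw [hJ, setLIntegral_congr_fun measurableSet_Ioi fun t ht => hker t ht]
  -- The weak norm is below the Lorentz norm: ψ is at least ψ(t) on (0, t], and q/p ≥ 1 leaves
  -- constant one.
  have hlower : ∀ t : ℝ, 0 < t → ENNReal.ofReal (t ^ p) * ψ t ^ (p / q) ≤ J := by
    intro t ht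
    calc ENNReal.ofReal (t ^ p) * ψ t ^ (p / q)
        ≤ ENNReal.ofReal (q * (t ^ p / p)) * ψ t ^ (p / q) := by
          gcongr
          rw [mul_div_left_comm]
          exact le_mul_of_one_le_right (by positivity) ((one_le_div hp).2 hpq)
      _ = ENNReal.ofReal q * ∫⁻ τ in Set.Ioc 0 t, ENNReal.ofReal (τ ^ (p - 1)) * ψ t ^ (p / q) := by
          rw [lintegral_mul_const _ (by fun_prop), lintegral_Ioc_rpow_sub_one hp ht.le,
            ENNReal.ofReal_mul hq.le, mul_assoc]
      _ ≤ ENNReal.ofReal q * ∫⁻ τ in Set.Ioc 0 t, ENNReal.ofReal (τ ^ (p - 1)) * ψ τ ^ (p / q) := by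
          gcongr ENNReal.ofReal q * ?_
          refine setLIntegral_mono' measurableSet_Ioc fun τ hτ => ?_
          gcongr
          exact hψanti hτ.2
      _ ≤ J := by
          rw [hJ']
          gcongr
          exact Set.Ioc_subset_Ioi_self
  have hlayer : (∫⁻ x in B, ‖h x‖ₑ ^ q * w x) / W =
      ENNReal.ofReal q * ∫⁻ t in Set.Ioi (0 : ℝ), ψ t * ENNReal.ofReal (t ^ (q - 1)) := by
    have h1 : ∫⁻ x in B, ‖h x‖ₑ ^ q * w x =
        ∫⁻ x, ENNReal.ofReal (|h x| ^ q) ∂((volume.restrict B).withDensity w) := by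
      rw [lintegral_withDensity_eq_lintegral_mul₀ hw.restrict]
      · refine lintegral_congr fun x => ?_
        rw [Pi.mul_apply, mul_comm, ← ENNReal.ofReal_rpow_of_nonneg (abs_nonneg _) hq.le,
          ← Real.enorm_eq_ofReal_abs]
      · fun_prop
    have habs : AEMeasurable (fun x => |h x|) (volume.restrict B) := by fun_prop
    rw [h1, lintegral_rpow_eq_lintegral_meas_lt_mul _ (Eventually.of_forall fun x => abs_nonneg _)
      (habs.mono_ac (withDensity_absolutelyContinuous _ _)) hq, div_eq_mul_inv, mul_assoc]
    congr 1
    have hanti : Antitone fun t : ℝ => (volume.restrict B).withDensity w {x | t < |h x|} :=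
      fun a b hab => measure_mono fun x hx => hab.trans_lt hx
    have hm : Measurable fun t : ℝ => (volume.restrict B).withDensity w {x | t < |h x|} *
        ENNReal.ofReal (t ^ (q - 1)) := hanti.measurable.mul (by fun_prop)
    rw [← lintegral_mul_const _ hm]
    refine lintegral_congr fun t => ?_
    rw [withDensity_apply', Measure.restrict_restrict₀ (nullMeasurableSet_lt (by fun_prop) habs),
      Set.inter_comm, mul_right_comm]
    rfl
  -- Write ψ t^(q-1) as t^(p-1) ψ^(p/q) times (t^p ψ^(p/q))^(q/p-1), and bound the last factor by
  -- the weak norm.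
  have hpow : (∫⁻ x in B, ‖h x‖ₑ ^ q * w x) / W ≤ J ^ (q / p) := by
    rw [hlayer]
    calc _ ≤ ENNReal.ofReal q * ∫⁻ t in Set.Ioi (0 : ℝ),
          ENNReal.ofReal (t ^ (p - 1)) * ψ t ^ (p / q) * J ^ (q / p - 1) := by
          gcongr ENNReal.ofReal q * ?_
          refine setLIntegral_mono' measurableSet_Ioi fun t ht => ?_
          have ht' : (0 : ℝ) < t := ht
          have e1 : ENNReal.ofReal (t ^ (q - 1)) =
              ENNReal.ofReal (t ^ (p - 1)) * ENNReal.ofReal (t ^ p) ^ (q / p - 1) := by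
            rw [ENNReal.ofReal_rpow_of_pos (by positivity), ← ENNReal.ofReal_mul (by positivity),
              ← Real.rpow_mul ht'.le, ← Real.rpow_add ht']
            congr 2; field_simp; ring
          have e2 : ψ t = ψ t ^ (p / q) * (ψ t ^ (p / q)) ^ (q / p - 1) := by
            have h1 : 0 ≤ q / p - 1 := sub_nonneg.2 ((one_le_div hp).2 hpq)
            rw [← ENNReal.rpow_mul, ← ENNReal.rpow_add_of_nonneg _ _ (by positivity)
              (by positivity)]
            have : p / q + p / q * (q / p - 1) = 1 := by field_simp; ring
            rw [this, ENNReal.rpow_one]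
          have h1 : 0 ≤ q / p - 1 := sub_nonneg.2 ((one_le_div hp).2 hpq)
          calc ψ t * ENNReal.ofReal (t ^ (q - 1))
              = ENNReal.ofReal (t ^ (p - 1)) * ψ t ^ (p / q) *
                (ENNReal.ofReal (t ^ p) * ψ t ^ (p / q)) ^ (q / p - 1) := by
                rw [ENNReal.mul_rpow_of_nonneg _ _ h1, e1]
                conv_lhs => rw [e2]
                ring
            _ ≤ _ := by gcongr; exact hlower t ht'
      _ = J * J ^ (q / p - 1) := by
          rw [lintegral_mul_const, ← mul_assoc, ← hJ']
          exact (by fun_prop : Measurable fun t : ℝ => ENNReal.ofReal (t ^ (p - 1))).mul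
            (hψanti.measurable.pow_const _)
      _ = J ^ (q / p) := by
          conv_lhs => enter [1]; rw [← ENNReal.rpow_one J]
          rw [← ENNReal.rpow_add_of_nonneg _ _ zero_le_one
            (sub_nonneg.2 ((one_le_div hp).2 hpq)), add_sub_cancel]
  calc weightedLpAvg q w B h ≤ (J ^ (q / p)) ^ (1 / q) := by
        unfold weightedLpAvg; gcongr
    _ = J ^ (1 / p) := by
        rw [← ENNReal.rpow_mul]; congr 1; field_simp
    _ = _ := rfl

theorem inv_sub_le_sobolevExponent (hn : 2 ≤ n) {s p : ℝ} (hs : 1 ≤ s) (hp : 1 ≤ p) (hpn : p < n) :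
    (1 / p - 1 / (n * s))⁻¹ ≤ sobolevExponent n p := by
  have hn0 : (0 : ℝ) < n := by linarith
  have h1 : sobolevExponent n p = (1 / p - 1 / n)⁻¹ := by
    have : (n : ℝ) - p ≠ 0 := by linarith
    rw [sobolevExponent, div_sub_div _ _ (by positivity) hn0.ne', inv_div]
    ring
  rw [h1]
  refine inv_anti₀ (sub_pos.2 (one_div_lt_one_div_of_lt (by linarith) hpn)) ?_
  gcongr
  nlinarith

/-- The self-improved pair bound is fed into the Lorentz inequality. The dimensional factor D' is at
least one, so D'^(1/p) ≤ D' and the constant does not depend on p; s ≥ 1 gives q ≤ p^*. -/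
theorem poincareSobolev_le (hn : 2 ≤ n) :
    ∃ c : ℝ, 0 < c ∧ ∀ p r : ℝ, 1 ≤ p → p < n → 1 ≤ r → r ≤ p →
      ∀ w : EuclideanSpace ℝ (Fin n) → ℝ≥0∞, IsApWeight r w →
      ∀ (x₀ : EuclideanSpace ℝ (Fin n)) (R : ℝ), 0 < R →
      ∀ (f : EuclideanSpace ℝ (Fin n) → ℝ)
        (G : EuclideanSpace ℝ (Fin n) → EuclideanSpace ℝ (Fin n)),
        IntegrableOn f (ball x₀ R) volume → HasWeakGradientOn (ball x₀ R) f G →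
        weightedLpAvg (weightedSobolevExponent p r w) w (ball x₀ R)
            (fun x => f x - ⨍ y in ball x₀ R, f y) ≤
          ENNReal.ofReal (c * sobolevExponent n p) * apConst r w ^ (1 / p) * ENNReal.ofReal R *
            weightedLpAvg p w (ball x₀ R) G ∧
        weightedLorentzAvg (weightedSobolevExponent p r w) p w (ball x₀ R)
            (fun x => f x - ⨍ y in ball x₀ R, f y) ≤
          ENNReal.ofReal (c * sobolevExponent n p) * apConst r w ^ (1 / p) * ENNReal.ofReal R *
            weightedLpAvg p w (ball x₀ R) G := by
  obtain ⟨C, hC1, hC⟩ := exists_weightedLorentzAvg_le hn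
  set D : ℝ := (2 * n) ^ n with hD
  have hn1 : (1 : ℝ) ≤ n := by exact_mod_cast (by omega : 1 ≤ n)
  have hD1 : 1 ≤ D := one_le_pow₀ (by linarith)
  set D' : ℝ := D * (2 * D) ^ n * D ^ n with hD'
  have hD'1 : 1 ≤ D' := by
    have h1 : 1 ≤ (2 * D) ^ n := one_le_pow₀ (by linarith)
    have h2 : 1 ≤ D ^ n := one_le_pow₀ hD1
    exact one_le_mul_of_one_le_of_one_le (one_le_mul_of_one_le_of_one_le hD1 h1) h2
  refine ⟨C * D', by positivity, ?_⟩
  intro p r hp hpn hr hrp w hw x₀ R hR f G hf hfG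
  obtain ⟨s, hs, hsr, hpair, hq⟩ := hw.exists_hasPairBound (by omega) hD hr (by linarith)
  obtain ⟨hpq, hqq⟩ := hq p hrp hpn
  have hp0 : 0 < p := by linarith
  have hK : ENNReal.ofReal D' * apConst r w ≠ ⊤ :=
    ENNReal.mul_ne_top ENNReal.ofReal_ne_top hw.apConst_lt_top.ne
  have h1 := hC hs (hsr.trans hrp) hpn hK hpair hw.aemeasurable
    (fun c R hR => hw.lintegral_ball_ne_zero hr c hR) (fun c R => (hw.lintegral_ball_lt_top c R).ne)
    x₀ R hR f G hf hfG
  have hLorentz : weightedLorentzAvg (weightedSobolevExponent p r w) p w (ball x₀ R)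
            (fun x => f x - ⨍ y in ball x₀ R, f y) ≤
          ENNReal.ofReal (C * D' * sobolevExponent n p) * apConst r w ^ (1 / p) *
            ENNReal.ofReal R * weightedLpAvg p w (ball x₀ R) G := by
    refine (weightedLorentzAvg_mono_exponent (by linarith) hqq hp0 _ _ _).trans (h1.trans ?_)
    gcongr ?_ * ENNReal.ofReal R * weightedLpAvg p w (ball x₀ R) G
    have h2 : ENNReal.ofReal D' ^ (1 / p) ≤ ENNReal.ofReal D' := by
      conv_rhs => rw [← ENNReal.rpow_one (ENNReal.ofReal D')]
      exact ENNReal.rpow_le_rpow_of_exponent_le (by simpa using hD'1) ((div_le_one hp0).2 hp)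
    have h3 := inv_sub_le_sobolevExponent hn hs hp hpn
    rw [ENNReal.mul_rpow_of_nonneg _ _ (by positivity), ← mul_assoc]
    gcongr
    calc _ ≤ ENNReal.ofReal (C * sobolevExponent n p) * ENNReal.ofReal D' := by gcongr
      _ = _ := by rw [← ENNReal.ofReal_mul' (by positivity)]; congr 1; ring
  refine ⟨le_trans ?_ hLorentz, hLorentz⟩
  exact weightedLpAvg_le_weightedLorentzAvg hp0 hpq hw.aemeasurable
    (hf.aestronglyMeasurable.aemeasurable.sub_const _)

end Embedding

/-! ### Power weights near the critical exponent -/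

section PowerWeight

open Filter Topology

variable {n : ℕ}

/-- A pointwise A_1 bound serves all r at once: on the ball w ≥ a/K with a its average, hence the
dual average to the power r − 1 is at most K/a. -/
theorem apConst_le_of_forall {r : ℝ} (hr : 1 ≤ r) {K : ℝ≥0∞}
    {w : EuclideanSpace ℝ (Fin n) → ℝ≥0∞}
    (h : ∀ (c : EuclideanSpace ℝ (Fin n)) (R : ℝ), ∀ x ∈ ball c R,
      ⨍⁻ y in ball c R, w y ∂volume ≤ K * w x) : apConst r w ≤ K := by
  rcases hr.eq_or_lt with rfl | hr1
  · rw [apConst, if_pos rfl]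
    refine essSup_le_of_ae_le _ (Eventually.of_forall fun x => ?_)
    exact ENNReal.div_le_of_le_mul (iSup_le fun c => iSup_le fun R => iSup_le fun hx => h c R x hx)
  · rw [apConst, if_neg hr1.ne']
    refine iSup_le fun c => iSup_le fun R => iSup_le fun hR => ?_
    set a := ⨍⁻ y in ball c R, w y ∂volume with ha
    have hr0 : 0 < r - 1 := by linarith
    have h1 : ⨍⁻ y in ball c R, w y ^ (1 - Real.conjExponent r) ∂volume ≤
        (a / K) ^ (-(1 / (r - 1))) := by
      rw [one_sub_conjExponent hr1]
      calc _ ≤ ⨍⁻ y in ball c R, (a / K) ^ (-(1 / (r - 1))) ∂volume := by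
            rw [setLAverage_eq, setLAverage_eq]
            gcongr ?_ / _
            refine setLIntegral_mono' measurableSet_ball fun x hx => ?_
            rw [ENNReal.rpow_neg, ENNReal.rpow_neg, ENNReal.inv_le_inv]
            gcongr
            exact ENNReal.div_le_of_le_mul' (h c R x hx)
        _ = _ := setLAverage_const (volume_ball_ne_zero _ hR) (volume_ball_ne_top _ _) _
    calc _ ≤ a * ((a / K) ^ (-(1 / (r - 1)))) ^ (r - 1) := by gcongr
      _ = a * (a / K)⁻¹ := by
          rw [← ENNReal.rpow_mul, neg_mul, one_div_mul_cancel hr0.ne', ENNReal.rpow_neg_one]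
      _ ≤ K := by
          rcases eq_or_ne a 0 with h0 | h0
          · simp [h0]
          rcases eq_or_ne K ⊤ with hK | hK
          · simp [hK]
          rw [ENNReal.inv_div (Or.inl hK) (Or.inr h0)]
          exact ENNReal.mul_div_le

/-- If the ball is small compared with ‖x‖, the weight is almost constant on it. Otherwise the ball
lies in the one of radius 6R about the origin, whose mass carries the factor 1/δ. -/
theorem laverage_ball_enorm_rpow_le (hn : 1 ≤ n) {δ : ℝ} (hδ : 0 < δ) (hδ1 : δ < 1)
    (c : EuclideanSpace ℝ (Fin n)) (R : ℝ) {x : EuclideanSpace ℝ (Fin n)} (hx : x ∈ ball c R) :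
    ⨍⁻ y in ball c R, ‖y‖ₑ ^ (δ - n) ∂volume ≤
      ENNReal.ofReal (6 * n * 4 ^ n / δ) * ‖x‖ₑ ^ (δ - n) := by
  have hne : Nonempty (Fin n) := ⟨⟨0, by omega⟩⟩
  have hn' : (1 : ℝ) ≤ n := by exact_mod_cast hn
  have hR : 0 < R := pos_of_mem_ball hx
  have hexp : δ - n < 0 := by linarith
  have hconst : 1 ≤ 6 * n * 4 ^ n / δ := by
    rw [one_le_div hδ]
    have : (1 : ℝ) ≤ 4 ^ n := one_le_pow₀ (by norm_num)
    nlinarith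
  rcases eq_or_ne x 0 with rfl | hx0
  · rw [enorm_zero, ENNReal.zero_rpow_of_neg hexp, ENNReal.mul_top]
    · exact le_top
    · have : 0 < 6 * n * 4 ^ n / δ := by linarith
      positivity
  have ht : 0 < ‖x‖ := norm_pos_iff.2 hx0
  have hpow : ∀ {a : ℝ}, 1 ≤ a → ENNReal.ofReal ((‖x‖ / a) ^ (δ - n)) ≤
      ENNReal.ofReal (a ^ n) * ‖x‖ₑ ^ (δ - n) := by
    intro a ha
    have ha0 : 0 < a := by linarith
    rw [← ofReal_norm, ENNReal.ofReal_rpow_of_pos ht, ← ENNReal.ofReal_mul (by positivity)]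
    refine ENNReal.ofReal_le_ofReal ?_
    rw [Real.div_rpow ht.le ha0.le, div_eq_mul_inv, mul_comm, ← Real.rpow_neg ha0.le]
    gcongr
    rw [← Real.rpow_natCast]
    exact Real.rpow_le_rpow_of_exponent_le ha (by linarith)
  have hmono : ∀ {a b : ℝ}, 0 < a → a ≤ b → b ^ (δ - n) ≤ a ^ (δ - n) := fun ha hab =>
    Real.rpow_le_rpow_of_nonpos ha hab hexp.le
  rw [mem_ball] at hx
  rcases le_or_gt R (‖x‖ / 4) with hle | hgt
  · have hy : ∀ y ∈ ball c R, ‖y‖ₑ ^ (δ - n) ≤ ENNReal.ofReal (2 ^ n) * ‖x‖ₑ ^ (δ - n) := by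
      intro y hy
      rw [mem_ball] at hy
      have h1 : ‖x‖ / 2 ≤ ‖y‖ := by
        have h2 : ‖x - y‖ < R + R := by
          rw [← dist_eq_norm]
          exact (dist_triangle_right x y c).trans_lt (add_lt_add hx hy)
        have h3 := norm_sub_norm_le x y
        linarith
      refine le_trans ?_ (hpow one_le_two)
      rw [← ofReal_norm, ENNReal.ofReal_rpow_of_pos (by linarith)]
      exact ENNReal.ofReal_le_ofReal (hmono (by positivity) h1)
    calc _ ≤ ⨍⁻ _ in ball c R, ENNReal.ofReal (2 ^ n) * ‖x‖ₑ ^ (δ - n) ∂volume := by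
          rw [setLAverage_eq, setLAverage_eq]
          gcongr ?_ / _
          exact setLIntegral_mono' measurableSet_ball hy
      _ = ENNReal.ofReal (2 ^ n) * ‖x‖ₑ ^ (δ - n) :=
          setLAverage_const (volume_ball_ne_zero _ hR) (volume_ball_ne_top _ _) _
      _ ≤ _ := by
          gcongr
          rw [le_div_iff₀ hδ]
          have h1 : (2 : ℝ) ^ n ≤ 4 ^ n := by gcongr; norm_num
          have h2 : (0 : ℝ) < 2 ^ n := by positivity
          nlinarith
  · have hsub : ball c R ⊆ ball 0 (6 * R) := by
      refine ball_subset_ball' ?_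
      have h1 := dist_triangle c x 0
      rw [dist_comm c x, dist_zero_right x] at h1
      linarith
    have hint := lintegral_ball_zero_enorm_rpow
      (volume : Measure (EuclideanSpace ℝ (Fin n))) hδ (by positivity : 0 < 6 * R)
    rw [finrank_euclideanSpace_fin] at hint
    have hv := volume_ball_eq_mul (0 : EuclideanSpace ℝ (Fin n)) c one_pos hR
    rw [div_one] at hv
    set v := volume (ball (0 : EuclideanSpace ℝ (Fin n)) 1)
    have hv0 : v ≠ 0 := volume_ball_ne_zero _ one_pos
    have hvt : v ≠ ⊤ := volume_ball_ne_top _ _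
    calc _ ≤ (ENNReal.ofReal (n * (6 * R) ^ δ / δ) * v) / (ENNReal.ofReal (R ^ n) * v) := by
          rw [setLAverage_eq, ← hv, ← hint]
          gcongr
      _ = ENNReal.ofReal (n * (6 * R) ^ δ / δ / R ^ n) := by
          rw [ENNReal.mul_div_mul_right _ _ hv0 hvt, ← ENNReal.ofReal_div_of_pos (by positivity)]
      _ ≤ ENNReal.ofReal (6 * n / δ * (‖x‖ / 4) ^ (δ - n)) := by
          refine ENNReal.ofReal_le_ofReal ?_
          have h1 : (6 : ℝ) ^ δ ≤ 6 := by
            conv_rhs => rw [← Real.rpow_one 6]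
            exact Real.rpow_le_rpow_of_exponent_le (by norm_num) hδ1.le
          calc n * (6 * R) ^ δ / δ / R ^ n = 6 ^ δ * n / δ * R ^ (δ - n) := by
                rw [Real.mul_rpow (by norm_num) hR.le, Real.rpow_sub hR, Real.rpow_natCast]
                ring
            _ ≤ _ := by
                refine mul_le_mul ?_ (hmono (by positivity) hgt.le) (by positivity) (by positivity)
                gcongr
      _ ≤ ENNReal.ofReal (6 * n / δ) * (ENNReal.ofReal (4 ^ n) * ‖x‖ₑ ^ (δ - n)) := by
          rw [ENNReal.ofReal_mul (by positivity)]
          gcongr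
          exact hpow (by norm_num)
      _ = _ := by
          rw [← mul_assoc, ← ENNReal.ofReal_mul (by positivity)]
          congr 2; ring

theorem lintegral_ball_zero_enorm_rpow_sub (hn : 1 ≤ n) {δ R : ℝ} (hδ : 0 < δ) (hR : 0 < R) :
    ∫⁻ y in ball (0 : EuclideanSpace ℝ (Fin n)) R, ‖y‖ₑ ^ (δ - n) =
      ENNReal.ofReal (n * R ^ δ / δ) * volume (ball (0 : EuclideanSpace ℝ (Fin n)) 1) := by
  have hne : Nonempty (Fin n) := ⟨⟨0, by omega⟩⟩
  have hint := lintegral_ball_zero_enorm_rpow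
    (volume : Measure (EuclideanSpace ℝ (Fin n))) hδ hR
  rwa [finrank_euclideanSpace_fin] at hint

/-- Power weights with exponent close to `-n` are `A_r` weights with explicit constants. -/
theorem isApWeight_enorm_rpow (hn : 1 ≤ n) {δ r : ℝ} (hδ : 0 < δ) (hδ1 : δ < 1) (hr : 1 ≤ r) :
    IsApWeight r (fun x : EuclideanSpace ℝ (Fin n) => ‖x‖ₑ ^ (δ - n)) ∧
      apConst r (fun x : EuclideanSpace ℝ (Fin n) => ‖x‖ₑ ^ (δ - n)) ≤
        ENNReal.ofReal (6 * n * 4 ^ n / δ) := by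
  have hne : Nonempty (Fin n) := ⟨⟨0, by omega⟩⟩
  have hK := apConst_le_of_forall hr fun c R x hx =>
    laverage_ball_enorm_rpow_le hn hδ hδ1 c R hx
  have hint : ∀ {R : ℝ}, 0 < R → _ := fun hR => lintegral_ball_zero_enorm_rpow_sub hn hδ hR
  refine ⟨⟨by fun_prop, fun c R => ?_, fun h => ?_, hK.trans_lt ENNReal.ofReal_lt_top⟩, hK⟩
  · have hsub : ball c R ⊆ ball 0 (|R| + ‖c‖ + 1) := by
      refine ball_subset_ball' ?_
      rw [dist_zero_right]
      linarith [le_abs_self R]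
    refine (lintegral_mono_set hsub).trans_lt ?_
    rw [hint (by positivity)]
    exact ENNReal.mul_lt_top ENNReal.ofReal_lt_top measure_ball_lt_top
  · have h1 := hint one_pos
    rw [lintegral_congr_ae (ae_restrict_of_ae h)] at h1
    simp only [Pi.zero_apply, lintegral_zero] at h1
    have h2 : 0 < n * (1 : ℝ) ^ δ / δ := by
      have : (0 : ℝ) < n := by exact_mod_cast hn
      positivity
    have h3 : ENNReal.ofReal (n * (1 : ℝ) ^ δ / δ) ≠ 0 := by positivity
    exact mul_ne_zero h3 (volume_ball_ne_zero _ one_pos) h1.symm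

theorem hasWeakGradientOn_gradient {f : EuclideanSpace ℝ (Fin n) → ℝ} (hf : ContDiff ℝ ∞ f)
    (U : Set (EuclideanSpace ℝ (Fin n))) : HasWeakGradientOn U f (gradient f) := by
  have hc : Continuous (gradient f) :=
    (InnerProductSpace.toDual ℝ (EuclideanSpace ℝ (Fin n))).symm.continuous.comp
      (hf.continuous_fderiv (by simp))
  have hinner : ∀ x v, inner ℝ (gradient f x) v = fderiv ℝ f x v := fun x v => by
    rw [gradient, InnerProductSpace.toDual_symm_apply]
  refine ⟨hf.continuous.locallyIntegrable.locallyIntegrableOn U,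
    hc.locallyIntegrable.locallyIntegrableOn U, fun φ hφ hφc hφU v => ?_⟩
  have hφ0 : ∀ x, x ∉ U → φ x = 0 := fun x hx =>
    image_eq_zero_of_notMem_tsupport fun h => hx (hφU h)
  have hφ0' : ∀ x, x ∉ U → fderiv ℝ φ x = 0 := fun x hx =>
    Function.notMem_support.1 fun h => hx (hφU (support_fderiv_subset ℝ h))
  have hdφ : HasCompactSupport fun x => fderiv ℝ φ x v := hφc.fderiv_apply ℝ v
  have hcf := hf.continuous
  have hcφ := hφ.continuous
  have hcdf : Continuous fun x => fderiv ℝ f x v :=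
    (hf.continuous_fderiv (by simp)).clm_apply continuous_const
  have hcdφ : Continuous fun x => fderiv ℝ φ x v :=
    (hφ.continuous_fderiv (by simp)).clm_apply continuous_const
  rw [setIntegral_eq_integral_of_forall_compl_eq_zero (fun x hx => by simp [hφ0' x hx]),
    setIntegral_eq_integral_of_forall_compl_eq_zero (fun x hx => by simp [hφ0 x hx])]
  simp_rw [hinner]
  refine integral_mul_fderiv_eq_neg_fderiv_mul_of_integrable ?_ ?_ ?_
    (fun x _ => hf.differentiable (by simp) x) (fun x _ => hφ.differentiable (by simp) x)
  · exact (hcdf.mul hcφ).integrable_of_hasCompactSupport hφc.mul_left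
  · exact (hcf.mul hcdφ).integrable_of_hasCompactSupport hdφ.mul_left
  · exact (hcf.mul hcφ).integrable_of_hasCompactSupport hφc.mul_left

end PowerWeight

/-! ### Sharpness of the exponent -/

section Sharpness

open Filter Topology

variable {n : ℕ}

/-- The average of a bump function supported in the ball of radius `1 / 2`. -/
theorem average_le_quarter (hn : 2 ≤ n) {f : EuclideanSpace ℝ (Fin n) → ℝ} (hf : Continuous f)
    (h1 : ∀ x, f x ≤ 1) (hs : ∀ x, 1 / 2 ≤ ‖x‖ → f x = 0) :
    ⨍ y in ball (0 : EuclideanSpace ℝ (Fin n)) 1, f y ≤ 1 / 4 := by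
  set v := volume.real (ball (0 : EuclideanSpace ℝ (Fin n)) 1) with hv
  have hv0 : 0 < v :=
    ENNReal.toReal_pos (volume_ball_ne_zero _ one_pos) (volume_ball_ne_top _ _)
  have hvol : volume.real (ball (0 : EuclideanSpace ℝ (Fin n)) (1 / 2)) = (1 / 2) ^ n * v := by
    have := volume_ball_eq_mul (0 : EuclideanSpace ℝ (Fin n)) 0 one_pos (one_half_pos (α := ℝ))
    rw [hv, Measure.real, Measure.real, this, ENNReal.toReal_mul,
      ENNReal.toReal_ofReal (by positivity), div_one]
  have hle : ∫ y in ball (0 : EuclideanSpace ℝ (Fin n)) 1, f y ≤ (1 / 2) ^ n * v := by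
    calc _ ≤ ∫ y in ball (0 : EuclideanSpace ℝ (Fin n)) 1,
          (ball (0 : EuclideanSpace ℝ (Fin n)) (1 / 2)).indicator (fun _ => (1 : ℝ)) y := by
          refine integral_mono ?_ ?_ fun x => ?_
          · exact (hf.continuousOn.integrableOn_compact (isCompact_closedBall 0 1)).mono_set
              ball_subset_closedBall
          · exact ((integrable_indicator_iff measurableSet_ball).2
              (integrableOn_const measure_ball_lt_top.ne)).integrableOn
          · by_cases hx : x ∈ ball (0 : EuclideanSpace ℝ (Fin n)) (1 / 2)
            · rw [Set.indicator_of_mem hx]; exact h1 x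
            · rw [Set.indicator_of_notMem hx, hs x (by simpa using hx)]
      _ = _ := by
          rw [setIntegral_indicator measurableSet_ball, Set.inter_eq_right.2
            (ball_subset_ball (by norm_num)), setIntegral_const, hvol, smul_eq_mul, mul_one]
  rw [setAverage_eq, smul_eq_mul, inv_mul_le_iff₀ hv0]
  refine hle.trans ?_
  rw [mul_comm]
  gcongr
  calc ((1 : ℝ) / 2) ^ n ≤ (1 / 2) ^ 2 := pow_le_pow_of_le_one (by norm_num) (by norm_num) hn
    _ = 1 / 4 := by norm_num

/-- A smooth function for which the weighted Poincaré inequality degenerates along the power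
weights `‖x‖ ^ (δ - n)` as `δ → 0`. -/
theorem exists_test_function (hn : 2 ≤ n) : ∃ M : ℝ, 0 < M ∧
    ∃ f : EuclideanSpace ℝ (Fin n) → ℝ, ContDiff ℝ ∞ f ∧ ∀ δ : ℝ, 0 < δ → δ < 1 → ∀ p q : ℝ,
      1 ≤ p → 1 ≤ q →
      ENNReal.ofReal (3 / 16) ≤ weightedLpAvg q (fun x => ‖x‖ₑ ^ (δ - n)) (ball 0 1)
        (fun x => f x - ⨍ y in ball 0 1, f y) ∧
      weightedLpAvg p (fun x => ‖x‖ₑ ^ (δ - n)) (ball 0 1) (gradient f) ≤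
        ENNReal.ofReal (M * δ ^ (1 / p)) := by
  have hn1 : (1 : ℝ) ≤ n := by exact_mod_cast (by omega : 1 ≤ n)
  -- Equal to 1 on the ball of radius 1/4 and supported in radius 1/2, so its mean is at most 1/4
  -- and the gradient stays away from the singularity.
  let b : ContDiffBump (0 : EuclideanSpace ℝ (Fin n)) :=
    ⟨1 / 4, 1 / 2, by norm_num, by norm_num⟩
  have hb : ContDiff ℝ ∞ b := b.contDiff
  have hav := average_le_quarter hn b.continuous (fun x => b.le_one)
    fun x hx => b.zero_of_le_dist (by rw [dist_zero_right]; exact hx)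
  have hgc : Continuous (gradient b) :=
    (InnerProductSpace.toDual ℝ (EuclideanSpace ℝ (Fin n))).symm.continuous.comp
      (hb.continuous_fderiv (by simp))
  obtain ⟨M, hM⟩ := (isCompact_closedBall (0 : EuclideanSpace ℝ (Fin n)) 1).exists_bound_of_continuousOn
    hgc.continuousOn
  have hM0 : 0 ≤ M := (norm_nonneg _).trans (hM 0 (by simp))
  have hgz : ∀ x ∈ ball (0 : EuclideanSpace ℝ (Fin n)) (1 / 4), gradient b x = 0 := by
    intro x hx
    have h1 : fderiv ℝ b x = 0 := by
      rw [(b.eventuallyEq_one_of_mem_ball hx).fderiv_eq]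
      exact fderiv_const_apply (1 : ℝ)
    rw [gradient, h1, map_zero]
  refine ⟨(M + 1) * 4 ^ n, by positivity, b, hb, fun δ hδ hδ1 p q hp hq => ?_⟩
  have hint : ∀ {R : ℝ}, 0 < R → _ :=
    fun hR => lintegral_ball_zero_enorm_rpow_sub (n := n) (by omega) hδ hR
  set v := volume (ball (0 : EuclideanSpace ℝ (Fin n)) 1)
  have hv0 : v ≠ 0 := volume_ball_ne_zero _ one_pos
  have hvt : v ≠ ⊤ := volume_ball_ne_top _ _
  have hp0 : 0 < p := by linarith
  have hq0 : 0 < q := by linarith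
  set W := ∫⁻ y in ball (0 : EuclideanSpace ℝ (Fin n)) 1, ‖y‖ₑ ^ (δ - n) with hW
  have hWe : W = ENNReal.ofReal (n / δ) * v := by
    rw [hW, hint one_pos, Real.one_rpow, mul_one]
  have hW0 : W ≠ 0 := by
    rw [hWe]
    have : ENNReal.ofReal (n / δ) ≠ 0 := by positivity
    exact mul_ne_zero this hv0
  have hWt : W ≠ ⊤ := by rw [hWe]; exact ENNReal.mul_ne_top ENNReal.ofReal_ne_top hvt
  constructor
  -- Near the origin the deviation is at least 3/4, and the ball of radius 1/4 carries the fraction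
  -- (1/4)^δ ≥ 1/4 of the weight.
  · have h1 : ENNReal.ofReal (3 / 4) ^ q * ENNReal.ofReal (1 / 4) ≤
        (∫⁻ x in ball (0 : EuclideanSpace ℝ (Fin n)) 1,
          ‖b x - ⨍ y in ball 0 1, b y‖ₑ ^ q * ‖x‖ₑ ^ (δ - n)) / W := by
      rw [ENNReal.le_div_iff_mul_le (Or.inl hW0) (Or.inl hWt)]
      calc _ ≤ ENNReal.ofReal (3 / 4) ^ q * ∫⁻ x in ball (0 : EuclideanSpace ℝ (Fin n)) (1 / 4),
            ‖x‖ₑ ^ (δ - n) := by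
            rw [mul_assoc, hint (by norm_num : (0 : ℝ) < 1 / 4), hWe,
              ← mul_assoc (ENNReal.ofReal (1 / 4)),
              ← ENNReal.ofReal_mul (by norm_num)]
            gcongr
            rw [mul_div_assoc', mul_comm]
            gcongr
            conv_lhs => rw [← Real.rpow_one (1 / 4)]
            exact Real.rpow_le_rpow_of_exponent_ge (by norm_num) (by norm_num) hδ1.le
        _ = ∫⁻ x in ball (0 : EuclideanSpace ℝ (Fin n)) (1 / 4),
            ENNReal.ofReal (3 / 4) ^ q * ‖x‖ₑ ^ (δ - n) := by
            rw [lintegral_const_mul _ (by fun_prop)]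
        _ ≤ ∫⁻ x in ball (0 : EuclideanSpace ℝ (Fin n)) (1 / 4),
            ‖b x - ⨍ y in ball 0 1, b y‖ₑ ^ q * ‖x‖ₑ ^ (δ - n) := by
            refine setLIntegral_mono' measurableSet_ball fun x hx => ?_
            gcongr
            rw [b.one_of_mem_closedBall (ball_subset_closedBall hx),
              Real.enorm_eq_ofReal (by linarith)]
            exact ENNReal.ofReal_le_ofReal (by linarith)
        _ ≤ _ := lintegral_mono_set (ball_subset_ball (by norm_num))
    calc ENNReal.ofReal (3 / 16) = ENNReal.ofReal (3 / 4) * ENNReal.ofReal (1 / 4) := by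
          rw [← ENNReal.ofReal_mul (by norm_num)]; norm_num
      _ ≤ ENNReal.ofReal (3 / 4) * ENNReal.ofReal (1 / 4) ^ (1 / q) := by
          gcongr
          conv_lhs => rw [← ENNReal.rpow_one (ENNReal.ofReal (1 / 4))]
          exact ENNReal.rpow_le_rpow_of_exponent_ge (ENNReal.ofReal_le_one.2 (by norm_num))
            ((div_le_one hq0).2 hq)
      _ = (ENNReal.ofReal (3 / 4) ^ q * ENNReal.ofReal (1 / 4)) ^ (1 / q) := by
          rw [ENNReal.mul_rpow_of_nonneg _ _ (by positivity), ← ENNReal.rpow_mul,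
            mul_one_div_cancel hq0.ne', ENNReal.rpow_one]
      _ ≤ _ := by unfold weightedLpAvg; gcongr
  -- On the support of the gradient the weight is at most 4^n, while the total mass is of order 1/δ;
  -- the average is therefore of order δ.
  · have h1 : (∫⁻ x in ball (0 : EuclideanSpace ℝ (Fin n)) 1,
          ‖gradient b x‖ₑ ^ p * ‖x‖ₑ ^ (δ - n)) / W ≤
        ENNReal.ofReal ((M + 1) ^ p * 4 ^ n * δ) := by
      rw [ENNReal.div_le_iff hW0 hWt]
      calc _ ≤ ∫⁻ x in ball (0 : EuclideanSpace ℝ (Fin n)) 1,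
            ENNReal.ofReal ((M + 1) ^ p * 4 ^ n) := by
            refine setLIntegral_mono' measurableSet_ball fun x hx => ?_
            by_cases hx4 : x ∈ ball (0 : EuclideanSpace ℝ (Fin n)) (1 / 4)
            · rw [hgz x hx4, enorm_zero, ENNReal.zero_rpow_of_pos hp0, zero_mul]
              exact zero_le
            · have hx' : 1 / 4 ≤ ‖x‖ := by simpa using hx4
              have hx0 : 0 < ‖x‖ := by linarith
              rw [ENNReal.ofReal_mul (by positivity), ← ofReal_norm, ← ofReal_norm,
                ENNReal.ofReal_rpow_of_nonneg (norm_nonneg _) hp0.le,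
                ENNReal.ofReal_rpow_of_pos hx0]
              gcongr
              · exact (hM x (ball_subset_closedBall hx)).trans (by linarith)
              · calc ‖x‖ ^ (δ - n) ≤ (1 / 4) ^ (δ - n) :=
                      Real.rpow_le_rpow_of_nonpos (by norm_num) hx' (by linarith)
                  _ = 4 ^ (n - δ) := by
                      rw [one_div, Real.inv_rpow (by norm_num), ← Real.rpow_neg (by norm_num), neg_sub]
                  _ ≤ 4 ^ (n : ℝ) := by
                      exact Real.rpow_le_rpow_of_exponent_le (by norm_num) (by linarith)
                  _ = _ := Real.rpow_natCast _ _
        _ = ENNReal.ofReal ((M + 1) ^ p * 4 ^ n) * v := setLIntegral_const _ _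
        _ ≤ _ := by
            rw [hWe, ← mul_assoc, ← ENNReal.ofReal_mul (by positivity)]
            gcongr ENNReal.ofReal ?_ * _
            have : (M + 1) ^ p * 4 ^ n * δ * (n / δ) = (M + 1) ^ p * 4 ^ n * n := by field_simp
            rw [this]
            exact le_mul_of_one_le_right (by positivity) hn1
    calc weightedLpAvg p (fun x => ‖x‖ₑ ^ (δ - n)) (ball 0 1) (gradient b)
        ≤ ENNReal.ofReal ((M + 1) ^ p * 4 ^ n * δ) ^ (1 / p) := by
          unfold weightedLpAvg; gcongr
      _ = ENNReal.ofReal ((M + 1) * (4 ^ n) ^ (1 / p) * δ ^ (1 / p)) := by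
          rw [ENNReal.ofReal_rpow_of_pos (by positivity), Real.mul_rpow (by positivity) hδ.le,
            Real.mul_rpow (by positivity) (by positivity), ← Real.rpow_mul (by positivity),
            mul_one_div_cancel hp0.ne', Real.rpow_one]
      _ ≤ _ := by
          gcongr
          conv_rhs => rw [← Real.rpow_one (4 ^ n)]
          exact Real.rpow_le_rpow_of_exponent_le (one_le_pow₀ (by norm_num))
            ((div_le_one hp0).2 hp)

/-- Testing with the bump and the weights ‖x‖^(δ-n) gives 3/16 ≤ const · δ^(1/p-γ) for γ = max(β,
0), which fails as δ → 0 if β < 1/p. -/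
theorem one_div_le_of_forall_poincareSobolev_le (hn : 2 ≤ n) {p r β C : ℝ} (hp : 1 ≤ p)
    (hpn : p < n) (hr : 1 ≤ r) (hrp : r ≤ p)
    (h : ∀ w : EuclideanSpace ℝ (Fin n) → ℝ≥0∞, IsApWeight r w →
        ∀ (x₀ : EuclideanSpace ℝ (Fin n)) (R : ℝ), 0 < R →
        ∀ (f : EuclideanSpace ℝ (Fin n) → ℝ)
          (G : EuclideanSpace ℝ (Fin n) → EuclideanSpace ℝ (Fin n)),
          IntegrableOn f (ball x₀ R) volume → HasWeakGradientOn (ball x₀ R) f G →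
          weightedLpAvg (weightedSobolevExponent p r w) w (ball x₀ R)
              (fun x => f x - ⨍ y in ball x₀ R, f y) ≤
            ENNReal.ofReal C * apConst r w ^ β * ENNReal.ofReal R *
              weightedLpAvg p w (ball x₀ R) G) :
    1 / p ≤ β := by
  by_contra! hβ
  have hp0 : 0 < p := by linarith
  have hn1 : (1 : ℝ) ≤ n := by exact_mod_cast (by omega : 1 ≤ n)
  obtain ⟨M, hM0, f, hf, hfM⟩ := exists_test_function hn
  set D : ℝ := (2 * n) ^ n with hD
  have hD0 : 0 < D := by positivity
  set D' : ℝ := D * (2 * D) ^ n * D ^ n with hD'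
  have hD'0 : 0 < D' := by positivity
  set A : ℝ := 6 * n * 4 ^ n with hA
  have hA0 : 0 < A := by positivity
  -- For β ≥ 0 the upper bound A/δ on the A_r constant is used; for β < 0 its power is controlled by
  -- the lower bound 1/D', so there δ enters with exponent zero.
  set γ := max β 0 with hγ
  have hγp : γ < 1 / p := max_lt hβ (by positivity)
  set E : ℝ := max (A ^ β) (D' ^ (-β)) with hE
  have hE0 : 0 < E := lt_max_of_lt_left (by positivity)
  have key : ∀ δ : ℝ, 0 < δ → δ < 1 → 3 / 16 ≤ |C| * E * M * δ ^ (1 / p - γ) := by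
    intro δ hδ hδ1
    obtain ⟨hw, hwA⟩ := isApWeight_enorm_rpow (n := n) (by omega) hδ hδ1 hr
    set w : EuclideanSpace ℝ (Fin n) → ℝ≥0∞ := fun x => ‖x‖ₑ ^ (δ - n) with hwd
    obtain ⟨s, hs, hsr, hpair, hq⟩ := hw.exists_hasPairBound (by omega) hD hr (by linarith)
    have hq1 : 1 ≤ weightedSobolevExponent p r w := hp.trans (hq p hrp hpn).1
    obtain ⟨h1, h2⟩ := hfM δ hδ hδ1 p _ hp hq1
    have hlow : 1 ≤ ENNReal.ofReal D' * apConst r w :=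
      hpair.one_le (hw.lintegral_ball_ne_zero hr 0 one_pos) (hw.lintegral_ball_lt_top 0 1).ne
    have hconst : apConst r w ^ β ≤ ENNReal.ofReal (E * δ ^ (-γ)) := by
      rcases le_total 0 β with hb | hb
      · have hγβ : γ = β := max_eq_left hb
        calc apConst r w ^ β ≤ ENNReal.ofReal (A / δ) ^ β := by gcongr
          _ = ENNReal.ofReal (A ^ β * δ ^ (-β)) := by
              rw [ENNReal.ofReal_rpow_of_pos (by positivity), Real.div_rpow hA0.le hδ.le,
                Real.rpow_neg hδ.le, div_eq_mul_inv]
          _ ≤ _ := by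
              rw [hγβ]
              gcongr
              exact le_max_left _ _
      · have hγ0 : γ = 0 := max_eq_right hb
        have h3 : (ENNReal.ofReal D')⁻¹ ≤ apConst r w := by
          rw [← one_div]
          exact ENNReal.div_le_of_le_mul' hlow
        calc apConst r w ^ β = (apConst r w ^ (-β))⁻¹ := by rw [ENNReal.rpow_neg, inv_inv]
          _ ≤ ((ENNReal.ofReal D')⁻¹ ^ (-β))⁻¹ := by
              rw [ENNReal.inv_le_inv]
              exact ENNReal.rpow_le_rpow h3 (by linarith)
          _ = ENNReal.ofReal (D' ^ (-β)) := by
              rw [ENNReal.inv_rpow, inv_inv, ENNReal.ofReal_rpow_of_pos hD'0]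
          _ ≤ _ := by
              rw [hγ0, neg_zero, Real.rpow_zero, mul_one]
              exact ENNReal.ofReal_le_ofReal (le_max_right _ _)
    have h4 := h w hw 0 1 one_pos f (gradient f)
      ((hf.continuous.continuousOn.integrableOn_compact (isCompact_closedBall 0 1)).mono_set
        ball_subset_closedBall) (hasWeakGradientOn_gradient hf _)
    have h5 : ENNReal.ofReal (3 / 16) ≤
        ENNReal.ofReal (|C| * E * M * δ ^ (1 / p - γ)) := by
      calc _ ≤ _ := h1.trans h4
        _ ≤ ENNReal.ofReal |C| * ENNReal.ofReal (E * δ ^ (-γ)) * ENNReal.ofReal 1 *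
            ENNReal.ofReal (M * δ ^ (1 / p)) := by
            gcongr
            exact le_abs_self C
        _ = _ := by
            rw [ENNReal.ofReal_one, mul_one, ← ENNReal.ofReal_mul (by positivity),
              ← ENNReal.ofReal_mul (by positivity), sub_eq_add_neg, Real.rpow_add hδ]
            congr 1; ring
    exact (ENNReal.ofReal_le_ofReal_iff (by positivity)).1 h5
  have hlim : Tendsto (fun δ : ℝ => |C| * E * M * δ ^ (1 / p - γ)) (𝓝[>] 0) (𝓝 0) := by
    have h1 : Tendsto (fun δ : ℝ => δ ^ (1 / p - γ)) (𝓝[>] 0) (𝓝 0) := by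
      have h2 := (Real.continuousAt_rpow_const 0 (1 / p - γ) (Or.inr (by linarith))).tendsto
      rw [Real.zero_rpow (by linarith)] at h2
      exact h2.mono_left nhdsWithin_le_nhds
    simpa using h1.const_mul (|C| * E * M)
  have := ge_of_tendsto hlim (b := 3 / 16) (by
    filter_upwards [Ioo_mem_nhdsGT (one_pos (α := ℝ))] with δ hδ using key δ hδ.1 hδ.2)
  linarith

end Sharpness

end PoincareSobolev

theorem mainTheorem1 (n : ℕ) (hn : 2 ≤ n) :
    (∃ c : ℝ, 0 < c ∧ ∀ p r : ℝ, 1 ≤ p → p < n → 1 ≤ r → r ≤ p →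
      ∀ w : EuclideanSpace ℝ (Fin n) → ℝ≥0∞, PoincareSobolev.IsApWeight r w →
      ∀ (x₀ : EuclideanSpace ℝ (Fin n)) (R : ℝ), 0 < R →
      ∀ (f : EuclideanSpace ℝ (Fin n) → ℝ)
        (G : EuclideanSpace ℝ (Fin n) → EuclideanSpace ℝ (Fin n)),
        IntegrableOn f (ball x₀ R) volume →
        PoincareSobolev.HasWeakGradientOn (ball x₀ R) f G →
        PoincareSobolev.weightedLpAvg (PoincareSobolev.weightedSobolevExponent p r w) w
            (ball x₀ R) (fun x => f x - ⨍ y in ball x₀ R, f y) ≤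
          ENNReal.ofReal (c * PoincareSobolev.sobolevExponent n p) *
            PoincareSobolev.apConst r w ^ (1 / p) * ENNReal.ofReal R *
            PoincareSobolev.weightedLpAvg p w (ball x₀ R) G ∧
        PoincareSobolev.weightedLorentzAvg (PoincareSobolev.weightedSobolevExponent p r w) p w
            (ball x₀ R) (fun x => f x - ⨍ y in ball x₀ R, f y) ≤
          ENNReal.ofReal (c * PoincareSobolev.sobolevExponent n p) *
            PoincareSobolev.apConst r w ^ (1 / p) * ENNReal.ofReal R *
            PoincareSobolev.weightedLpAvg p w (ball x₀ R) G) ∧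
    (∀ p r : ℝ, 1 ≤ p → p < n → 1 ≤ r → r ≤ p → ∀ β C : ℝ,
      (∀ w : EuclideanSpace ℝ (Fin n) → ℝ≥0∞, PoincareSobolev.IsApWeight r w →
        ∀ (x₀ : EuclideanSpace ℝ (Fin n)) (R : ℝ), 0 < R →
        ∀ (f : EuclideanSpace ℝ (Fin n) → ℝ)
          (G : EuclideanSpace ℝ (Fin n) → EuclideanSpace ℝ (Fin n)),
          IntegrableOn f (ball x₀ R) volume →
          PoincareSobolev.HasWeakGradientOn (ball x₀ R) f G →
          PoincareSobolev.weightedLpAvg (PoincareSobolev.weightedSobolevExponent p r w) w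
              (ball x₀ R) (fun x => f x - ⨍ y in ball x₀ R, f y) ≤
            ENNReal.ofReal C * PoincareSobolev.apConst r w ^ β * ENNReal.ofReal R *
              PoincareSobolev.weightedLpAvg p w (ball x₀ R) G) →
      1 / p ≤ β) := by
  exact ⟨PoincareSobolev.poincareSobolev_le hn, fun p r hp hpn hr hrp β C h =>
    PoincareSobolev.one_div_le_of_forall_poincareSobolev_le hn hp hpn hr hrp h⟩
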